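/- **Setting.** Let $G=(V,E)$ be a directed graph with $n=|V|\ge 2$ nodes and $m=|E|$ edges, and let $D_v$ ($v\in V$) be a distribution over subsets of the in-neighbours of $v$ (triggering model: $T_v\sim D_v$ are drawn independently; nodes of a seed set $S$ are active at time $0$, and $v$ is active at time $t\ge1$ if it or a node of $T_v$ was active at time $t-1$). $\sigma(S)$ is the expected number of finally active nodes. There are $d\ge1$ strategies; $S_v\subseteq[d]$ is the set of strategies that may activate $v$, and for $j\in S_v$ the function $q_{v,j}:[0,\infty)\to[0,1]$ is non-decreasing and concave with $q_{v,j}(0)=0$. Under a strategy mix $x\in\mathbb R_+^d$ each node $v$ is independently a seed with probability $h_v(x)=1-\prod_{j\in S_v}(1-q_{v,j}(x_j))$, and $g(x)=\sum_{A\subseteq V}\sigma(A)\prod_{u\in A}h_u(x)\prod_{v\notin A}(1-h_v(x))$. Given $\delta>0$ and a budget $k$ that is a positive integer multiple of $\delta$, $x$ is feasible if all $x_j\in\{0,\delta,2\delta,\dots\}$ and $\sum_j x_j\le k$; LIM asks to maximize $g$ over the feasible $x$, with optimal value $\mathrm{OPT}$. Let $M=\min(k\delta^{-1}\ln d,\ d\ln(k\delta^{-1}))$.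 **Algorithm IMM-PRR**, with accuracy $\varepsilon>0$ and confidence $\ell>0$. A random reverse reachable (RR) set consists of the nodes that can reach a uniformly random root in the graph of the edges $(w,u)$ with $w\in T_u$; it is generated by reverse search. For a list $\mathcal R$ of RR sets let $\hat g_{\mathcal R}(x)=\frac n{|\mathcal R|}\sum_{R\in\mathcal R}\bigl(1-\prod_{v\in R}(1-h_v(x))\bigr)$. Lattice greedy on $\mathcal R$ starts with $x=0$ and makes $k\delta^{-1}$ rounds, each of which replaces $x$ by $x+\delta e_j$ for a $j$ that maximizes $\Delta_j=\hat g_{\mathcal R}(x+\delta e_j)-\hat g_{\mathcal R}(x)$ (up to the factor $n/|\mathcal R|$, this is computed from the stored products $s_i=\prod_{v\in R_i}\prod_{j'\in S_v}(1-q_{v,j'}(x_{j'}))$ by one scan, for every $j$, of the list of the pairs $(i,v)$ with $v\in R_i$, $j\in S_v$). Put $\alpha(\ell)=\sqrt{\ell\ln n+\ln2}$, $\beta(\ell)=\sqrt{(1-1/e)(M+\alpha(\ell)^2)}$, $\lambda^*(\ell)=2n((1-1/e)\alpha(\ell)+\beta(\ell))^2\varepsilon^{-2}$. The sampling phase finds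 by binary search a $\gamma$ with $\lceil\lambda^*(\ell+\gamma)\rceil/n^{\ell+\gamma}\le 1/n^{\ell}$ and puts $\ell'=\ell+\gamma+\ln2/\ln n$, $\varepsilon'=\sqrt2\,\varepsilon$, $\lambda'=(2+\frac23\varepsilon')(M+\ell'\ln n+\ln\log_2 n)\,n/\varepsilon'^2$, $\mathrm{LB}=1$, $\mathcal R=\emptyset$. For $i=1,\dots,\lfloor\log_2 n\rfloor$, with $y=n/2^i$, it adds independent RR sets while $|\mathcal R|\le\lambda'/y$ and computes $x$ by lattice greedy on $\mathcal R$; if $\hat g_{\mathcal R}(x)\ge(1+\varepsilon')y$, it sets $\mathrm{LB}=\hat g_{\mathcal R}(x)/(1+\varepsilon')$ and leaves the loop. Then it adds RR sets while $|\mathcal R|\le\lambda^*(\ell')/\mathrm{LB}$. The output is the result of lattice greedy on the final $\mathcal R$. Running time is counted in steps of a unit-cost random access machine with exact real arithmetic, on which an evaluation of $q_{v,j}$ takes constant time and drawing $T_v$ takes time proportional to the in-degree of $v$ (plus one). **Theorem.** 1. If $k\delta^{-1}\ge2$, then with probability at least $1-1/n^{\ell}$ the output of IMM-PRR is a $(1-1/e-\varepsilon)$-approximate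 solution of LIM, that is, a feasible $x$ with $g(x)\ge(1-1/e-\varepsilon)\,\mathrm{OPT}$. 2. For all constants $c>0$ and $\ell_0>0$ there is a constant $C$, depending only on $c$ and $\ell_0$, such that, whenever $n^{-c}\le\varepsilon\le1$, $\ell\ge\ell_0$, every strategy $j\in[d]$ belongs to some $S_v$, and $\mathrm{OPT}\ge\max_{v\in V}\sigma(\{v\})$, the expected running time of IMM-PRR is at most $$C\cdot k\delta^{-1}\Bigl(\max_{v\in V}|S_v|\Bigr)\frac{(M+\ell\ln n)(n+m)}{\varepsilon^2}.$$ -/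

import Mathlib

open MeasureTheory
open scoped ENNReal

noncomputable section

/-! ### The triggering model -/

/-- A directed graph on the nodes `Fin n` with edge set `E` (the pair `(u, v)` is the edge from
`u` to `v`), together with, for every node `v`, a distribution `D v` over the subsets of the
in-neighbours of `v`. -/
structure TriggeringModel (n : ℕ) where
  E : Finset (Fin n × Fin n)
  D : Fin n → PMF (Finset (Fin n))
  D_subset : ∀ v, ∀ T ∈ (D v).support, ∀ u ∈ T, (u, v) ∈ E

namespace TriggeringModel

variable {n : ℕ} (G : TriggeringModel n)

/-- The number `m` of edges. -/
def numEdges : ℕ := G.E.card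

/-- The in-degree of a node. -/
def inDegree (v : Fin n) : ℕ := (G.E.filter fun e => e.2 = v).card

/-- The set of active nodes at time `t`, for the triggering sets `T` and the seed set `S`. -/
def activeAt (T : Fin n → Finset (Fin n)) (S : Finset (Fin n)) : ℕ → Finset (Fin n)
  | 0 => S
  | t + 1 => activeAt T S t ∪ Finset.univ.filter fun v => ∃ u ∈ T v, u ∈ activeAt T S t

open Classical in
/-- The set of nodes that are active when the propagation has ended. -/
def finalActive (T : Fin n → Finset (Fin n)) (S : Finset (Fin n)) : Finset (Fin n) :=
  Finset.univ.filter fun v => ∃ t, v ∈ activeAt T S t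

/-- The influence spread `σ(S)`: the expected number of finally active nodes, when the triggering
sets `T v ∼ D v` are drawn independently. -/
def spread (S : Finset (Fin n)) : ℝ :=
  ∑ T : Fin n → Finset (Fin n), (∏ v, (G.D v (T v)).toReal) * ((finalActive T S).card : ℝ)

end TriggeringModel

/-! ### Lattice influence maximization under independent strategy activation -/

/-- A triggering model with `d` marketing strategies under independent strategy activation:
`S v` is the set of strategies that may activate `v`, and `q v j a` is the probability that
strategy `j`, used with amount `a ≥ 0`, activates `v` as a seed. -/
structure LIM (n d : ℕ) extends TriggeringModel n where
  S : Fin n → Finset (Fin d)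
  q : Fin n → Fin d → ℝ → ℝ
  q_zero : ∀ v, ∀ j ∈ S v, q v j 0 = 0
  q_le_one : ∀ v, ∀ j ∈ S v, ∀ a, 0 ≤ a → q v j a ≤ 1
  q_mono : ∀ v, ∀ j ∈ S v, MonotoneOn (q v j) (Set.Ici 0)
  q_concave : ∀ v, ∀ j ∈ S v, ConcaveOn ℝ (Set.Ici 0) (q v j)

namespace LIM

variable {n d : ℕ} (P : LIM n d)

/-- The strategy activation function `h_v`. -/
def h (v : Fin n) (x : Fin d → ℝ) : ℝ := 1 - ∏ j ∈ P.S v, (1 - P.q v j (x j))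

/-- The influence spread `g(x)` of a strategy mix `x`. -/
def g (x : Fin d → ℝ) : ℝ :=
  ∑ A : Finset (Fin n),
    P.spread A * (∏ u ∈ A, P.h u x) * ∏ v ∈ Finset.univ \ A, (1 - P.h v x)

/-- `max_v |S_v|`. -/
def maxS : ℕ := Finset.univ.sup fun v => (P.S v).card

end LIM

/-- The feasible strategy mixes: the vectors whose coordinates are among `0, δ, 2δ, …` and
whose total amount is at most the budget `k`. -/
def Feasible {d : ℕ} (k δ : ℝ) (x : Fin d → ℝ) : Prop :=
  (∀ j, ∃ a : ℕ, x j = a * δ) ∧ ∑ j, x j ≤ k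

/-- `x` is a `ρ`-approximate solution: it is feasible, and its influence spread is at least `ρ`
times that of every feasible strategy mix (so at least `ρ` times the optimum). -/
def LIM.IsApproxSolution {n d : ℕ} (P : LIM n d) (k δ ρ : ℝ) (x : Fin d → ℝ) : Prop :=
  Feasible k δ x ∧ ∀ y, Feasible k δ y → ρ * P.g y ≤ P.g x

/-! ### Step-counted programs

Programs are run on a unit-cost random access machine with exact real arithmetic: arithmetic
operations and elementary functions, comparisons, one evaluation of one `q v j`, one access to an
array cell, and appending to or advancing in a linked list take a bounded number of steps. -/

/-- The result of a program together with the number of steps that it took. -/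
structure Timed (α : Type) where
  val : α
  steps : ℕ

instance : Monad Timed where
  pure a := ⟨a, 0⟩
  bind p f := ⟨(f p.val).val, p.steps + (f p.val).steps⟩

/-- Spend `c` steps. -/
def tick (c : ℕ) : Timed Unit := ⟨(), c⟩

/-- Run `f` on `a` for `r` rounds. -/
def iterTimed {α : Type} (f : α → Timed α) : ℕ → α → Timed α
  | 0, a => pure a
  | r + 1, a => do
    let b ← f a
    iterTimed f r b

/-! ### Reverse reachable sets -/

/-- The randomness used for one RR set: its root, and a triggering set of every node. A program
looks only at the triggering sets of the nodes that it visits, and pays for each of them. -/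
abbrev Draw (n : ℕ) : Type := Fin n × (Fin n → Finset (Fin n))

namespace TriggeringModel

variable {n : ℕ} (G : TriggeringModel n)

/-- Inspect the in-neighbours in the list, putting the new ones into the RR set and on the stack.
The state is the pair of the stack and the RR set. Membership in the RR set is tested in one step
(by a mark at every node). -/
def scanNeighbours (l : List (Fin n)) (st : List (Fin n) × List (Fin n)) :
    Timed (List (Fin n) × List (Fin n)) :=
  l.foldlM (fun st w => do
    tick 1
    if w ∈ st.2 then pure st else pure (w :: st.1, st.2 ++ [w])) st

/-- Take a node `u` from the stack, draw its triggering set (in time proportional to the in-degree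
of `u`), inspect that set. -/
def visitNext (T : Fin n → Finset (Fin n)) (st : List (Fin n) × List (Fin n)) :
    Timed (List (Fin n) × List (Fin n)) :=
  match st.1 with
  | [] => pure st
  | u :: rest => do
    tick (1 + G.inDegree u)
    scanNeighbours (T u).toList (rest, st.2)

/-- Generate an RR set by reverse search from the root. Every node enters the stack at most once,
so that the stack is empty after `n` visits. At the end, the marks of the nodes of the RR set
are removed. -/
def genRR (ω : Draw n) : Timed (List (Fin n)) := do
  tick 1
  let st ← iterTimed (G.visitNext ω.2) n ([ω.1], [ω.1])
  tick st.2.length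
  pure st.2

/-- Generate RR sets and append them to `Rs` while `|Rs| ≤ θ`, that is, until
`|Rs| ≥ ⌊θ⌋ + 1`. The next RR set uses the first unused entry of the random tape `ω`. -/
def fill (ω : ℕ → Draw n) (θ : ℝ) (Rs : List (List (Fin n))) : Timed (List (List (Fin n))) :=
  iterTimed (fun Rs => do
    tick 1
    let R ← G.genRR (ω Rs.length)
    pure (Rs ++ [R])) (⌊θ⌋₊ + 1 - Rs.length) Rs

end TriggeringModel

/-! ### Lattice greedy on RR sets -/

/-- The variables `Δ_j`, `prev` and `ratio` of the scan of one list. -/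
structure ScanState where
  gain : ℝ
  prev : ℕ
  ratio : ℝ

namespace LIM

variable {n d : ℕ} (P : LIM n d)

/-- Set up the array `s`, with `s 0 = 0` and, for the `i`-th RR set `R` (`i ≥ 1`),
`s i = ∏_{v ∈ R} ∏_{j ∈ S_v} (1 - q_{v,j}(0))`, and the lists `L j` of the pairs `(i, v)` such that
`v` is in the `i`-th RR set and `j ∈ S_v`. -/
def initTables (Rs : List (List (Fin n))) :
    Timed ((ℕ → ℝ) × (Fin d → List (ℕ × Fin n))) := do
  tick (1 + d)
  (Rs.zipIdx 1).foldlM (fun st Ri => do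
    tick 1
    Ri.1.foldlM (fun st v => do
      tick 1
      (P.S v).toList.foldlM (fun st j => do
        tick 1
        pure (Function.update st.1 Ri.2 (st.1 Ri.2 * (1 - P.q v j 0)),
          Function.update st.2 j (st.2 j ++ [(Ri.2, v)]))) st)
      (Function.update st.1 Ri.2 1, st.2)) (fun _ => 0, fun _ => [])

/-- The factor `(1 - q_{v,j}(x_j + δ)) / (1 - q_{v,j}(x_j))`. -/
def factor (δ : ℝ) (x : Fin d → ℝ) (j : Fin d) (v : Fin n) : ℝ :=
  (1 - P.q v j (x j + δ)) / (1 - P.q v j (x j))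

/-- Compute `Δ_j` by one scan of the list of `j`. -/
def scanGain (δ : ℝ) (x : Fin d → ℝ) (s : ℕ → ℝ) (j : Fin d) (l : List (ℕ × Fin n)) :
    Timed ℝ := do
  let st ← l.foldlM (fun (st : ScanState) iv => do
    tick 1
    let st' : ScanState :=
      if iv.1 ≠ st.prev then ⟨st.gain + s st.prev * (1 - st.ratio), iv.1, 1⟩ else st
    pure { st' with ratio := st'.ratio * P.factor δ x j iv.2 }) ⟨0, 0, 1⟩
  tick 1
  pure (if st.prev ≠ 0 then st.gain + s st.prev * (1 - st.ratio) else st.gain)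

/-- One round of lattice greedy: compute all `Δ_j`, find the first maximal one, move one step of
length `δ` in this direction `j`, and update `s`. The state is the pair `(x, s)`. -/
def greedyRound [NeZero d] (δ : ℝ) (L : Fin d → List (ℕ × Fin n))
    (st : (Fin d → ℝ) × (ℕ → ℝ)) : Timed ((Fin d → ℝ) × (ℕ → ℝ)) := do
  let Δ ← (List.finRange d).foldlM (fun (Δ : Fin d → ℝ) j => do
    tick 1
    let a ← P.scanGain δ st.1 st.2 j (L j)
    pure (Function.update Δ j a)) (fun _ => 0)
  let j ← (List.finRange d).foldlM (fun (b : Fin d) j => do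
    tick 1
    pure (if Δ b < Δ j then j else b)) 0
  let s ← (L j).foldlM (fun (s : ℕ → ℝ) iv => do
    tick 1
    pure (Function.update s iv.1 (s iv.1 * P.factor δ st.1 j iv.2))) st.2
  tick 1
  pure (Function.update st.1 j (st.1 j + δ), s)

/-- Lattice greedy on the RR sets `Rs`: `k / δ` rounds, starting with the zero vector. -/
def lgreedy [NeZero d] (k δ : ℝ) (Rs : List (List (Fin n))) : Timed (Fin d → ℝ) := do
  tick d
  let t ← P.initTables Rs
  let st ← iterTimed (P.greedyRound δ t.2) ⌊k / δ⌋₊ (fun _ => 0, t.1)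
  pure st.1

/-- Compute the estimate `(n / |Rs|) * ∑_{R ∈ Rs} (1 - ∏_{v ∈ R} (1 - h_v(x)))` of `g(x)`. -/
def estimate (x : Fin d → ℝ) (Rs : List (List (Fin n))) : Timed ℝ := do
  let a ← Rs.foldlM (fun (a : ℝ) R => do
    tick 1
    let p ← R.foldlM (fun (p : ℝ) v => do
      tick 1
      (P.S v).toList.foldlM (fun (p : ℝ) j => do
        tick 1
        pure (p * (1 - P.q v j (x j)))) p) 1
    pure (a + (1 - p))) 0
  tick 1
  pure ((n : ℝ) / Rs.length * a)

end LIM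

/-! ### Parameters of the sampling phase -/

/-- `M = min ((k / δ) ln d, d ln (k / δ))`. -/
def paramM (d : ℕ) (k δ : ℝ) : ℝ := min (k / δ * Real.log d) (d * Real.log (k / δ))

/-- `α(ℓ)`. -/
def paramAlpha (n : ℕ) (ℓ : ℝ) : ℝ := √(ℓ * Real.log n + Real.log 2)

/-- `β(ℓ)`. -/
def paramBeta (n d : ℕ) (k δ ℓ : ℝ) : ℝ :=
  √((1 - 1 / Real.exp 1) * (paramM d k δ + paramAlpha n ℓ ^ 2))

/-- `λ*(ℓ)`. -/
def lamStar (n d : ℕ) (k δ ε ℓ : ℝ) : ℝ :=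
  2 * n * ((1 - 1 / Real.exp 1) * paramAlpha n ℓ + paramBeta n d k δ ℓ) ^ 2 / ε ^ 2

/-- `λ'`, for given values of `ε'` and `ℓ`. -/
def lamPrime (n d : ℕ) (k δ ε' ℓ : ℝ) : ℝ :=
  (2 + 2 / 3 * ε') * (paramM d k δ + ℓ * Real.log n + Real.log (Real.logb 2 n)) * n / ε' ^ 2

/-- The condition that the binary search for `γ` has to satisfy. -/
def GammaOK (n d : ℕ) (k δ ε ℓ γ : ℝ) : Prop :=
  (⌈lamStar n d k δ ε (ℓ + γ)⌉ : ℝ) / (n : ℝ) ^ (ℓ + γ) ≤ 1 / (n : ℝ) ^ ℓ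

open Classical in
/-- `r` steps of bisection between a lower bound `lo` and a value `hi` that satisfies the
condition. -/
def bisect (n d : ℕ) (k δ ε ℓ : ℝ) : ℕ → ℝ → ℝ → Timed ℝ
  | 0, _, hi => pure hi
  | r + 1, lo, hi => do
    tick 1
    if GammaOK n d k δ ε ℓ ((lo + hi) / 2) then bisect n d k δ ε ℓ r lo ((lo + hi) / 2)
    else bisect n d k δ ε ℓ r ((lo + hi) / 2) hi

/-- Compute `γ` by binary search: test `1, 2, 4, …` up to the first number `2 ^ J` that satisfies
the condition, and then bisect the interval from `0` to `2 ^ J` down to length `1`. -/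
def findGamma (n d : ℕ) (k δ ε ℓ : ℝ) : Timed ℝ := do
  let J := sInf {j : ℕ | GammaOK n d k δ ε ℓ (2 ^ j)}
  tick (J + 1)
  bisect n d k δ ε ℓ J 0 (2 ^ J)

/-! ### The algorithm -/

namespace LIM

variable {n d : ℕ} (P : LIM n d)

open Classical in
/-- The loop that looks for a lower bound `LB` of the optimum, over the given list of indices `i`;
`ε'` and `lam'` are the parameters `ε'` and `λ'`. The result is the pair of the RR sets
and `LB`. -/
def lowerBoundLoop [NeZero d] (ω : ℕ → Draw n) (k δ ε' lam' : ℝ) :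
    List ℕ → List (List (Fin n)) → Timed (List (List (Fin n)) × ℝ)
  | [], Rs => pure (Rs, 1)
  | i :: is, Rs => do
    tick 1
    let y : ℝ := (n : ℝ) / 2 ^ i
    let Rs' ← P.fill ω (lam' / y) Rs
    let x ← P.lgreedy k δ Rs'
    let a ← P.estimate x Rs'
    if (1 + ε') * y ≤ a then pure (Rs', a / (1 + ε'))
    else lowerBoundLoop ω k δ ε' lam' is Rs'

/-- The sampling phase. The loop runs over `i = 1, …, ⌊log₂ n⌋`. -/
def sampling [NeZero d] (ω : ℕ → Draw n) (k δ ε ℓ : ℝ) : Timed (List (List (Fin n))) := do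
  let γ ← findGamma n d k δ ε ℓ
  tick 1
  let ℓ' := ℓ + γ + Real.log 2 / Real.log n
  let ε' := √2 * ε
  let r ← P.lowerBoundLoop ω k δ ε' (lamPrime n d k δ ε' ℓ') (List.range' 1 (Nat.log 2 n)) []
  tick 1
  P.fill ω (lamStar n d k δ ε ℓ' / r.2) r.1

/-- The algorithm IMM-PRR on the random tape `ω`. -/
def immPRR [NeZero d] (k δ ε ℓ : ℝ) (ω : ℕ → Draw n) : Timed (Fin d → ℝ) := do
  tick n
  let Rs ← P.sampling ω k δ ε ℓ
  P.lgreedy k δ Rs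

end LIM

/-! ### The law of the random tape -/

namespace TriggeringModel

variable {n : ℕ} (G : TriggeringModel n)

/-- The law of one draw: a uniformly random root and independent triggering sets. -/
def drawLaw [NeZero n] : Measure (Draw n) :=
  (PMF.uniformOfFintype (Fin n)).toMeasure.prod (Measure.pi fun v => (G.D v).toMeasure)

instance [NeZero n] : IsProbabilityMeasure G.drawLaw := by
  unfold drawLaw; infer_instance

/-- The law of the random tape: a sequence of independent draws. -/
def tape [NeZero n] : Measure (ℕ → Draw n) := Measure.infinitePi fun _ => G.drawLaw

end TriggeringModel

end

/-!
Everything that the algorithm outputs depends on the random tape only through a number `N` of RR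
sets: the output is the lattice greedy solution on the first `N` entries of the tape. So the proof
compares the greedy solution for *fixed* `N` with the optimum, and treats `N` by union bounds.

**Greedy.** With the stored products, one round of lattice greedy finds a coordinate of maximal
marginal gain of the coverage `∑ R, (1 - ∏ v ∈ R, (1 - h_v(x)))` (`LIM.greedyRound_val`).
Nonnegative decreasing functions on the lattice with decreasing decrements are closed under
products, and concavity of `q` puts the functions `1 - q` into this class, so the coverage is
monotone and has diminishing returns (`LIM.cov_increment_anti`). The usual argument then gives the
factor `1 - 1/e` (`LIM.lgreedy_spec`).

**Approximation.** By duality between forward and reverse reachability, `g(x)` is `n` times the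
expected coverage `LIM.hit` of one RR set (`LIM.g_eq`). The output of greedy uses the whole
budget, and there are at most `exp M` such mixes (`card_budgetMixes_le`). Chernoff bounds, and a
union bound over these mixes, show that greedy on `N ≥ λ*(ℓ') / max(1, OPT)` RR sets is good
enough with high probability (`LIM.measure_lgreedy_fail`). Here `OPT` may be below `1`; then the
sampled values are at most `OPT`, and dividing them by `OPT` before applying the Chernoff bounds
makes up for it. Since `N` depends on the tape, the failure probabilities are summed over *all*
`N` above this threshold: they decay geometrically, and the condition on `γ` pays for the sum
(`final_failure_le`). It remains to see that `LB` rarely exceeds `max(1, OPT)`, which is a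
Chernoff bound again (`LIM.measure_loop_fail`).

**Running time.** An RR set costs in expectation at most `2 (n + m) OPT / n`, since `v` belongs to
it with probability `σ({v}) / n` (`TriggeringModel.integral_rrCost_le`). Round `i` of the sampling
phase works with about `λ' 2^i / n` RR sets, and greedy on them costs `(k/δ) max_v |S_v|` times
their size. If `z = 2^i OPT / n` is large, round `i` is reached only if the optimal mix was badly
underestimated in the preceding round, which has a probability that is exponentially small in `z`.
The cost of an RR set and this event are dependent, but dropping that RR set from the estimate
makes them independent, at the price of a constant factor
(`TriggeringModel.lintegral_cost_lower_tail`). So the expected cost of round `i` is bounded by a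
constant multiple of `z` times the probability, and this is at most a constant multiple of `φ(2z)
- φ(z)` with `φ(z) = z / (1 + z)`; the sum over the rounds telescopes (`LIM.sum_mul_slowProb_le`).
-/

noncomputable section

/-! ### Programs with step counts -/

namespace Timed

variable {α β : Type}

@[simp] theorem val_pure (a : α) : (pure a : Timed α).val = a := rfl
@[simp] theorem steps_pure (a : α) : (pure a : Timed α).steps = 0 := rfl
@[simp] theorem val_bind (p : Timed α) (f : α → Timed β) : (p >>= f).val = (f p.val).val := rfl
@[simp] theorem steps_bind (p : Timed α) (f : α → Timed β) :
    (p >>= f).steps = p.steps + (f p.val).steps := rfl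
@[simp] theorem steps_tick (c : ℕ) : (tick c).steps = c := rfl

theorem val_foldlM {σ : Type} {ι : Type} (f : σ → ι → Timed σ) (l : List ι) (a : σ) :
    (l.foldlM f a).val = l.foldl (fun a i => (f a i).val) a := by
  induction l generalizing a with
  | nil => rfl
  | cons i l ih => simp [List.foldlM_cons, ih]

theorem steps_foldlM_cons {σ : Type} {ι : Type} (f : σ → ι → Timed σ) (i : ι) (l : List ι)
    (a : σ) : ((i :: l).foldlM f a).steps = (f a i).steps + (l.foldlM f (f a i).val).steps := by
  simp [List.foldlM_cons]

theorem steps_foldlM_of_eq {σ : Type} {ι : Type} (f : σ → ι → Timed σ) (c : ι → ℕ)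
    (h : ∀ a i, (f a i).steps = c i) (l : List ι) (a : σ) :
    (l.foldlM f a).steps = (l.map c).sum := by
  induction l generalizing a with
  | nil => rfl
  | cons i l ih => rw [steps_foldlM_cons, ih, h]; simp

end Timed

theorem iterTimed_succ {α : Type} (f : α → Timed α) (r : ℕ) (a : α) :
    (iterTimed f (r + 1) a).val = (iterTimed f r (f a).val).val ∧
    (iterTimed f (r + 1) a).steps = (f a).steps + (iterTimed f r (f a).val).steps := by
  simp [iterTimed]

/-! ### Reverse reachable sets -/

namespace TriggeringModel

variable {n : ℕ} (G : TriggeringModel n)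

/-- The node `v` reaches the node `r` along edges `(w, u)` with `w ∈ T u`. -/
def Reaches (T : Fin n → Finset (Fin n)) (v r : Fin n) : Prop :=
  Relation.ReflTransGen (fun w u => w ∈ T u) v r

/-- Forward propagation and reverse reachability agree. -/
theorem mem_finalActive_iff (T : Fin n → Finset (Fin n)) (S : Finset (Fin n)) (r : Fin n) :
    r ∈ finalActive T S ↔ ∃ v ∈ S, Reaches T v r := by
  have step : ∀ t r, r ∈ activeAt T S (t + 1) ↔
      r ∈ activeAt T S t ∨ ∃ u ∈ T r, u ∈ activeAt T S t := by
    intro t r; simp [activeAt]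
  simp only [finalActive, Finset.mem_filter, Finset.mem_univ, true_and]
  constructor
  · rintro ⟨t, ht⟩
    induction t generalizing r with
    | zero => exact ⟨r, ht, .refl⟩
    | succ t ih =>
      rcases (step t r).1 ht with h | ⟨u, hu, h⟩
      · exact ih r h
      · obtain ⟨v, hv, hr⟩ := ih u h
        exact ⟨v, hv, hr.tail hu⟩
  · rintro ⟨v, hv, hr⟩
    induction hr with
    | refl => exact ⟨0, hv⟩
    | tail _ hbc ih =>
      obtain ⟨t, ht⟩ := ih
      exact ⟨t + 1, (step t _).2 (.inr ⟨_, hbc, ht⟩)⟩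

/-- The scan appends the list `N` of the new neighbours to the RR set, and pushes them. -/
theorem scanNeighbours_spec (l : List (Fin n)) (st : List (Fin n) × List (Fin n))
    (hst : st.2.Nodup) :
    ∃ N : List (Fin n), (scanNeighbours l st).val = (N.reverse ++ st.1, st.2 ++ N) ∧
      (st.2 ++ N).Nodup ∧ (∀ w ∈ N, w ∈ l) ∧ (∀ w ∈ l, w ∈ st.2 ++ N) ∧
      (scanNeighbours l st).steps = l.length := by
  induction l generalizing st with
  | nil => exact ⟨[], by simp [scanNeighbours], by simpa using hst, by simp, by simp,
      by simp [scanNeighbours]⟩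
  | cons w l ih =>
    by_cases hw : w ∈ st.2
    · obtain ⟨N, h1, h2, h3, h4, h5⟩ := ih st hst
      refine ⟨N, ?_, h2, fun v hv => List.mem_cons_of_mem _ (h3 v hv), ?_, ?_⟩
      · rw [← h1]; simp [scanNeighbours, List.foldlM_cons, hw]
      · intro v hv
        rcases List.mem_cons.1 hv with rfl | hv
        · exact List.mem_append_left _ hw
        · exact h4 v hv
      · simp only [scanNeighbours] at h5
        simp [scanNeighbours, List.foldlM_cons, hw, h5, add_comm]
    · obtain ⟨N, h1, h2, h3, h4, h5⟩ := ih (w :: st.1, st.2 ++ [w])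
        (List.nodup_append.2 ⟨hst, by simp, by rintro a ha b hb rfl; simp_all⟩)
      refine ⟨w :: N, ?_, by simpa using h2, ?_, ?_, ?_⟩
      · simp only [scanNeighbours] at h1
        simp [scanNeighbours, List.foldlM_cons, hw, h1]
      · intro v hv
        rcases List.mem_cons.1 hv with rfl | hv
        · exact List.mem_cons_self
        · exact List.mem_cons_of_mem _ (h3 v hv)
      · intro v hv
        rcases List.mem_cons.1 hv with rfl | hv
        · simp
        · simpa using h4 v hv
      · simp only [scanNeighbours] at h5
        simp [scanNeighbours, List.foldlM_cons, hw, h5, add_comm]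

/-- The state of the reverse search from `r` after `t` visits: the stack and the RR set, whose
nodes outside the stack are the visited ones. Either the stack is empty or `t` nodes have been
visited. -/
structure SearchInv (T : Fin n → Finset (Fin n)) (r : Fin n) (t : ℕ)
    (st : List (Fin n) × List (Fin n)) : Prop where
  nodup_set : st.2.Nodup
  nodup_stack : st.1.Nodup
  subset : ∀ v ∈ st.1, v ∈ st.2
  root_mem : r ∈ st.2
  reaches : ∀ v ∈ st.2, Reaches T v r
  closed : ∀ v ∈ st.2, v ∉ st.1 → ∀ w ∈ T v, w ∈ st.2
  count : st.1 = [] ∨ st.2.length = st.1.length + t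

/-- The cost of visiting a node. -/
def visitCost (T : Fin n → Finset (Fin n)) (v : Fin n) : ℕ := 1 + G.inDegree v + (T v).card

/-- A visit preserves the invariant, and its steps are accounted for by the visited nodes, which
are the nodes of the RR set outside the stack. -/
theorem visitNext_spec {T : Fin n → Finset (Fin n)} {r : Fin n} {t : ℕ}
    {st : List (Fin n) × List (Fin n)} (h : SearchInv T r t st) :
    SearchInv T r (t + 1) (G.visitNext T st).val ∧
    (G.visitNext T st).steps + ∑ v ∈ st.2.toFinset \ st.1.toFinset, G.visitCost T v =
      ∑ v ∈ (G.visitNext T st).val.2.toFinset \ (G.visitNext T st).val.1.toFinset,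
        G.visitCost T v := by
  obtain ⟨stk, R⟩ := st
  cases stk with
  | nil =>
    refine ⟨?_, by simp [visitNext]⟩
    obtain ⟨h1, h2, h3, h4, h5, h6, h7⟩ := h
    exact ⟨h1, h2, h3, h4, h5, h6, .inl rfl⟩
  | cons u rest =>
    obtain ⟨h1, h2, h3, h4, h5, h6, h7⟩ := h
    simp only at h1 h2 h3 h4 h5 h6 h7
    obtain ⟨N, e1, e2, e3, e4, e5⟩ := scanNeighbours_spec (T u).toList (rest, R) h1
    simp only at e1 e2 e3 e4 e5
    have hval : (G.visitNext T (u :: rest, R)).val = (N.reverse ++ rest, R ++ N) := by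
      simp [visitNext, e1]
    have hsteps : (G.visitNext T (u :: rest, R)).steps = G.visitCost T u := by
      simp [visitNext, e5, visitCost]
    have hNR : ∀ v ∈ N, v ∉ R := fun v hv hR => (List.nodup_append.1 e2).2.2 v hR v hv rfl
    have hu : u ∈ R := h3 u List.mem_cons_self
    have hur : u ∉ rest := (List.nodup_cons.1 h2).1
    have hrR : ∀ v ∈ rest, v ∈ R := fun v hv => h3 v (List.mem_cons_of_mem _ hv)
    rw [hval, hsteps]
    refine ⟨⟨e2, ?_, ?_, by simp [h4], ?_, ?_, .inr ?_⟩, ?_⟩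
    · simp only
      rw [List.nodup_append]
      refine ⟨List.nodup_reverse.2 (List.nodup_append.1 e2).2.1, (List.nodup_cons.1 h2).2, ?_⟩
      rintro a ha b hb rfl
      exact hNR a (by simpa using ha) (hrR a hb)
    · intro v hv
      simp only [List.mem_append, List.mem_reverse] at hv ⊢
      rcases hv with hv | hv
      · exact .inr hv
      · exact .inl (hrR v hv)
    · intro v hv
      simp only [List.mem_append] at hv
      rcases hv with hv | hv
      · exact h5 v hv
      · exact Relation.ReflTransGen.head (by simpa using e3 v hv) (h5 u hu)
    · intro v hv hv' w hw
      simp only [List.mem_append, List.mem_reverse, not_or] at hv hv' ⊢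
      by_cases huv : v = u
      · subst huv
        simpa using e4 w (by simpa using hw)
      · have hvR : v ∈ R := hv.resolve_right hv'.1
        exact .inl (h6 v hvR (by simp [huv, hv'.2]) w hw)
    · have := h7.resolve_left (by simp)
      simp at this ⊢
      omega
    · have : (R ++ N).toFinset \ (N.reverse ++ rest).toFinset =
          insert u (R.toFinset \ (u :: rest).toFinset) := by
        ext v
        simp only [List.toFinset_append, List.toFinset_reverse, Finset.mem_sdiff,
          Finset.mem_union, List.mem_toFinset, Finset.mem_insert, not_or,
          List.toFinset_cons]
        have := hNR v
        by_cases huv : v = u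
        · subst huv; tauto
        · tauto
      rw [this, Finset.sum_insert (by simp)]

theorem iterate_visitNext_spec {T : Fin n → Finset (Fin n)} {r : Fin n} (m t : ℕ)
    (st : List (Fin n) × List (Fin n)) (h : SearchInv T r t st) :
    SearchInv T r (t + m) (iterTimed (G.visitNext T) m st).val ∧
    (iterTimed (G.visitNext T) m st).steps +
        ∑ v ∈ st.2.toFinset \ st.1.toFinset, G.visitCost T v =
      ∑ v ∈ (iterTimed (G.visitNext T) m st).val.2.toFinset \
        (iterTimed (G.visitNext T) m st).val.1.toFinset, G.visitCost T v := by
  induction m generalizing t st with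
  | zero => exact ⟨by simpa [iterTimed] using h, by simp [iterTimed]⟩
  | succ m ih =>
    obtain ⟨a1, a2⟩ := G.visitNext_spec h
    obtain ⟨b1, b2⟩ := ih (t + 1) _ a1
    obtain ⟨c1, c2⟩ := iterTimed_succ (G.visitNext T) m st
    rw [c1, c2]
    refine ⟨by rwa [show t + (m + 1) = t + 1 + m by ring], ?_⟩
    rw [← b2, ← a2]; ring

/-- The RR set of a draw, as a list. -/
def rrList (ω : Draw n) : List (Fin n) := (G.genRR ω).val

/-- The cost of the visits of the nodes of the RR set of a draw. -/
def rrCost (ω : Draw n) : ℕ := ∑ v ∈ (G.rrList ω).toFinset, G.visitCost ω.2 v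

/-- Reverse search is correct, and it visits every node of the RR set exactly once. -/
theorem genRR_spec (ω : Draw n) :
    (G.rrList ω).Nodup ∧ (∀ v, v ∈ G.rrList ω ↔ Reaches ω.2 v ω.1) ∧
      (G.genRR ω).steps = 1 + G.rrCost ω + (G.rrList ω).length := by
  have h0 : SearchInv ω.2 ω.1 0 ([ω.1], [ω.1]) :=
    ⟨by simp, by simp, by simp, by simp, by simp [Reaches, Relation.ReflTransGen.refl],
      by simp +contextual, .inr (by simp)⟩
  obtain ⟨h, hs⟩ := G.iterate_visitNext_spec n 0 _ h0
  have hval : G.rrList ω = (iterTimed (G.visitNext ω.2) n ([ω.1], [ω.1])).val.2 := by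
    simp [rrList, genRR]
  -- More than `n` visits are impossible, so the stack is empty at the end.
  have hstk : (iterTimed (G.visitNext ω.2) n ([ω.1], [ω.1])).val.1 = [] := by
    rcases h.count with h' | h'
    · exact h'
    · have := h.nodup_set.length_le_card
      simp only [Fintype.card_fin] at this
      exact List.length_eq_zero_iff.1 (by omega)
  obtain ⟨h1, h2, h3, h4, h5, h6, -⟩ := h
  rw [hstk] at h6 hs
  rw [← hval] at h1 h4 h5 h6 hs
  refine ⟨h1, fun v => ⟨h5 v, fun hv => ?_⟩, ?_⟩
  · induction hv using Relation.ReflTransGen.head_induction_on with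
    | refl => exact h4
    | head hab _ ih => exact h6 _ ih (by simp) _ hab
  · have : (G.genRR ω).steps = 1 + (iterTimed (G.visitNext ω.2) n ([ω.1], [ω.1])).steps +
        (G.rrList ω).length := by
      simp [genRR, hval, add_assoc]
    rw [this]
    simp only [List.toFinset_nil, Finset.sdiff_empty, List.toFinset_cons, insert_empty_eq,
      Finset.sdiff_self, Finset.sum_empty, add_zero] at hs
    rw [hs, rrCost]

theorem length_rrList_le (ω : Draw n) : (G.rrList ω).length ≤ G.rrCost ω := by
  rw [rrCost, ← List.toFinset_card_of_nodup (G.genRR_spec ω).1, Finset.card_eq_sum_ones]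
  exact Finset.sum_le_sum fun v _ => by unfold visitCost; omega

theorem one_le_length_rrList (ω : Draw n) : 1 ≤ (G.rrList ω).length :=
  List.length_pos_of_mem (((G.genRR_spec ω).2.1 ω.1).2 .refl)

theorem steps_genRR_le (ω : Draw n) : (G.genRR ω).steps ≤ 3 * G.rrCost ω := by
  have h1 := (G.genRR_spec ω).2.2
  have h2 := G.length_rrList_le ω
  have h3 := G.one_le_length_rrList ω
  omega

/-- The RR sets of the first `N` draws of the random tape `ω`. -/
def rrPrefix (ω : ℕ → Draw n) (N : ℕ) : List (List (Fin n)) :=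
  (List.range N).map fun t => G.rrList (ω t)

@[simp] theorem length_rrPrefix (ω : ℕ → Draw n) (N : ℕ) : (G.rrPrefix ω N).length = N := by
  simp [rrPrefix]

theorem iterate_fill_spec (ω : ℕ → Draw n) (m N : ℕ) :
    let p := iterTimed (fun Rs : List (List (Fin n)) => do
      tick 1
      let R ← G.genRR (ω Rs.length)
      pure (Rs ++ [R])) m (G.rrPrefix ω N)
    p.val = G.rrPrefix ω (N + m) ∧ p.steps ≤ 4 * ∑ t ∈ Finset.Ico N (N + m), G.rrCost (ω t) := by
  induction m generalizing N with
  | zero => simp [iterTimed]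
  | succ m ih =>
    intro p
    obtain ⟨c1, c2⟩ := iterTimed_succ (fun Rs : List (List (Fin n)) => do
      tick 1
      let R ← G.genRR (ω Rs.length)
      pure (Rs ++ [R])) m (G.rrPrefix ω N)
    have hv : G.rrPrefix ω N ++ [(G.genRR (ω N)).val] = G.rrPrefix ω (N + 1) := by
      simp [rrPrefix, List.range_succ, rrList]
    obtain ⟨h1, h2⟩ := ih (N + 1)
    simp only [Timed.val_bind, Timed.val_pure, Timed.steps_bind, Timed.steps_tick,
      Timed.steps_pure, length_rrPrefix, hv] at c1 c2
    refine ⟨c1.trans (h1.trans (by rw [add_assoc, add_comm 1 m])), ?_⟩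
    have h3 := G.steps_genRR_le (ω N)
    have h4 := G.length_rrList_le (ω N)
    have h5 := G.one_le_length_rrList (ω N)
    rw [show N + (m + 1) = N + 1 + m by ring, Finset.sum_eq_sum_Ico_succ_bot (by omega)]
    have : p.steps = _ := c2
    rw [this]
    omega

theorem fill_spec (ω : ℕ → Draw n) (θ : ℝ) (N : ℕ) :
    (G.fill ω θ (G.rrPrefix ω N)).val = G.rrPrefix ω (max N (⌊θ⌋₊ + 1)) ∧
    (G.fill ω θ (G.rrPrefix ω N)).steps ≤
      4 * ∑ t ∈ Finset.range (max N (⌊θ⌋₊ + 1)), G.rrCost (ω t) := by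
  obtain ⟨h1, h2⟩ := G.iterate_fill_spec ω (⌊θ⌋₊ + 1 - N) N
  have e : N + (⌊θ⌋₊ + 1 - N) = max N (⌊θ⌋₊ + 1) := by omega
  simp only [fill, length_rrPrefix]
  rw [e] at h1 h2
  refine ⟨h1, h2.trans (Nat.mul_le_mul_left _ (Finset.sum_le_sum_of_subset ?_))⟩
  intro t; simp

end TriggeringModel

/-! ### Correctness and cost of lattice greedy -/

namespace LIM

variable {n d : ℕ} (P : LIM n d)

theorem q_nonneg {v : Fin n} {j : Fin d} (hj : j ∈ P.S v) {a : ℝ} (ha : 0 ≤ a) :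
    0 ≤ P.q v j a :=
  (P.q_zero v j hj).symm.le.trans (P.q_mono v j hj Set.self_mem_Ici ha ha)

/-- The probability that no node of `R` is a seed. -/
def surv (R : List (Fin n)) (x : Fin d → ℝ) : ℝ := (R.map fun v => 1 - P.h v x).prod

/-- The expected number of the sets in `Rs` that contain a seed. -/
def cov (Rs : List (List (Fin n))) (x : Fin d → ℝ) : ℝ := (Rs.map fun R => 1 - P.surv R x).sum

theorem one_sub_h (v : Fin n) (x : Fin d → ℝ) :
    1 - P.h v x = ∏ j ∈ P.S v, (1 - P.q v j (x j)) := by simp [h]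

/-- The list of the pairs `(i, v)` such that the set with index `i` contains `v` and `j ∈ S v`,
for a list `Z` of indexed sets. -/
def pairs (Z : List (List (Fin n) × ℕ)) (j : Fin d) : List (ℕ × Fin n) :=
  Z.flatMap fun Ri => (Ri.1.filter fun v => j ∈ P.S v).map fun v => (Ri.2, v)

/-- The factors `1 - q v j 0` are `1`, so that only the lists change. -/
theorem initTables_inner (i : ℕ) (v : Fin n) (l : List (Fin d)) (hl : l.Nodup)
    (hq : ∀ j ∈ l, P.q v j 0 = 0) (st : (ℕ → ℝ) × (Fin d → List (ℕ × Fin n))) :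
    l.foldl (fun st j => (Function.update st.1 i (st.1 i * (1 - P.q v j 0)),
      Function.update st.2 j (st.2 j ++ [(i, v)]))) st =
    (st.1, fun j => if j ∈ l then st.2 j ++ [(i, v)] else st.2 j) := by
  induction l generalizing st with
  | nil => simp
  | cons a l ih =>
    rw [List.foldl_cons, ih (List.nodup_cons.1 hl).2 (fun j hj => hq j (List.mem_cons_of_mem _ hj))]
    have ha := (List.nodup_cons.1 hl).1
    ext j
    · simp [hq a]
    · by_cases hja : j = a
      · subst hja; simp [ha]
      · simp [hja]

theorem initTables_mid (i : ℕ) (R : List (Fin n)) (st : (ℕ → ℝ) × (Fin d → List (ℕ × Fin n))) :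
    R.foldl (fun st v => (P.S v).toList.foldl (fun st j =>
      (Function.update st.1 i (st.1 i * (1 - P.q v j 0)),
        Function.update st.2 j (st.2 j ++ [(i, v)]))) st) st =
    (st.1, fun j => st.2 j ++ (R.filter fun v => j ∈ P.S v).map fun v => (i, v)) := by
  induction R generalizing st with
  | nil => simp
  | cons v R ih =>
    rw [List.foldl_cons, P.initTables_inner i v _ (Finset.nodup_toList _)
      (fun j hj => P.q_zero v j (by simpa using hj)), ih]
    ext j
    · rfl
    · by_cases hj : j ∈ P.S v <;> simp [hj]

theorem initTables_outer (Z : List (List (Fin n) × ℕ))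
    (st : (ℕ → ℝ) × (Fin d → List (ℕ × Fin n))) :
    Z.foldl (fun st Ri => Ri.1.foldl (fun st v => (P.S v).toList.foldl (fun st j =>
      (Function.update st.1 Ri.2 (st.1 Ri.2 * (1 - P.q v j 0)),
        Function.update st.2 j (st.2 j ++ [(Ri.2, v)]))) st)
        (Function.update st.1 Ri.2 1, st.2)) st =
    (fun i => if i ∈ Z.map Prod.snd then 1 else st.1 i, fun j => st.2 j ++ P.pairs Z j) := by
  induction Z generalizing st with
  | nil => simp [pairs]
  | cons p Z ih =>
    rw [List.foldl_cons, P.initTables_mid, ih]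
    ext j
    · by_cases hj : j = p.2
      · subst hj; simp
      · rw [List.map_cons]
        simp only [List.mem_cons, hj, false_or, Function.update_of_ne hj]
    · simp [pairs]

theorem initTables_val (Rs : List (List (Fin n))) :
    (P.initTables Rs).val = (fun i => if i ∈ (Rs.zipIdx 1).map Prod.snd then 1 else 0,
      P.pairs (Rs.zipIdx 1)) := by
  simp only [initTables, Timed.val_bind, Timed.val_foldlM, Timed.val_pure]
  rw [P.initTables_outer]
  simp

theorem initTables_steps (Rs : List (List (Fin n))) :
    (P.initTables Rs).steps =
      1 + d + (Rs.map fun R => 1 + (R.map fun v => 1 + (P.S v).card).sum).sum := by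
  simp only [initTables, Timed.steps_bind, Timed.steps_tick]
  congr 1
  rw [Timed.steps_foldlM_of_eq _ (fun Ri => 1 + (Ri.1.map fun v => 1 + (P.S v).card).sum)]
  · rw [show (fun Ri : List (Fin n) × ℕ => 1 + (Ri.1.map fun v => 1 + (P.S v).card).sum) =
      (fun R : List (Fin n) => 1 + (R.map fun v => 1 + (P.S v).card).sum) ∘ Prod.fst from rfl,
      ← List.map_map, List.zipIdx_map_fst]
  · intro a Ri
    simp only [Timed.steps_bind, Timed.steps_tick]
    congr 1
    apply Timed.steps_foldlM_of_eq _ (fun v => 1 + (P.S v).card)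
    intro a v
    simp only [Timed.steps_bind, Timed.steps_tick]
    congr 1
    rw [Timed.steps_foldlM_of_eq _ (fun _ => 1) (by intros; rfl)]
    simp

/-- One step of the scan of a list, with the factors `f`. -/
def scanStep (s : ℕ → ℝ) (f : Fin n → ℝ) (st : ScanState) (iv : ℕ × Fin n) : ScanState :=
  let st' : ScanState :=
    if iv.1 ≠ st.prev then ⟨st.gain + s st.prev * (1 - st.ratio), iv.1, 1⟩ else st
  { st' with ratio := st'.ratio * f iv.2 }

/-- The gain of the scan so far, including the contribution of the current set. -/
def scanTotal (s : ℕ → ℝ) (st : ScanState) : ℝ := st.gain + s st.prev * (1 - st.ratio)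

theorem scan_block_of_eq (s : ℕ → ℝ) (f : Fin n → ℝ) (i : ℕ) (B : List (Fin n)) (st : ScanState)
    (h : st.prev = i) :
    (B.map fun v => (i, v)).foldl (scanStep s f) st =
      { st with ratio := st.ratio * (B.map f).prod } := by
  induction B generalizing st with
  | nil => simp
  | cons v B ih =>
    simp only [List.map_cons, List.foldl_cons]
    rw [ih _ (by simp [scanStep, h])]
    simp [scanStep, h, mul_assoc]

/-- The entries `(i, v)` of a list that belong to one set `i` are consecutive, and together they
contribute one summand to the gain. -/
theorem scan_block (s : ℕ → ℝ) (f : Fin n → ℝ) (i : ℕ) (B : List (Fin n)) (st : ScanState)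
    (h : st.prev ≠ i) :
    let st' := (B.map fun v => (i, v)).foldl (scanStep s f) st
    scanTotal s st' = scanTotal s st + s i * (1 - (B.map f).prod) ∧
      (st'.prev = st.prev ∨ st'.prev = i) := by
  cases B with
  | nil => simp
  | cons v B =>
    simp only [List.map_cons, List.foldl_cons]
    rw [scan_block_of_eq _ _ _ _ _ (by simp [scanStep, h.symm])]
    simp [scanStep, h.symm, scanTotal]

theorem scan_pairs (s : ℕ → ℝ) (f : Fin n → ℝ) (j : Fin d) (Z : List (List (Fin n) × ℕ))
    (hZ : (Z.map Prod.snd).Nodup) (st : ScanState) (h : st.prev ∉ Z.map Prod.snd) :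
    scanTotal s ((P.pairs Z j).foldl (scanStep s f) st) = scanTotal s st +
      (Z.map fun p => s p.2 * (1 - ((p.1.filter fun v => j ∈ P.S v).map f).prod)).sum := by
  induction Z generalizing st with
  | nil => simp [pairs]
  | cons p Z ih =>
    simp only [List.map_cons, List.nodup_cons, List.mem_cons, not_or] at hZ h
    obtain ⟨h1, h2⟩ := scan_block s f p.2 (p.1.filter fun v => j ∈ P.S v) st h.1
    simp only [pairs, List.flatMap_cons, List.foldl_append] at ih ⊢
    rw [ih hZ.2, h1]
    · simp [add_assoc]
    · rcases h2 with h2 | h2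
      · rw [h2]; exact h.2
      · rw [h2]; exact hZ.1

theorem scanGain_val (δ : ℝ) (x : Fin d → ℝ) (s : ℕ → ℝ) (hs : s 0 = 0) (j : Fin d)
    (Z : List (List (Fin n) × ℕ)) (hZ : (Z.map Prod.snd).Nodup) (h0 : 0 ∉ Z.map Prod.snd) :
    (P.scanGain δ x s j (P.pairs Z j)).val = (Z.map fun p => s p.2 *
      (1 - ((p.1.filter fun v => j ∈ P.S v).map (P.factor δ x j)).prod)).sum := by
  have h := P.scan_pairs s (P.factor δ x j) j Z hZ ⟨0, 0, 1⟩ h0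
  have h2 : (P.scanGain δ x s j (P.pairs Z j)).val =
      scanTotal s ((P.pairs Z j).foldl (scanStep s (P.factor δ x j)) ⟨0, 0, 1⟩) := by
    simp only [scanGain, Timed.val_bind, Timed.val_foldlM, Timed.val_pure]
    change (if ((P.pairs Z j).foldl (scanStep s (P.factor δ x j)) ⟨0, 0, 1⟩).prev ≠ 0 then _
      else _) = _
    split_ifs with h'
    · rfl
    · rw [not_not] at h'
      rw [scanTotal, h', hs]
      simp only [zero_mul, add_zero]
      rfl
  rw [h2, h]
  simp [scanTotal]

theorem scanGain_steps (δ : ℝ) (x : Fin d → ℝ) (s : ℕ → ℝ) (j : Fin d) (l : List (ℕ × Fin n)) :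
    (P.scanGain δ x s j l).steps = l.length + 1 := by
  simp only [scanGain, Timed.steps_bind, Timed.steps_tick, Timed.steps_pure, add_zero]
  rw [Timed.steps_foldlM_of_eq _ (fun _ => 1) (by intros; rfl)]
  simp

/-- Where `1 - q v j (x j)` vanishes, so does `1 - q v j (x j + δ)`; therefore the division by
zero in the factor is harmless. -/
theorem one_sub_h_mul_factor {δ : ℝ} (hδ : 0 ≤ δ) {x : Fin d → ℝ} (hx : ∀ j, 0 ≤ x j)
    (j : Fin d) (v : Fin n) :
    (1 - P.h v x) * (if j ∈ P.S v then P.factor δ x j v else 1) =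
      1 - P.h v (Function.update x j (x j + δ)) := by
  rw [one_sub_h, one_sub_h]
  split_ifs with hj
  · rw [← Finset.mul_prod_erase _ _ hj, ← Finset.mul_prod_erase _ _ hj]
    have : ∏ i ∈ (P.S v).erase j, (1 - P.q v i (Function.update x j (x j + δ) i)) =
        ∏ i ∈ (P.S v).erase j, (1 - P.q v i (x i)) := by
      refine Finset.prod_congr rfl fun i hi => ?_
      rw [Function.update_of_ne (Finset.ne_of_mem_erase hi)]
    rw [this, Function.update_self, factor]
    by_cases h0 : 1 - P.q v j (x j) = 0
    · have hd : 0 ≤ x j + δ := add_nonneg (hx j) hδ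
      have h1 := P.q_mono v j hj (hx j) hd (by linarith)
      have h2 := P.q_le_one v j hj _ hd
      have h3 : 1 - P.q v j (x j + δ) = 0 := by linarith
      rw [h0, h3]; simp
    · field_simp
  · rw [mul_one]
    refine Finset.prod_congr rfl fun i hi => ?_
    rw [Function.update_of_ne (by rintro rfl; exact hj hi)]

theorem surv_mul_factor {δ : ℝ} (hδ : 0 ≤ δ) {x : Fin d → ℝ} (hx : ∀ j, 0 ≤ x j) (j : Fin d)
    (R : List (Fin n)) :
    P.surv R x * ((R.filter fun v => j ∈ P.S v).map (P.factor δ x j)).prod =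
      P.surv R (Function.update x j (x j + δ)) := by
  induction R with
  | nil => simp [surv]
  | cons v R ih =>
    have h := P.one_sub_h_mul_factor hδ hx j v
    simp only [surv, List.map_cons, List.prod_cons] at ih ⊢
    rw [← ih, ← h]
    by_cases hj : j ∈ P.S v <;> simp [hj] <;> ring

theorem foldl_update_of_notMem (f : Fin n → ℝ) (i : ℕ) (l : List (ℕ × Fin n))
    (h : ∀ p ∈ l, p.1 ≠ i) (s : ℕ → ℝ) :
    l.foldl (fun s iv => Function.update s iv.1 (s iv.1 * f iv.2)) s i = s i := by
  induction l generalizing s with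
  | nil => rfl
  | cons p l ih =>
    rw [List.foldl_cons, ih fun p hp => h p (List.mem_cons_of_mem _ hp),
      Function.update_of_ne (h p List.mem_cons_self).symm]

theorem foldl_update_block (f : Fin n → ℝ) (i : ℕ) (B : List (Fin n)) (s : ℕ → ℝ) :
    (B.map fun v => (i, v)).foldl (fun s iv => Function.update s iv.1 (s iv.1 * f iv.2)) s i =
      s i * (B.map f).prod := by
  induction B generalizing s with
  | nil => simp
  | cons v B ih => rw [List.map_cons, List.foldl_cons, ih]; simp [mul_assoc]

theorem mem_pairs_fst {Z : List (List (Fin n) × ℕ)} {j : Fin d} {p : ℕ × Fin n}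
    (hp : p ∈ P.pairs Z j) : p.1 ∈ Z.map Prod.snd := by
  simp only [pairs, List.mem_flatMap, List.mem_map] at hp
  obtain ⟨a, ha, v, -, rfl⟩ := hp
  exact List.mem_map_of_mem ha

theorem foldl_update_pairs (f : Fin n → ℝ) (j : Fin d) (Z : List (List (Fin n) × ℕ))
    (hZ : (Z.map Prod.snd).Nodup) (s : ℕ → ℝ) (p : List (Fin n) × ℕ) (hp : p ∈ Z) :
    (P.pairs Z j).foldl (fun s iv => Function.update s iv.1 (s iv.1 * f iv.2)) s p.2 =
      s p.2 * ((p.1.filter fun v => j ∈ P.S v).map f).prod := by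
  induction Z generalizing s with
  | nil => simp at hp
  | cons a Z ih =>
    simp only [List.map_cons, List.nodup_cons] at hZ
    have hcons : P.pairs (a :: Z) j =
        ((a.1.filter fun v => j ∈ P.S v).map fun v => (a.2, v)) ++ P.pairs Z j := by
      simp [pairs]
    rw [hcons, List.foldl_append]
    rcases List.mem_cons.1 hp with rfl | hp
    · rw [foldl_update_of_notMem, foldl_update_block]
      intro r hr hre
      exact hZ.1 (hre ▸ P.mem_pairs_fst hr)
    · rw [ih hZ.2 _ hp, foldl_update_of_notMem]
      intro r hr hre
      simp only [List.mem_map] at hr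
      obtain ⟨v, -, rfl⟩ := hr
      exact hZ.1 (by rw [show a.2 = p.2 from hre]; exact List.mem_map_of_mem hp)

theorem foldl_update_all (f : Fin d → ℝ) (l : List (Fin d)) (Δ : Fin d → ℝ) (j : Fin d) :
    l.foldl (fun Δ j => Function.update Δ j (f j)) Δ j = if j ∈ l then f j else Δ j := by
  induction l generalizing Δ with
  | nil => simp
  | cons a l ih =>
    rw [List.foldl_cons, ih]
    by_cases h : j ∈ l
    · simp [h]
    · by_cases hja : j = a
      · subst hja; simp
      · simp [h, hja]

theorem foldl_argmax (Δ : Fin d → ℝ) (l : List (Fin d)) (b : Fin d) :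
    Δ b ≤ Δ (l.foldl (fun b j => if Δ b < Δ j then j else b) b) ∧
    ∀ j ∈ l, Δ j ≤ Δ (l.foldl (fun b j => if Δ b < Δ j then j else b) b) := by
  induction l generalizing b with
  | nil => simp
  | cons a l ih =>
    rw [List.foldl_cons]
    obtain ⟨h1, h2⟩ := ih (if Δ b < Δ a then a else b)
    have hb : Δ b ≤ Δ (if Δ b < Δ a then a else b) ∧ Δ a ≤ Δ (if Δ b < Δ a then a else b) := by
      split_ifs with h
      · exact ⟨h.le, le_rfl⟩
      · exact ⟨le_rfl, not_lt.1 h⟩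
    refine ⟨hb.1.trans h1, fun j hj => ?_⟩
    rcases List.mem_cons.1 hj with rfl | hj
    · exact hb.2.trans h1
    · exact h2 j hj

/-- The invariant of lattice greedy for the state `(x, s)`: the array `s` holds the products that
belong to the strategy mix `x`. -/
structure TableInv (Z : List (List (Fin n) × ℕ)) (st : (Fin d → ℝ) × (ℕ → ℝ)) : Prop where
  nonneg : ∀ j, 0 ≤ st.1 j
  zero : st.2 0 = 0
  eq_surv : ∀ p ∈ Z, st.2 p.2 = P.surv p.1 st.1

/-- One round keeps the stored products correct, and it moves in a direction `j` of maximal marginal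
gain. -/
theorem greedyRound_val [NeZero d] {δ : ℝ} (hδ : 0 ≤ δ) (Z : List (List (Fin n) × ℕ))
    (hZ : (Z.map Prod.snd).Nodup) (h0 : 0 ∉ Z.map Prod.snd) (st : (Fin d → ℝ) × (ℕ → ℝ))
    (h : P.TableInv Z st) :
    P.TableInv Z (P.greedyRound δ (P.pairs Z) st).val ∧
    ∃ j, (P.greedyRound δ (P.pairs Z) st).val.1 = Function.update st.1 j (st.1 j + δ) ∧
      ∀ j', P.cov (Z.map Prod.fst) (Function.update st.1 j' (st.1 j' + δ)) ≤
        P.cov (Z.map Prod.fst) (Function.update st.1 j (st.1 j + δ)) := by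
  obtain ⟨x, s⟩ := st
  obtain ⟨hx, hs, hZs⟩ := h
  simp only at hx hs hZs
  set Δ : Fin d → ℝ := fun j => (P.scanGain δ x s j (P.pairs Z j)).val with hΔ
  have hΔ2 : ∀ j, Δ j = P.cov (Z.map Prod.fst) (Function.update x j (x j + δ)) -
      P.cov (Z.map Prod.fst) x := by
    intro j
    rw [hΔ]
    simp only
    rw [P.scanGain_val δ x s hs j Z hZ h0, cov, cov, List.map_map, List.map_map,
      eq_sub_iff_add_eq, ← List.sum_map_add]
    congr 1
    refine List.map_congr_left fun p hp => ?_
    rw [hZs p hp, mul_sub, mul_one, P.surv_mul_factor hδ hx]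
    simp only [Function.comp]
    ring
  set jm : Fin d := (List.finRange d).foldl (fun b j => if Δ b < Δ j then j else b) 0 with hjm
  have hval : (P.greedyRound δ (P.pairs Z) (x, s)).val = (Function.update x jm (x jm + δ),
      (P.pairs Z jm).foldl (fun s iv => Function.update s iv.1 (s iv.1 * P.factor δ x jm iv.2))
        s) := by
    have e : (List.finRange d).foldl (fun (Δ' : Fin d → ℝ) j => Function.update Δ' j (Δ j))
        (fun _ => 0) = Δ := by
      ext j; rw [foldl_update_all]; simp
    simp only [greedyRound, Timed.val_bind, Timed.val_foldlM, Timed.val_pure]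
    rw [e]
  rw [hval]
  refine ⟨⟨?_, ?_, ?_⟩, jm, rfl, fun j' => ?_⟩
  · intro j
    simp only
    by_cases hj : j = jm
    · subst hj; simpa using add_nonneg (hx _) hδ
    · simpa [hj] using hx j
  · simp only
    rw [foldl_update_of_notMem, hs]
    intro p hp hp0
    exact h0 (hp0 ▸ P.mem_pairs_fst hp)
  · intro p hp
    simp only
    rw [P.foldl_update_pairs _ _ _ hZ _ _ hp, hZs p hp, P.surv_mul_factor hδ hx]
  · have h1 := (foldl_argmax Δ (List.finRange d) 0).2 j' (by simp)
    rw [← hjm, hΔ2, hΔ2] at h1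
    linarith

theorem greedyRound_steps [NeZero d] (δ : ℝ) (L : Fin d → List (ℕ × Fin n))
    (st : (Fin d → ℝ) × (ℕ → ℝ)) :
    (P.greedyRound δ L st).steps ≤ 3 * d + 1 + 2 * ∑ j, (L j).length := by
  simp only [greedyRound, Timed.steps_bind, Timed.steps_tick, Timed.steps_pure]
  rw [Timed.steps_foldlM_of_eq _ (fun j => 2 + (L j).length) (by
      intro a i
      simp only [Timed.steps_bind, Timed.steps_tick, Timed.steps_pure, scanGain_steps]
      ring),
    Timed.steps_foldlM_of_eq _ (fun _ => 1) (by intros; rfl),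
    Timed.steps_foldlM_of_eq _ (fun _ => 1) (by intros; rfl)]
  simp only [List.map_const', List.length_finRange, List.sum_replicate, smul_eq_mul, mul_one]
  rw [← List.ofFn_eq_map, List.sum_ofFn, Finset.sum_add_distrib]
  have : ∀ j, (L j).length ≤ ∑ j, (L j).length := fun j =>
    Finset.single_le_sum (f := fun j => (L j).length) (fun _ _ => Nat.zero_le _)
      (Finset.mem_univ j)
  simp only [Finset.sum_const, Finset.card_univ, Fintype.card_fin, smul_eq_mul]
  refine (fun j => ?_ : ∀ j, _ + (_ + ((L j).length + 1)) ≤ _) _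
  have := this j
  omega

theorem sum_length_pairs (Z : List (List (Fin n) × ℕ)) :
    ∑ j, (P.pairs Z j).length = (Z.map fun p => (p.1.map fun v => (P.S v).card).sum).sum := by
  have block : ∀ R : List (Fin n), ∑ j, (R.filter fun v => j ∈ P.S v).length =
      (R.map fun v => (P.S v).card).sum := by
    intro R
    induction R with
    | nil => simp
    | cons v R ih =>
      rw [List.map_cons, List.sum_cons, ← ih]
      have : ∀ j, ((v :: R).filter fun v => j ∈ P.S v).length =
          (if j ∈ P.S v then 1 else 0) + (R.filter fun v => j ∈ P.S v).length := by
        intro j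
        by_cases h : j ∈ P.S v <;> simp [h, add_comm]
      rw [Finset.sum_congr rfl fun j _ => this j, Finset.sum_add_distrib]
      simp
  induction Z with
  | nil => simp [pairs]
  | cons p Z ih =>
    rw [List.map_cons, List.sum_cons, ← ih, ← block, ← Finset.sum_add_distrib]
    simp [pairs]

theorem card_S_le_maxS (v : Fin n) : (P.S v).card ≤ P.maxS :=
  Finset.le_sup (f := fun v => (P.S v).card) (Finset.mem_univ v)

theorem sum_card_S_le (R : List (Fin n)) :
    (R.map fun v => (P.S v).card).sum ≤ P.maxS * R.length := by
  induction R with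
  | nil => simp
  | cons v R ih =>
    have := P.card_S_le_maxS v
    simp only [List.map_cons, List.sum_cons, List.length_cons, mul_add, mul_one]
    omega

theorem iterate_greedyRound_steps [NeZero d] (δ : ℝ) (L : Fin d → List (ℕ × Fin n)) (r : ℕ)
    (st : (Fin d → ℝ) × (ℕ → ℝ)) :
    (iterTimed (P.greedyRound δ L) r st).steps ≤ r * (3 * d + 1 + 2 * ∑ j, (L j).length) := by
  induction r generalizing st with
  | zero => simp [iterTimed]
  | succ r ih =>
    have h1 := (iterTimed_succ (P.greedyRound δ L) r st).2
    have h2 := ih (P.greedyRound δ L st).val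
    have h3 := P.greedyRound_steps δ L st
    rw [h1, add_mul, one_mul]
    omega

theorem sum_scan_le (Rs : List (List (Fin n))) (hRs : ∀ R ∈ Rs, 1 ≤ R.length)
    (hc : 1 ≤ P.maxS) :
    (Rs.map fun R => 1 + (R.map fun v => 1 + (P.S v).card).sum).sum ≤
      3 * (P.maxS * (Rs.map List.length).sum) := by
  induction Rs with
  | nil => simp
  | cons R Rs ih =>
    have h1 := ih fun R hR => hRs R (List.mem_cons_of_mem _ hR)
    have h2 := hRs R List.mem_cons_self
    have h3 := P.sum_card_S_le R
    have h4 : R.length ≤ P.maxS * R.length := Nat.le_mul_of_pos_left _ hc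
    simp only [List.map_cons, List.sum_cons, List.sum_map_add, List.map_const',
      List.sum_replicate, smul_eq_mul, mul_one, mul_add] at h1 ⊢
    omega

theorem lgreedy_steps [NeZero d] {K : ℕ} {k δ : ℝ} (hK : 1 ≤ K) (hKk : ⌊k / δ⌋₊ = K)
    (hc : 1 ≤ P.maxS) (Rs : List (List (Fin n))) (hRs : ∀ R ∈ Rs, 1 ≤ R.length) :
    (P.lgreedy k δ Rs).steps ≤ 7 * (K * (d + P.maxS * (Rs.map List.length).sum)) := by
  simp only [lgreedy, Timed.steps_bind, Timed.steps_tick, Timed.steps_pure, initTables_steps,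
    hKk]
  have h1 := P.sum_scan_le Rs hRs hc
  have h2 := P.iterate_greedyRound_steps δ (P.initTables Rs).val.2 K
    ((fun _ => 0), (P.initTables Rs).val.1)
  have h3 : ∑ j, ((P.initTables Rs).val.2 j).length ≤ P.maxS * (Rs.map List.length).sum := by
    rw [initTables_val]
    simp only
    rw [sum_length_pairs]
    rw [show (fun p : List (Fin n) × ℕ => (p.1.map fun v => (P.S v).card).sum) =
      (fun R : List (Fin n) => (R.map fun v => (P.S v).card).sum) ∘ Prod.fst from rfl,
      ← List.map_map, List.zipIdx_map_fst]
    clear h1 h2 hRs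
    induction Rs with
    | nil => simp
    | cons R Rs ih =>
      have := P.sum_card_S_le R
      simp only [List.map_cons, List.sum_cons, mul_add] at ih ⊢
      omega
  have hd : 1 ≤ d := NeZero.one_le
  set W := P.maxS * (Rs.map List.length).sum
  set B := (Rs.map fun R => 1 + (R.map fun v => 1 + (P.S v).card).sum).sum
  have h4 : K * (3 * d + 1 + 2 * ∑ j, ((P.initTables Rs).val.2 j).length) ≤
      K * (4 * d + 2 * W) := Nat.mul_le_mul_left _ (by omega)
  have h5 : d + W ≤ K * (d + W) := Nat.le_mul_of_pos_left _ hK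
  have h6 : K * (4 * d + 2 * W) ≤ 4 * (K * (d + W)) := by nlinarith
  omega

theorem estimate_val (x : Fin d → ℝ) (Rs : List (List (Fin n))) :
    (P.estimate x Rs).val = (n : ℝ) / Rs.length * P.cov Rs x := by
  have h1 : ∀ (v : Fin n) (p : ℝ), (P.S v).toList.foldl
      (fun (p : ℝ) j => p * (1 - P.q v j (x j))) p = p * (1 - P.h v x) := by
    intro v p
    rw [one_sub_h, ← Finset.prod_map_toList]
    generalize (P.S v).toList = l
    induction l generalizing p with
    | nil => simp
    | cons j l ih => rw [List.foldl_cons, ih]; simp [mul_assoc]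
  have h2 : ∀ (R : List (Fin n)) (p : ℝ), R.foldl (fun p v => p * (1 - P.h v x)) p =
      p * P.surv R x := by
    intro R
    induction R with
    | nil => simp [surv]
    | cons v R ih => intro p; rw [List.foldl_cons, ih]; simp [surv, mul_assoc]
  have h3 : ∀ (Rs : List (List (Fin n))) (a : ℝ),
      Rs.foldl (fun a R => a + (1 - P.surv R x)) a = a + P.cov Rs x := by
    intro R
    induction R with
    | nil => simp [cov]
    | cons v R ih => intro p; rw [List.foldl_cons, ih]; simp [cov, add_assoc]
  simp only [estimate, Timed.val_bind, Timed.val_foldlM, Timed.val_pure, h1, h2, one_mul, h3,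
    zero_add]

theorem estimate_steps (x : Fin d → ℝ) (hc : 1 ≤ P.maxS) (Rs : List (List (Fin n)))
    (hRs : ∀ R ∈ Rs, 1 ≤ R.length) :
    (P.estimate x Rs).steps ≤ 3 * (P.maxS * (Rs.map List.length).sum) + 1 := by
  simp only [estimate, Timed.steps_bind, Timed.steps_tick, Timed.steps_pure]
  rw [Timed.steps_foldlM_of_eq _ (fun R => 1 + (R.map fun v => 1 + (P.S v).card).sum)]
  · exact Nat.add_le_add_right (P.sum_scan_le Rs hRs hc) _
  · intro a R
    simp only [Timed.steps_bind, Timed.steps_tick, Timed.steps_pure, add_zero]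
    congr 1
    apply Timed.steps_foldlM_of_eq _ (fun v => 1 + (P.S v).card)
    intro a v
    simp only [Timed.steps_bind, Timed.steps_tick]
    congr 1
    rw [Timed.steps_foldlM_of_eq _ (fun _ => 1) (by intros; rfl)]
    simp

end LIM

/-! ### The approximation guarantee of lattice greedy -/

/-- The lattice point with the coordinates `a j * δ`. -/
def latticeMix {d : ℕ} (δ : ℝ) (a : Fin d → ℕ) : Fin d → ℝ := fun j => a j * δ

theorem update_latticeMix {d : ℕ} (δ : ℝ) (a : Fin d → ℕ) (j : Fin d) :
    Function.update (latticeMix δ a) j (latticeMix δ a j + δ) =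
      latticeMix δ (a + Pi.single j 1) := by
  ext i
  by_cases h : i = j
  · subst h; simp [latticeMix]; ring
  · simp [latticeMix, h]

theorem feasible_iff {d K : ℕ} {k δ : ℝ} (hδ : 0 < δ) (hk : k = K * δ) (x : Fin d → ℝ) :
    Feasible k δ x ↔ ∃ a : Fin d → ℕ, ∑ j, a j ≤ K ∧ x = latticeMix δ a := by
  have key : ∀ a : Fin d → ℕ, ∑ j, latticeMix δ a j ≤ k ↔ ∑ j, a j ≤ K := by
    intro a
    simp only [latticeMix]
    rw [← Finset.sum_mul, hk, mul_le_mul_iff_left₀ hδ]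
    exact_mod_cast Iff.rfl
  constructor
  · rintro ⟨h1, h2⟩
    choose a ha using h1
    obtain rfl : x = latticeMix δ a := funext ha
    exact ⟨a, (key a).1 h2, rfl⟩
  · rintro ⟨a, h, rfl⟩
    exact ⟨fun j => ⟨a j, rfl⟩, (key a).2 h⟩

/-- Nonnegative antitone functions on the lattice whose decrements in every direction are
antitone. If `φ` has this property, then `-φ` is monotone and has diminishing returns. -/
structure DRDecreasing {d : ℕ} (φ : (Fin d → ℕ) → ℝ) : Prop where
  nonneg : ∀ a, 0 ≤ φ a
  anti : Antitone φ
  decr : ∀ j a b, a ≤ b → φ b - φ (b + Pi.single j 1) ≤ φ a - φ (a + Pi.single j 1)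

namespace DRDecreasing

variable {d : ℕ} {φ ψ : (Fin d → ℕ) → ℝ}

theorem one : DRDecreasing (fun _ : Fin d → ℕ => (1 : ℝ)) :=
  ⟨fun _ => zero_le_one, antitone_const, by simp⟩

theorem mul (hφ : DRDecreasing φ) (hψ : DRDecreasing ψ) :
    DRDecreasing (fun a => φ a * ψ a) := by
  refine ⟨fun a => mul_nonneg (hφ.nonneg a) (hψ.nonneg a), fun a b h =>
    mul_le_mul (hφ.anti h) (hψ.anti h) (hψ.nonneg b) (hφ.nonneg a), fun j a b h => ?_⟩
  have e : ∀ a, φ a * ψ a - φ (a + Pi.single j 1) * ψ (a + Pi.single j 1) =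
      φ a * (ψ a - ψ (a + Pi.single j 1)) + (φ a - φ (a + Pi.single j 1)) *
        ψ (a + Pi.single j 1) := fun a => by ring
  have hle : ∀ c : Fin d → ℕ, c ≤ c + Pi.single j 1 := fun c => le_self_add
  have h1 : b + Pi.single j 1 ≥ a + Pi.single j 1 := by gcongr
  rw [e, e]
  refine add_le_add (mul_le_mul (hφ.anti h) (hψ.decr j a b h) ?_ (hφ.nonneg a))
    (mul_le_mul (hφ.decr j a b h) (hψ.anti h1) (hψ.nonneg _) ?_)
  · exact sub_nonneg.2 (hψ.anti (hle b))
  · exact sub_nonneg.2 (hφ.anti (hle a))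

theorem listProd {ι : Type*} (l : List ι) (φ : ι → (Fin d → ℕ) → ℝ)
    (h : ∀ i ∈ l, DRDecreasing (φ i)) : DRDecreasing (fun a => (l.map fun i => φ i a).prod) := by
  induction l with
  | nil => exact one
  | cons i l ih =>
    simpa using (h i List.mem_cons_self).mul (ih fun i hi => h i (List.mem_cons_of_mem _ hi))

theorem finsetProd {ι : Type*} (s : Finset ι) (φ : ι → (Fin d → ℕ) → ℝ)
    (h : ∀ i ∈ s, DRDecreasing (φ i)) : DRDecreasing (fun a => ∏ i ∈ s, φ i a) := by
  simpa [Finset.prod_map_toList] using listProd s.toList φ fun i hi => h i (by simpa using hi)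

theorem listSum {ι : Type*} (l : List ι) (φ : ι → (Fin d → ℕ) → ℝ)
    (h : ∀ i ∈ l, DRDecreasing (φ i)) : DRDecreasing (fun a => (l.map fun i => φ i a).sum) := by
  induction l with
  | nil => exact ⟨by simp, by simpa using antitone_const, by simp⟩
  | cons i l ih =>
    have h1 := h i List.mem_cons_self
    have h2 := ih fun i hi => h i (List.mem_cons_of_mem _ hi)
    refine ⟨fun a => ?_, fun a b hab => ?_, fun j a b hab => ?_⟩
    · simpa using add_nonneg (h1.nonneg a) (h2.nonneg a)
    · simpa using add_le_add (h1.anti hab) (h2.anti hab)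
    · have := h1.decr j a b hab
      have := h2.decr j a b hab
      simp only [List.map_cons, List.sum_cons]
      linarith

end DRDecreasing

/-- Equal increments of a concave function decrease. -/
theorem ConcaveOn.increment_anti {f : ℝ → ℝ} (hf : ConcaveOn ℝ (Set.Ici 0) f) {s t δ : ℝ}
    (hs : 0 ≤ s) (hst : s ≤ t) (hδ : 0 < δ) : f (t + δ) - f t ≤ f (s + δ) - f s := by
  set L := t + δ - s with hL
  have hLpos : 0 < L := by linarith
  have h0 : (0 : ℝ) ≤ δ / L := by positivity
  have h1 : 0 ≤ 1 - δ / L := by rw [sub_nonneg, div_le_one hLpos]; linarith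
  have hmem : t + δ ∈ Set.Ici (0 : ℝ) := by simp only [Set.mem_Ici]; linarith
  have e1 := hf.2 hs hmem h1 h0 (by ring)
  have e2 := hf.2 hs hmem h0 h1 (by ring)
  simp only [smul_eq_mul] at e1 e2
  have p1 : (1 - δ / L) * s + δ / L * (t + δ) = s + δ := by field_simp; rw [hL]; ring
  have p2 : δ / L * s + (1 - δ / L) * (t + δ) = t := by field_simp; rw [hL]; ring
  rw [p1] at e1
  rw [p2] at e2
  linarith

namespace LIM

variable {n d : ℕ} (P : LIM n d)

theorem drDecreasing_q {δ : ℝ} (hδ : 0 < δ) {v : Fin n} {i : Fin d} (hi : i ∈ P.S v) :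
    DRDecreasing fun a : Fin d → ℕ => 1 - P.q v i (a i * δ) := by
  have hnn : ∀ m : ℕ, (0 : ℝ) ≤ m * δ := fun m => by positivity
  refine ⟨fun a => sub_nonneg.2 (P.q_le_one v i hi _ (hnn _)), fun a b h => ?_,
    fun j a b h => ?_⟩
  · have h1 : (a i : ℝ) ≤ b i := by exact_mod_cast h i
    have := P.q_mono v i hi (hnn (a i)) (hnn (b i)) (by gcongr)
    linarith
  · by_cases hj : i = j
    · subst hj
      have h1 : (a i : ℝ) ≤ b i := by exact_mod_cast h i
      have := (P.q_concave v i hi).increment_anti (hnn (a i))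
        (show (a i : ℝ) * δ ≤ b i * δ by gcongr) hδ
      simp only [Pi.add_apply, Pi.single_eq_same, Nat.cast_add, Nat.cast_one, add_mul, one_mul]
      linarith
    · simp [hj]

theorem drDecreasing_surv {δ : ℝ} (hδ : 0 < δ) (R : List (Fin n)) :
    DRDecreasing fun a : Fin d → ℕ => P.surv R (latticeMix δ a) := by
  simp only [surv, one_sub_h]
  exact DRDecreasing.listProd _ _ fun v _ =>
    DRDecreasing.finsetProd _ _ fun j hj => P.drDecreasing_q hδ hj

theorem cov_eq_length_sub (Rs : List (List (Fin n))) (x : Fin d → ℝ) :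
    P.cov Rs x = Rs.length - (Rs.map fun R => P.surv R x).sum := by
  induction Rs with
  | nil => simp [cov]
  | cons R Rs ih =>
    simp only [cov] at ih
    simp only [cov, List.map_cons, List.sum_cons, ih, List.length_cons]
    push_cast
    ring

theorem cov_mono {δ : ℝ} (hδ : 0 < δ) (Rs : List (List (Fin n))) :
    Monotone fun a : Fin d → ℕ => P.cov Rs (latticeMix δ a) := by
  intro a b h
  have := (DRDecreasing.listSum Rs _ fun R _ => P.drDecreasing_surv hδ R).anti h
  simp only [cov_eq_length_sub] at this ⊢
  linarith

theorem cov_increment_anti {δ : ℝ} (hδ : 0 < δ) (Rs : List (List (Fin n))) (j : Fin d)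
    {a b : Fin d → ℕ} (h : a ≤ b) :
    P.cov Rs (latticeMix δ (b + Pi.single j 1)) - P.cov Rs (latticeMix δ b) ≤
      P.cov Rs (latticeMix δ (a + Pi.single j 1)) - P.cov Rs (latticeMix δ a) := by
  have := (DRDecreasing.listSum Rs _ fun R _ => P.drDecreasing_surv hδ R).decr j a b h
  simp only [cov_eq_length_sub] at this ⊢
  linarith

/-- Diminishing returns: `m` further increments gain at most `m` times the best single one. -/
theorem cov_add_le {δ : ℝ} (hδ : 0 < δ) (Rs : List (List (Fin n))) (a : Fin d → ℕ) {D : ℝ}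
    (hD : ∀ j, P.cov Rs (latticeMix δ (a + Pi.single j 1)) - P.cov Rs (latticeMix δ a) ≤ D)
    (m : ℕ) (y : Fin d → ℕ) (hy : ∑ j, y j = m) :
    P.cov Rs (latticeMix δ (a + y)) ≤ P.cov Rs (latticeMix δ a) + m * D := by
  induction m generalizing y with
  | zero =>
    have : y = 0 := funext fun j => by simpa using (Finset.sum_eq_zero_iff.1 hy) j
    simp [this]
  | succ m ih =>
    obtain ⟨j, hj⟩ : ∃ j, y j ≠ 0 := by
      by_contra! h
      simp [h] at hy
    have hle : (Pi.single j 1 : Fin d → ℕ) ≤ y := by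
      intro i
      by_cases h : i = j
      · subst h; simpa using Nat.one_le_iff_ne_zero.2 hj
      · simp [h]
    have hsplit : y - Pi.single j 1 + Pi.single j 1 = y := tsub_add_cancel_of_le hle
    have hsum : ∑ i, (y - Pi.single j 1 : Fin d → ℕ) i = m := by
      have h1 : ∑ i, (y - Pi.single j 1 + Pi.single j 1 : Fin d → ℕ) i = m + 1 := by rw [hsplit, hy]
      simp only [Pi.add_apply, Finset.sum_add_distrib, Finset.sum_pi_single', Finset.mem_univ,
        if_true] at h1
      simpa using h1
    have h1 := ih _ hsum
    have h2 := P.cov_increment_anti hδ Rs j (le_self_add (a := a) (b := y - Pi.single j 1))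
    rw [add_assoc, hsplit] at h2
    have h3 := hD j
    push_cast
    linarith

theorem cov_zero_mix (Rs : List (List (Fin n))) : P.cov Rs (fun _ => 0) = 0 := by
  have h1 : ∀ v, P.h v (fun _ => 0) = 0 := fun v => by
    rw [h, Finset.prod_congr rfl fun j hj => by rw [P.q_zero v j hj]]; simp
  simp [cov, surv, h1]

/-- Each round shrinks the distance to the coverage of any `y` within the budget by the factor
`1 - 1 / K`. -/
theorem iterate_greedyRound_spec [NeZero d] {K : ℕ} {δ : ℝ} (hK : 1 ≤ K) (hδ : 0 < δ)
    (Z : List (List (Fin n) × ℕ)) (hZ : (Z.map Prod.snd).Nodup) (h0 : 0 ∉ Z.map Prod.snd)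
    (r : ℕ) (s : ℕ → ℝ) (a : Fin d → ℕ) (h : P.TableInv Z (latticeMix δ a, s)) :
    ∃ b, (iterTimed (P.greedyRound δ (P.pairs Z)) r (latticeMix δ a, s)).val.1 =
        latticeMix δ b ∧ ∑ j, b j = ∑ j, a j + r ∧
      ∀ y : Fin d → ℕ, ∑ j, y j ≤ K →
        P.cov (Z.map Prod.fst) (latticeMix δ y) - P.cov (Z.map Prod.fst) (latticeMix δ b) ≤
          (1 - 1 / K : ℝ) ^ r * (P.cov (Z.map Prod.fst) (latticeMix δ y) -
            P.cov (Z.map Prod.fst) (latticeMix δ a)) := by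
  induction r generalizing s a with
  | zero => exact ⟨a, rfl, by simp, by simp⟩
  | succ r ih =>
    rw [(iterTimed_succ _ _ _).1]
    obtain ⟨h1, j, h2, h3⟩ := P.greedyRound_val hδ.le Z hZ h0 _ h
    simp only [update_latticeMix] at h2 h3
    obtain ⟨s', hs'⟩ : ∃ s', (P.greedyRound δ (P.pairs Z) (latticeMix δ a, s)).val =
      (latticeMix δ (a + Pi.single j 1), s') := ⟨_, by rw [← h2]⟩
    rw [hs'] at h1 ⊢
    obtain ⟨b, b1, b2, b3⟩ := ih s' _ h1
    refine ⟨b, b1, ?_, fun y hy => (b3 y hy).trans ?_⟩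
    · rw [b2]; simp [Finset.sum_add_distrib]; ring
    · set F := fun a => P.cov (Z.map Prod.fst) (latticeMix δ a) with hF
      change (1 - 1 / K : ℝ) ^ r * (F y - F (a + Pi.single j 1)) ≤
        (1 - 1 / K : ℝ) ^ (r + 1) * (F y - F a)
      have hK' : (1 : ℝ) ≤ K := by exact_mod_cast hK
      have hK0 : (0 : ℝ) ≤ 1 - 1 / K := by rw [sub_nonneg, div_le_one (by linarith)]; exact hK'
      rw [pow_succ, mul_assoc]
      refine mul_le_mul_of_nonneg_left ?_ (pow_nonneg hK0 r)
      -- The optimum exceeds the current value by at most `K` times the best marginal gain.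
      set D := F (a + Pi.single j 1) - F a with hD
      have hD0 : 0 ≤ D := sub_nonneg.2 (P.cov_mono hδ _ le_self_add)
      have h4 : F (a + y) ≤ F a + (∑ j, y j : ℕ) * D :=
        P.cov_add_le hδ _ a (fun j' => sub_le_sub_right (h3 j') _) _ y rfl
      have h5 : F y ≤ F (a + y) := P.cov_mono hδ _ le_add_self
      have h6 : ((∑ j, y j : ℕ) : ℝ) * D ≤ K * D := by gcongr
      have h7 : (F y - F a) / K ≤ D := by
        rw [div_le_iff₀ (by linarith)]; linarith
      have h8 : (1 - 1 / K : ℝ) * (F y - F a) = F y - F a - (F y - F a) / K := by ring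
      rw [h8]
      linarith

/-- Lattice greedy returns a mix that uses the whole budget, and that is a
`(1 - 1/e)`-approximate maximizer of the coverage. -/
theorem lgreedy_spec [NeZero d] {K : ℕ} {k δ : ℝ} (hK : 1 ≤ K) (hδ : 0 < δ) (hk : k = K * δ)
    (Rs : List (List (Fin n))) :
    ∃ b : Fin d → ℕ, (P.lgreedy k δ Rs).val = latticeMix δ b ∧ ∑ j, b j = K ∧
      ∀ y : Fin d → ℕ, ∑ j, y j ≤ K →
        (1 - 1 / Real.exp 1) * P.cov Rs (latticeMix δ y) ≤ P.cov Rs (latticeMix δ b) := by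
  have hfl : ⌊k / δ⌋₊ = K := by rw [hk, mul_div_cancel_right₀ _ hδ.ne', Nat.floor_natCast]
  have hsnd : (Rs.zipIdx 1).map Prod.snd = List.range' 1 Rs.length := List.zipIdx_map_snd 1 Rs
  have hz : latticeMix δ (0 : Fin d → ℕ) = fun _ => 0 := by ext; simp [latticeMix]
  have hinv : P.TableInv (Rs.zipIdx 1) (latticeMix δ 0, (P.initTables Rs).val.1) := by
    rw [initTables_val]
    refine ⟨fun j => by simp [latticeMix], by simp [hsnd], fun p hp => ?_⟩
    have h1 : ∀ v, P.h v (fun _ => 0) = 0 := fun v => by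
      rw [h, Finset.prod_congr rfl fun j hj => by rw [P.q_zero v j hj]]; simp
    simp only
    rw [if_pos (List.mem_map_of_mem hp), surv, hz]
    simp [h1]
  obtain ⟨b, b1, b2, b3⟩ := P.iterate_greedyRound_spec (K := K) hK hδ (Rs.zipIdx 1)
    (by rw [hsnd]; exact List.nodup_range') (by simp [hsnd]) K _ 0 hinv
  refine ⟨b, ?_, by simpa using b2, fun y hy => ?_⟩
  · rw [← b1, hz]
    simp [lgreedy, hfl, initTables_val]
  · have h1 := b3 y hy
    rw [List.zipIdx_map_fst, hz, cov_zero_mix, sub_zero] at h1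
    have h2 : 0 ≤ P.cov Rs (latticeMix δ y) := by
      rw [← P.cov_zero_mix Rs, ← hz]
      exact P.cov_mono hδ Rs (zero_le)
    have h3 : (1 - 1 / K : ℝ) ^ K ≤ 1 / Real.exp 1 := by
      have hK' : (1 : ℝ) ≤ K := by exact_mod_cast hK
      rw [one_div (Real.exp 1), ← Real.exp_neg]
      exact Real.one_sub_div_pow_le_exp_neg hK'
    nlinarith [mul_le_mul_of_nonneg_right h3 h2]

end LIM

/-! ### The distribution of RR sets -/

namespace TriggeringModel

variable {n : ℕ} (G : TriggeringModel n)

/-- The probability that the triggering sets are given by `T`. -/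
def trigProb (T : Fin n → Finset (Fin n)) : ℝ := ∏ v, (G.D v (T v)).toReal

theorem trigProb_nonneg (T : Fin n → Finset (Fin n)) : 0 ≤ G.trigProb T :=
  Finset.prod_nonneg fun _ _ => ENNReal.toReal_nonneg

theorem drawLaw_real_singleton [NeZero n] (ω : Draw n) :
    G.drawLaw.real {ω} = (n : ℝ)⁻¹ * G.trigProb ω.2 := by
  obtain ⟨r, T⟩ := ω
  rw [Measure.real, drawLaw, ← Set.singleton_prod_singleton, Measure.prod_prod,
    Measure.pi_singleton, PMF.toMeasure_apply_singleton _ _ (measurableSet_singleton _),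
    ENNReal.toReal_mul, ENNReal.toReal_prod, PMF.uniformOfFintype_apply, trigProb]
  simp

theorem integral_drawLaw [NeZero n] (f : Draw n → ℝ) :
    ∫ ω, f ω ∂G.drawLaw = (n : ℝ)⁻¹ * ∑ T, ∑ r, G.trigProb T * f (r, T) := by
  rw [integral_fintype Integrable.of_finite, Fintype.sum_prod_type, Finset.sum_comm,
    Finset.mul_sum]
  refine Finset.sum_congr rfl fun T _ => ?_
  rw [Finset.mul_sum]
  refine Finset.sum_congr rfl fun r _ => ?_
  rw [drawLaw_real_singleton, smul_eq_mul, mul_assoc]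

theorem spread_singleton [NeZero n] (v : Fin n) :
    G.spread {v} = n * ∫ ω, (if v ∈ G.rrList ω then 1 else 0) ∂G.drawLaw := by
  have hn : (n : ℝ) ≠ 0 := by exact_mod_cast NeZero.ne n
  rw [integral_drawLaw, mul_inv_cancel_left₀ hn, spread]
  refine Finset.sum_congr rfl fun T _ => ?_
  rw [← Finset.mul_sum]
  change G.trigProb T * _ = _
  congr 1
  rw [Finset.sum_boole]
  congr 2
  ext r
  simp [mem_finalActive_iff, (G.genRR_spec (r, T)).2.1]

theorem sum_inDegree : ∑ v, G.inDegree v = G.numEdges := by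
  unfold inDegree numEdges
  exact (Finset.card_eq_sum_card_fiberwise fun _ _ => Finset.mem_coe.2 (Finset.mem_univ _)).symm

theorem card_le_inDegree {v : Fin n} {T : Finset (Fin n)} (hT : T ∈ (G.D v).support) :
    T.card ≤ G.inDegree v := by
  refine Finset.card_le_card_of_injOn (fun u => (u, v)) (fun u hu => ?_) fun a _ b _ h => ?_
  · simpa using G.D_subset v T hT u hu
  · exact (Prod.mk.inj h).1

/-- The expected cost of an RR set: a node `v` belongs to it with probability `σ({v}) / n`. -/
theorem integral_rrCost_le [NeZero n] {U : ℝ} (hU : ∀ v, G.spread {v} ≤ U) :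
    ∫ ω, (G.rrCost ω : ℝ) ∂G.drawLaw ≤ 2 * (n + G.numEdges) * U / n := by
  have hn : (0 : ℝ) < n := by exact_mod_cast NeZero.pos n
  have h1 : ∫ ω, (G.rrCost ω : ℝ) ∂G.drawLaw ≤
      ∫ ω, ∑ v, (1 + 2 * G.inDegree v : ℝ) * (if v ∈ G.rrList ω then 1 else 0) ∂G.drawLaw := by
    rw [integral_drawLaw, integral_drawLaw]
    refine mul_le_mul_of_nonneg_left (Finset.sum_le_sum fun T _ => Finset.sum_le_sum fun r _ => ?_)
      (by positivity)
    by_cases hT : ∀ v, T v ∈ (G.D v).support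
    · refine mul_le_mul_of_nonneg_left ?_ (G.trigProb_nonneg T)
      rw [rrCost]
      push_cast
      rw [← Finset.sum_filter_add_sum_filter_not Finset.univ (fun v => v ∈ G.rrList (r, T))]
      have e : (Finset.univ.filter fun v => v ∈ G.rrList (r, T)) = (G.rrList (r, T)).toFinset := by
        ext; simp
      rw [e]
      refine le_add_of_le_of_nonneg (Finset.sum_le_sum fun v hv => ?_)
        (Finset.sum_nonneg fun v _ => by positivity)
      rw [if_pos (List.mem_toFinset.1 hv), mul_one, visitCost]
      have := G.card_le_inDegree (hT v)
      have h2 : ((T v).card : ℝ) ≤ G.inDegree v := by exact_mod_cast this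
      push_cast
      linarith
    · push Not at hT
      obtain ⟨v, hv⟩ := hT
      have : G.trigProb T = 0 := Finset.prod_eq_zero (Finset.mem_univ v) (by
        rw [PMF.mem_support_iff, not_not] at hv; simp [hv])
      simp [this]
  refine h1.trans ?_
  rw [integral_finsetSum _ fun _ _ => Integrable.of_finite]
  have h2 : ∀ v, ∫ ω, (1 + 2 * G.inDegree v : ℝ) * (if v ∈ G.rrList ω then 1 else 0) ∂G.drawLaw
      ≤ (1 + 2 * G.inDegree v : ℝ) * (U / n) := by
    intro v
    rw [integral_const_mul]
    gcongr
    rw [le_div_iff₀ hn, mul_comm, ← spread_singleton]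
    exact hU v
  refine (Finset.sum_le_sum fun v _ => h2 v).trans ?_
  have hU0 : 0 ≤ U := by
    refine le_trans ?_ (hU 0)
    exact Finset.sum_nonneg fun T _ => mul_nonneg (G.trigProb_nonneg T) (Nat.cast_nonneg _)
  rw [← Finset.sum_mul, Finset.sum_add_distrib, ← Finset.mul_sum, ← Nat.cast_sum, sum_inDegree]
  simp only [Finset.sum_const, Finset.card_univ, Fintype.card_fin, nsmul_eq_mul, mul_one]
  rw [mul_div_assoc]
  have : 0 ≤ U / n := by positivity
  gcongr
  linarith

/-! ### Independence of the draws, and concentration -/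

/-- Functions of distinct draws are independent. -/
theorem lintegral_tape_prod [NeZero n] (s : Finset ℕ) (f : ℕ → Draw n → ℝ≥0∞) :
    ∫⁻ ω, ∏ i ∈ s, f i (ω i) ∂G.tape = ∏ i ∈ s, ∫⁻ a, f i a ∂G.drawLaw := by
  have hf : ∀ i, Measurable (f i) := fun i => measurable_of_finite _
  have h1 : ProbabilityTheory.iIndepFun (fun i (ω : ℕ → Draw n) => f i (ω i)) G.tape :=
    ProbabilityTheory.iIndepFun_infinitePi hf
  rw [ProbabilityTheory.lintegral_prod_eq_prod_lintegral_of_indepFun s _ h1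
    fun i => (hf i).comp (measurable_pi_apply i)]
  refine Finset.prod_congr rfl fun i _ => ?_
  exact (measurePreserving_eval_infinitePi (fun _ : ℕ => G.drawLaw) i).lintegral_comp (hf i)

/-- The exponential moment of a variable with values between `0` and `1`. -/
theorem lintegral_exp_le [NeZero n] {X : Draw n → ℝ} (h0 : ∀ ω, 0 ≤ X ω) (h1 : ∀ ω, X ω ≤ 1)
    (t : ℝ) : ∫⁻ ω, ENNReal.ofReal (Real.exp (t * X ω)) ∂G.drawLaw ≤
      ENNReal.ofReal (Real.exp ((∫ ω, X ω ∂G.drawLaw) * (Real.exp t - 1))) := by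
  rw [← ofReal_integral_eq_lintegral_ofReal Integrable.of_finite
    (ae_of_all _ fun _ => (Real.exp_pos _).le)]
  refine ENNReal.ofReal_le_ofReal ?_
  calc ∫ ω, Real.exp (t * X ω) ∂G.drawLaw
      ≤ ∫ ω, (1 + X ω * (Real.exp t - 1)) ∂G.drawLaw := by
        refine integral_mono Integrable.of_finite Integrable.of_finite fun ω => ?_
        have := convexOn_exp.2 (Set.mem_univ 0) (Set.mem_univ t) (sub_nonneg.2 (h1 ω)) (h0 ω)
          (by ring)
        simp only [smul_eq_mul, mul_zero, zero_add, Real.exp_zero, mul_one] at this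
        rw [mul_comm t]
        simp only
        linarith
    _ = 1 + (∫ ω, X ω ∂G.drawLaw) * (Real.exp t - 1) := by
        rw [integral_add Integrable.of_finite Integrable.of_finite, integral_mul_const]
        simp
    _ ≤ _ := by rw [add_comm]; exact Real.add_one_le_exp _

theorem tape_chernoff [NeZero n] {X : Draw n → ℝ} (h0 : ∀ ω, 0 ≤ X ω) (h1 : ∀ ω, X ω ≤ 1)
    (N : ℕ) (t c : ℝ) :
    G.tape {ω | t * c ≤ t * ∑ s ∈ Finset.range N, X (ω s)} ≤ ENNReal.ofReal
      (Real.exp (N * ((∫ ω, X ω ∂G.drawLaw) * (Real.exp t - 1)) - t * c)) := by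
  set f : (ℕ → Draw n) → ℝ≥0∞ := fun ω =>
    ∏ s ∈ Finset.range N, ENNReal.ofReal (Real.exp (t * X (ω s))) with hf
  have hfm : Measurable f := Finset.measurable_prod _ fun s _ =>
    (measurable_of_finite fun a : Draw n => ENNReal.ofReal (Real.exp (t * X a))).comp
      (measurable_pi_apply s)
  have hpos : ENNReal.ofReal (Real.exp (t * c)) ≠ 0 := by simp [Real.exp_pos]
  have h2 : {ω | t * c ≤ t * ∑ s ∈ Finset.range N, X (ω s)} ⊆
      {ω | ENNReal.ofReal (Real.exp (t * c)) ≤ f ω} := by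
    intro ω hω
    simp only [Set.mem_ofPred_eq, hf] at hω ⊢
    rw [← ENNReal.ofReal_prod_of_nonneg fun _ _ => (Real.exp_pos _).le, ← Real.exp_sum,
      ← Finset.mul_sum]
    exact ENNReal.ofReal_le_ofReal (Real.exp_le_exp.2 hω)
  refine (measure_mono h2).trans ((meas_ge_le_lintegral_div hfm.aemeasurable hpos
    ENNReal.ofReal_ne_top).trans ?_)
  have h3 := G.lintegral_tape_prod (Finset.range N)
    fun _ a => ENNReal.ofReal (Real.exp (t * X a))
  simp only [hf]
  rw [h3]
  rw [ENNReal.div_le_iff hpos ENNReal.ofReal_ne_top, ← ENNReal.ofReal_mul (Real.exp_pos _).le,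
    ← Real.exp_add, sub_add_cancel, Real.exp_nat_mul, ENNReal.ofReal_pow (Real.exp_pos _).le]
  rw [Finset.prod_const, Finset.card_range]
  gcongr
  exact G.lintegral_exp_le h0 h1 t

theorem exp_neg_le_quadratic {t : ℝ} (ht : 0 ≤ t) : Real.exp (-t) ≤ 1 - t + t ^ 2 / 2 := by
  have h1 := Real.quadratic_le_exp_of_nonneg ht
  have h2 : Real.exp (-t) * Real.exp t = 1 := by rw [← Real.exp_add]; simp
  have h3 : 0 ≤ 1 - t + t ^ 2 / 2 := by nlinarith [sq_nonneg (t - 1)]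
  refine le_of_mul_le_mul_right ?_ (Real.exp_pos t)
  rw [h2]
  nlinarith [mul_le_mul_of_nonneg_left h1 h3, sq_nonneg (t ^ 2)]

/-- The lower tail. -/
theorem tape_lower_tail [NeZero n] {X : Draw n → ℝ} (h0 : ∀ ω, 0 ≤ X ω) (h1 : ∀ ω, X ω ≤ 1)
    (N : ℕ) {μ η : ℝ} (hμ : ∫ ω, X ω ∂G.drawLaw = μ) (hη : 0 ≤ η) :
    G.tape {ω | ∑ s ∈ Finset.range N, X (ω s) ≤ N * μ * (1 - η)} ≤
      ENNReal.ofReal (Real.exp (-(η ^ 2 * (N * μ) / 2))) := by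
  have hμ0 : 0 ≤ μ := hμ ▸ integral_nonneg h0
  refine (measure_mono ?_).trans ((G.tape_chernoff h0 h1 N (-η) (N * μ * (1 - η))).trans
    (ENNReal.ofReal_le_ofReal (Real.exp_le_exp.2 ?_)))
  · intro ω hω
    exact mul_le_mul_of_nonpos_left (show _ ≤ _ from hω) (neg_nonpos.2 hη)
  · rw [hμ]
    have : Real.exp (-η) ≤ 1 - η + η ^ 2 / 2 := by
      have := exp_neg_le_quadratic hη
      linarith
    have h2 : N * (μ * (Real.exp (-η) - 1)) ≤ N * (μ * (-η + η ^ 2 / 2)) := by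
      gcongr; linarith
    nlinarith

theorem exp_sub_one_sub_le {t : ℝ} (h0 : 0 ≤ t) (h3 : t < 3) :
    Real.exp t - 1 - t ≤ t ^ 2 / (2 * (1 - t / 3)) := by
  have hH : MonotoneOn (fun t : ℝ => t + 2 + (t - 2) * Real.exp t) (Set.Ici 0) := by
    refine monotoneOn_of_deriv_nonneg (convex_Ici 0) (by fun_prop) (by fun_prop) fun s hs => ?_
    have hd : HasDerivAt (fun t : ℝ => t + 2 + (t - 2) * Real.exp t)
        (1 + (1 * Real.exp s + (s - 2) * Real.exp s)) s :=
      ((hasDerivAt_id s).add_const 2).add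
        (((hasDerivAt_id s).sub_const 2).mul (Real.hasDerivAt_exp s))
    rw [hd.deriv]
    have h1 := Real.add_one_le_exp (-s)
    have h2 : Real.exp (-s) * Real.exp s = 1 := by rw [← Real.exp_add]; simp
    nlinarith [Real.exp_pos s]
  have hG : MonotoneOn (fun t : ℝ => t ^ 2 / 2 - (1 - t / 3) * (Real.exp t - 1 - t))
      (Set.Ici 0) := by
    refine monotoneOn_of_deriv_nonneg (convex_Ici 0) (by fun_prop) (by fun_prop) fun s hs => ?_
    have hs0 : 0 ≤ s := by simpa using interior_subset hs
    have hd : HasDerivAt (fun t : ℝ => t ^ 2 / 2 - (1 - t / 3) * (Real.exp t - 1 - t))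
        (2 * s / 2 - (-(1 / 3) * (Real.exp s - 1 - s) + (1 - s / 3) * (Real.exp s - 1))) s := by
      refine HasDerivAt.sub ?_ (HasDerivAt.mul ?_ ?_)
      · simpa using (hasDerivAt_pow 2 s).div_const 2
      · exact ((hasDerivAt_id s).div_const 3).const_sub 1
      · exact ((Real.hasDerivAt_exp s).sub_const 1).sub (hasDerivAt_id s)
    rw [hd.deriv]
    have := hH (Set.self_mem_Ici) hs0 hs0
    simp at this
    linarith
  have := hG Set.self_mem_Ici h0 h0
  simp at this
  rw [le_div_iff₀ (by linarith)]
  linarith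

/-- The upper tail, in Bernstein's form. -/
theorem tape_upper_tail [NeZero n] {X : Draw n → ℝ} (h0 : ∀ ω, 0 ≤ X ω) (h1 : ∀ ω, X ω ≤ 1)
    (N : ℕ) {μ a : ℝ} (hμ : ∫ ω, X ω ∂G.drawLaw ≤ μ) (hNμ : 0 < N * μ) (ha : 0 ≤ a) :
    G.tape {ω | N * μ + a ≤ ∑ s ∈ Finset.range N, X (ω s)} ≤
      ENNReal.ofReal (Real.exp (-(a ^ 2 / (2 * (N * μ) + 2 / 3 * a)))) := by
  set m := N * μ with hm
  set t := a / (m + a / 3) with ht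
  have hden : 0 < m + a / 3 := by positivity
  have ht0 : 0 ≤ t := by positivity
  have ht3 : t < 3 := by rw [ht, div_lt_iff₀ hden]; linarith
  refine (measure_mono ?_).trans ((G.tape_chernoff h0 h1 N t (m + a)).trans
    (ENNReal.ofReal_le_ofReal (Real.exp_le_exp.2 ?_)))
  · intro ω hω
    exact mul_le_mul_of_nonneg_left (show _ ≤ _ from hω) ht0
  · have he := exp_sub_one_sub_le ht0 ht3
    have he0 : 0 ≤ Real.exp t - 1 := by linarith [Real.add_one_le_exp t]
    have h2 : N * ((∫ ω, X ω ∂G.drawLaw) * (Real.exp t - 1)) ≤ m * (Real.exp t - 1) := by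
      rw [hm, mul_assoc]; gcongr
    have h3 : m * (Real.exp t - 1) ≤ m * (t + t ^ 2 / (2 * (1 - t / 3))) := by
      gcongr; linarith
    have h4 : 1 - t / 3 = m / (m + a / 3) := by rw [ht]; field_simp; ring
    have h5 : m * (t + t ^ 2 / (2 * (1 - t / 3))) - t * (m + a) =
        -(a ^ 2 / (2 * m + 2 / 3 * a)) := by
      rw [h4, ht]
      have : 2 * m + 2 / 3 * a ≠ 0 := by positivity
      field_simp
      ring
    linarith

/-- The cost of draw `t` on the event that the first `N` values of `X` add up to less than half
of the expected sum. Draw `t` is dropped from the sum, which makes the event independent of its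
cost. -/
theorem lintegral_cost_lower_tail [NeZero n] {X : Draw n → ℝ} (h0 : ∀ ω, 0 ≤ X ω)
    (h1 : ∀ ω, X ω ≤ 1) (w : Draw n → ℝ≥0∞) (N t : ℕ) {μ : ℝ} (hμ : ∫ ω, X ω ∂G.drawLaw = μ) :
    ∫⁻ ω, {ω : ℕ → Draw n | ∑ s ∈ Finset.range N, X (ω s) < N * μ / 2}.indicator
        (fun ω => w (ω t)) ω ∂G.tape ≤
      (∫⁻ a, w a ∂G.drawLaw) * ENNReal.ofReal (2 * Real.exp (-(N * μ / 8))) := by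
  have hμ0 : 0 ≤ μ := hμ ▸ integral_nonneg h0
  have hμ1 : μ ≤ 1 := by
    rw [← hμ]
    calc ∫ ω, X ω ∂G.drawLaw ≤ ∫ _, (1 : ℝ) ∂G.drawLaw :=
          integral_mono Integrable.of_finite Integrable.of_finite h1
      _ = 1 := by simp
  set s := (Finset.range N).erase t with hs
  set f : ℕ → Draw n → ℝ≥0∞ := fun i a =>
    if i = t then w a else ENNReal.ofReal (Real.exp (-(1 / 2) * X a)) with hf
  have hts : t ∉ s := by simp [hs]
  have hprod : ∀ ω : ℕ → Draw n, ∏ i ∈ insert t s, f i (ω i) =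
      w (ω t) * ENNReal.ofReal (Real.exp (-(1 / 2) * ∑ i ∈ s, X (ω i))) := by
    intro ω
    rw [Finset.prod_insert hts, Finset.mul_sum, Real.exp_sum,
      ENNReal.ofReal_prod_of_nonneg fun _ _ => (Real.exp_pos _).le]
    simp only [hf, if_true]
    congr 1
    refine Finset.prod_congr rfl fun i hi => ?_
    rw [if_neg (by rintro rfl; exact hts hi)]
  have hle : ∀ ω : ℕ → Draw n,
      {ω : ℕ → Draw n | ∑ s ∈ Finset.range N, X (ω s) < N * μ / 2}.indicator
        (fun ω => w (ω t)) ω ≤ ENNReal.ofReal (Real.exp (N * μ / 4)) *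
          ∏ i ∈ insert t s, f i (ω i) := by
    intro ω
    refine Set.indicator_apply_le' (fun hω => ?_) fun _ => bot_le
    rw [hprod, mul_left_comm, ← ENNReal.ofReal_mul (Real.exp_pos _).le, ← Real.exp_add]
    refine le_mul_of_one_le_right' ?_
    rw [ENNReal.one_le_ofReal]
    refine Real.one_le_exp ?_
    have h2 : ∑ i ∈ s, X (ω i) ≤ ∑ i ∈ Finset.range N, X (ω i) :=
      Finset.sum_le_sum_of_subset_of_nonneg (Finset.erase_subset _ _) fun i _ _ => h0 _
    have h3 : ∑ s ∈ Finset.range N, X (ω s) < N * μ / 2 := hω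
    linarith
  refine (lintegral_mono hle).trans ?_
  rw [lintegral_const_mul' _ _ ENNReal.ofReal_ne_top, lintegral_tape_prod,
    Finset.prod_insert hts, mul_left_comm]
  have e1 : ∫⁻ a, f t a ∂G.drawLaw = ∫⁻ a, w a ∂G.drawLaw := by simp [hf]
  rw [e1]
  gcongr
  have e2 : ∏ i ∈ s, ∫⁻ a, f i a ∂G.drawLaw ≤
      ENNReal.ofReal (Real.exp (s.card * (μ * (Real.exp (-(1 / 2)) - 1)))) := by
    rw [Real.exp_nat_mul, ENNReal.ofReal_pow (Real.exp_pos _).le, ← Finset.prod_const]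
    refine Finset.prod_le_prod' fun i hi => ?_
    have := G.lintegral_exp_le h0 h1 (-(1 / 2))
    rw [hμ] at this
    simpa only [hf, if_neg (show i ≠ t by rintro rfl; exact hts hi)] using this
  calc _ ≤ ENNReal.ofReal (Real.exp (N * μ / 4)) *
        ENNReal.ofReal (Real.exp (s.card * (μ * (Real.exp (-(1 / 2)) - 1)))) := by gcongr
    _ = ENNReal.ofReal (Real.exp (N * μ / 4 + s.card * (μ * (Real.exp (-(1 / 2)) - 1)))) := by
        rw [← ENNReal.ofReal_mul (Real.exp_pos _).le, ← Real.exp_add]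
    _ ≤ ENNReal.ofReal (Real.exp (Real.log 2 + -(N * μ / 8))) := by
        refine ENNReal.ofReal_le_ofReal (Real.exp_le_exp.2 ?_)
        have h2 : Real.exp (-(1 / 2)) ≤ 1 - 1 / 2 + (1 / 2) ^ 2 / 2 := by
          have := exp_neg_le_quadratic (show (0 : ℝ) ≤ 1 / 2 by norm_num)
          linarith
        have h3 : (N : ℝ) - 1 ≤ s.card := by
          have : N - 1 ≤ s.card := by
            simpa [hs] using Finset.pred_card_le_card_erase (s := Finset.range N) (a := t)
          have h4 : N ≤ s.card + 1 := by omega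
          have h5 : (N : ℝ) ≤ s.card + 1 := by exact_mod_cast h4
          linarith
        have h4 : (s.card : ℝ) * (μ * (Real.exp (-(1 / 2)) - 1)) ≤ (N - 1) * (μ * (-3 / 8)) := by
          have : μ * (Real.exp (-(1 / 2)) - 1) ≤ μ * (-3 / 8) := by gcongr; linarith
          have h5 : (s.card : ℝ) * (μ * (Real.exp (-(1 / 2)) - 1)) ≤ s.card * (μ * (-3 / 8)) := by
            gcongr
          have h6 : μ * (-3 / 8) ≤ 0 := by linarith
          nlinarith
        have h5 := Real.log_two_gt_d9
        nlinarith
    _ = _ := by rw [Real.exp_add, Real.exp_log two_pos]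

end TriggeringModel

/-! ### The influence spread of a strategy mix as an expectation over RR sets -/

namespace LIM

variable {n d : ℕ} (P : LIM n d)

theorem h_nonneg (v : Fin n) {x : Fin d → ℝ} (hx : ∀ j, 0 ≤ x j) : 0 ≤ P.h v x := by
  rw [h, sub_nonneg]
  exact Finset.prod_le_one (fun j hj => sub_nonneg.2 (P.q_le_one v j hj _ (hx j)))
    fun j hj => sub_le_self _ (P.q_nonneg hj (hx j))

theorem h_le_one (v : Fin n) {x : Fin d → ℝ} (hx : ∀ j, 0 ≤ x j) : P.h v x ≤ 1 := by
  rw [h]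
  exact sub_le_self _ (Finset.prod_nonneg fun j hj =>
    sub_nonneg.2 (P.q_le_one v j hj _ (hx j)))

/-- The probability that the RR set of the draw `ω` contains a seed. -/
def hit (x : Fin d → ℝ) (ω : Draw n) : ℝ := 1 - P.surv (P.rrList ω) x

theorem cov_rrPrefix (ω : ℕ → Draw n) (N : ℕ) (x : Fin d → ℝ) :
    P.cov (P.rrPrefix ω N) x = ∑ t ∈ Finset.range N, P.hit x (ω t) := by
  induction N with
  | zero => simp [cov, TriggeringModel.rrPrefix]
  | succ N ih =>
    rw [Finset.sum_range_succ, ← ih]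
    simp [cov, TriggeringModel.rrPrefix, List.range_succ, hit]

theorem surv_rrList (x : Fin d → ℝ) (ω : Draw n) :
    P.surv (P.rrList ω) x = ∏ v ∈ (P.rrList ω).toFinset, (1 - P.h v x) := by
  rw [surv, List.prod_toFinset _ (P.genRR_spec ω).1]

theorem hit_nonneg {x : Fin d → ℝ} (hx : ∀ j, 0 ≤ x j) (ω : Draw n) : 0 ≤ P.hit x ω := by
  rw [hit, surv_rrList, sub_nonneg]
  exact Finset.prod_le_one (fun v _ => sub_nonneg.2 (P.h_le_one v hx))
    fun v _ => sub_le_self _ (P.h_nonneg v hx)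

theorem hit_le_one {x : Fin d → ℝ} (hx : ∀ j, 0 ≤ x j) (ω : Draw n) : P.hit x ω ≤ 1 := by
  rw [hit, surv_rrList]
  exact sub_le_self _ (Finset.prod_nonneg fun v _ => sub_nonneg.2 (P.h_le_one v hx))

/-- The probability that a set of independent seeds avoids `R` is the product of the
probabilities of its elements not to be seeds. -/
theorem sum_seeds_disjoint (h : Fin n → ℝ) (R : Finset (Fin n)) :
    ∑ A : Finset (Fin n), (if ∃ v ∈ A, v ∈ R then 1 else 0) *
      ((∏ u ∈ A, h u) * ∏ v ∈ Finset.univ \ A, (1 - h v)) = 1 - ∏ v ∈ R, (1 - h v) := by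
  have h1 : ∑ A : Finset (Fin n), (∏ u ∈ A, h u) * ∏ v ∈ Finset.univ \ A, (1 - h v) = 1 := by
    have := Finset.prod_add h (fun v => 1 - h v) Finset.univ
    simp only [add_sub_cancel, Finset.prod_const_one, Finset.powerset_univ] at this
    exact this.symm
  have h2 : ∑ A : Finset (Fin n), (if ∃ v ∈ A, v ∈ R then 0 else 1) *
      ((∏ u ∈ A, h u) * ∏ v ∈ Finset.univ \ A, (1 - h v)) = ∏ v ∈ R, (1 - h v) := by
    have := Finset.prod_add (fun v => if v ∈ R then 0 else h v) (fun v => 1 - h v) Finset.univ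
    simp only [Finset.powerset_univ] at this
    have e : ∏ v ∈ R, (1 - h v) =
        ∏ v, ((if v ∈ R then 0 else h v) + (1 - h v)) := by
      rw [← Finset.prod_subset (Finset.subset_univ R)]
      · exact Finset.prod_congr rfl fun v hv => by simp [hv]
      · intro v _ hv; simp [hv]
    rw [e, this]
    refine Finset.sum_congr rfl fun A _ => ?_
    split_ifs with hA
    · obtain ⟨v, hv, hR⟩ := hA
      rw [Finset.prod_eq_zero (f := fun v => if v ∈ R then 0 else h v) hv (by simp [hR])]
      ring
    · push Not at hA
      rw [one_mul]
      congr 1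
      exact Finset.prod_congr rfl fun v hv => by rw [if_neg (hA v hv)]
  rw [← h2, eq_sub_iff_add_eq, ← Finset.sum_add_distrib]
  refine Eq.trans (Finset.sum_congr rfl fun A _ => ?_) h1
  split_ifs <;> ring

/-- The spread of a mix is `n` times the probability that an RR set contains a seed. -/
theorem g_eq [NeZero n] (x : Fin d → ℝ) : P.g x = n * ∫ ω, P.hit x ω ∂P.drawLaw := by
  have hn : (n : ℝ) ≠ 0 := by exact_mod_cast NeZero.ne n
  rw [TriggeringModel.integral_drawLaw, mul_inv_cancel_left₀ hn, g]
  have h1 : ∀ T r, P.hit x (r, T) = ∑ A : Finset (Fin n),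
      (if r ∈ TriggeringModel.finalActive T A then 1 else 0) *
        ((∏ u ∈ A, P.h u x) * ∏ v ∈ Finset.univ \ A, (1 - P.h v x)) := by
    intro T r
    rw [hit, surv_rrList, ← sum_seeds_disjoint]
    refine Finset.sum_congr rfl fun A _ => ?_
    congr 2
    simp only [TriggeringModel.mem_finalActive_iff, List.mem_toFinset,
      (P.genRR_spec (r, T)).2.1]
  simp only [h1, TriggeringModel.spread, Finset.sum_mul, Finset.mul_sum]
  rw [Finset.sum_comm]
  refine Finset.sum_congr rfl fun T _ => ?_
  rw [Finset.sum_comm]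
  refine Finset.sum_congr rfl fun A _ => ?_
  rw [← Finset.mul_sum, ← Finset.sum_mul, Finset.sum_boole, Finset.filter_univ_mem]
  change P.trigProb T * _ * _ * _ = _
  ring

theorem hit_le_sum_h {x : Fin d → ℝ} (hx : ∀ j, 0 ≤ x j) (ω : Draw n) :
    P.hit x ω ≤ ∑ v, P.h v x := by
  have key : ∀ R : Finset (Fin n), 1 - ∏ v ∈ R, (1 - P.h v x) ≤ ∑ v ∈ R, P.h v x := by
    intro R
    induction R using Finset.induction_on with
    | empty => simp
    | insert v R hv ih =>
      rw [Finset.prod_insert hv, Finset.sum_insert hv]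
      have h1 : ∏ v ∈ R, (1 - P.h v x) ≤ 1 :=
        Finset.prod_le_one (fun v _ => sub_nonneg.2 (P.h_le_one v hx))
          fun v _ => sub_le_self _ (P.h_nonneg v hx)
      nlinarith [P.h_nonneg v hx]
  rw [hit, surv_rrList]
  exact (key _).trans (Finset.sum_le_sum_of_subset_of_nonneg (Finset.subset_univ _)
    fun v _ _ => P.h_nonneg v hx)

/-- An RR set contains its root. -/
theorem sum_h_le_g [NeZero n] {x : Fin d → ℝ} (hx : ∀ j, 0 ≤ x j) : ∑ v, P.h v x ≤ P.g x := by
  have hn : (0 : ℝ) < n := by exact_mod_cast NeZero.pos n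
  have h1 : ∑ T, P.trigProb T = 1 := by
    have := P.integral_drawLaw (fun _ => (1 : ℝ))
    simp only [integral_const, probReal_univ, smul_eq_mul, mul_one, Finset.sum_const,
      Finset.card_univ, Fintype.card_fin, nsmul_eq_mul] at this
    rw [← Finset.mul_sum, inv_mul_cancel_left₀ hn.ne'] at this
    exact this.symm
  rw [g_eq, TriggeringModel.integral_drawLaw, mul_inv_cancel_left₀ hn.ne']
  calc ∑ v, P.h v x = ∑ T, ∑ r, P.trigProb T * P.h r x := by
        simp only [← Finset.mul_sum]
        rw [← Finset.sum_mul, h1, one_mul]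
    _ ≤ _ := by
        refine Finset.sum_le_sum fun T _ => Finset.sum_le_sum fun r _ =>
          mul_le_mul_of_nonneg_left ?_ (P.trigProb_nonneg T)
        have hr : r ∈ (P.rrList (r, T)).toFinset :=
          List.mem_toFinset.2 (((P.genRR_spec (r, T)).2.1 r).2 .refl)
        rw [hit, surv_rrList, ← Finset.mul_prod_erase _ _ hr]
        have h2 : ∏ v ∈ (P.rrList (r, T)).toFinset.erase r, (1 - P.h v x) ≤ 1 :=
          Finset.prod_le_one (fun v _ => sub_nonneg.2 (P.h_le_one v hx))
            fun v _ => sub_le_self _ (P.h_nonneg v hx)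
        have h3 := mul_le_mul_of_nonneg_left h2 (sub_nonneg.2 (P.h_le_one r hx))
        linarith

theorem g_nonneg [NeZero n] {x : Fin d → ℝ} (hx : ∀ j, 0 ≤ x j) : 0 ≤ P.g x :=
  (Finset.sum_nonneg fun v _ => P.h_nonneg v hx).trans (P.sum_h_le_g hx)

theorem latticeMix_nonneg {δ : ℝ} (hδ : 0 ≤ δ) (a : Fin d → ℕ) (j : Fin d) :
    0 ≤ latticeMix δ a j := mul_nonneg (Nat.cast_nonneg _) hδ

end LIM

/-! ### The number of strategy mixes that use the whole budget -/

theorem multichoose_le_pow (d K : ℕ) : d.multichoose K ≤ d ^ K := by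
  induction d generalizing K with
  | zero => cases K <;> simp
  | succ d ihd =>
    induction K with
    | zero => simp
    | succ K ihK =>
      rw [Nat.multichoose_succ_succ]
      have h1 : d ^ (K + 1) ≤ (d + 1) ^ K * d := by
        rw [pow_succ]; gcongr; omega
      have := ihd (K + 1)
      rw [pow_succ (d + 1)]
      linarith

theorem multichoose_le_pow' (d : ℕ) {K : ℕ} (hK : 2 ≤ K) : d.multichoose K ≤ K ^ d := by
  induction K, hK using Nat.le_induction generalizing d with
  | base =>
    induction d with
    | zero => simp
    | succ d ih =>
      rw [Nat.multichoose_succ_succ, Nat.multichoose_one_right, pow_succ]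
      have := Nat.lt_two_pow_self (n := d)
      have ih' : d.multichoose (1 + 1) ≤ 2 ^ d := ih
      omega
  | succ K hK ih =>
    induction d with
    | zero => simp
    | succ d ihd =>
      rw [Nat.multichoose_succ_succ]
      have h1 := ih (d + 1)
      have h2 : K ^ (d + 1) ≤ (K + 1) ^ d * K := by
        rw [pow_succ]; gcongr; omega
      rw [pow_succ (K + 1)]
      linarith

theorem card_budgetMixes_le {d K : ℕ} [NeZero d] {k δ : ℝ} (hK : 2 ≤ K) (hδ : 0 < δ)
    (hk : k = K * δ) :
    ((Finset.piAntidiag (Finset.univ : Finset (Fin d)) K).card : ℝ) ≤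
      Real.exp (paramM d k δ) := by
  have hkδ : k / δ = K := by rw [hk, mul_div_cancel_right₀ _ hδ.ne']
  have hcard : (Finset.piAntidiag (Finset.univ : Finset (Fin d)) K).card = d.multichoose K := by
    rw [← Finset.map_sym_eq_piAntidiag, Finset.card_map, Finset.sym_univ, Finset.card_univ,
      Sym.card_sym_eq_multichoose, Fintype.card_fin]
  have hd : (0 : ℝ) < d := by exact_mod_cast NeZero.pos d
  have hK0 : (0 : ℝ) < K := by exact_mod_cast (by omega : 0 < K)
  rw [hcard, paramM, hkδ]
  rcases min_choice ((K : ℝ) * Real.log d) (d * Real.log K) with h | h <;> rw [h]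
  · rw [Real.exp_nat_mul, Real.exp_log hd]
    exact_mod_cast multichoose_le_pow d K
  · rw [Real.exp_nat_mul, Real.exp_log hK0]
    exact_mod_cast multichoose_le_pow' d hK

theorem paramM_nonneg {d K : ℕ} {k δ : ℝ} (hδ : 0 < δ)
    (hk : k = K * δ) : 0 ≤ paramM d k δ := by
  have hkδ : k / δ = K := by rw [hk, mul_div_cancel_right₀ _ hδ.ne']
  rw [paramM, hkδ]
  exact le_min (mul_nonneg (Nat.cast_nonneg _) (Real.log_natCast_nonneg _))
    (mul_nonneg (Nat.cast_nonneg _) (Real.log_natCast_nonneg _))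

/-! ### The binary search for `γ` -/

theorem one_sub_inv_exp_mem : 0 < 1 - 1 / Real.exp 1 ∧ 1 - 1 / Real.exp 1 ≤ 1 := by
  have h1 : 1 < Real.exp 1 := by simp
  have h2 : 1 / Real.exp 1 < 1 := by rw [div_lt_one (by positivity)]; exact h1
  have h3 : 0 < 1 / Real.exp 1 := by positivity
  constructor <;> linarith

section Params

variable {n d : ℕ} {k δ ε ℓ : ℝ}

theorem log_two_le_log (hn : 2 ≤ n) : Real.log 2 ≤ Real.log n :=
  Real.log_le_log two_pos (by exact_mod_cast hn)

theorem paramAlpha_sq (hn : 2 ≤ n) (hℓ : 0 ≤ ℓ) :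
    paramAlpha n ℓ ^ 2 = ℓ * Real.log n + Real.log 2 := by
  have h1 := log_two_le_log hn
  have h2 : 0 < Real.log 2 := Real.log_pos one_lt_two
  rw [paramAlpha, Real.sq_sqrt]
  nlinarith

theorem paramBeta_sq (hM : 0 ≤ paramM d k δ) :
    paramBeta n d k δ ℓ ^ 2 =
      (1 - 1 / Real.exp 1) * (paramM d k δ + paramAlpha n ℓ ^ 2) := by
  rw [paramBeta, Real.sq_sqrt]
  exact mul_nonneg one_sub_inv_exp_mem.1.le (by positivity)

theorem lamStar_le (hn : 2 ≤ n) (hM : 0 ≤ paramM d k δ) (hε : 0 < ε) (hℓ : 0 ≤ ℓ) :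
    lamStar n d k δ ε ℓ ≤
      8 * n * (paramM d k δ + ℓ * Real.log n + Real.log 2) / ε ^ 2 := by
  obtain ⟨hc0, hc1⟩ := one_sub_inv_exp_mem
  have hA := paramAlpha_sq hn hℓ
  have hB := paramBeta_sq (n := n) (ℓ := ℓ) hM
  rw [lamStar]
  set c := 1 - 1 / Real.exp 1
  set a := paramAlpha n ℓ
  set b := paramBeta n d k δ ℓ
  gcongr ?_ / ε ^ 2
  rw [add_assoc, ← hA]
  have h1 : b ^ 2 ≤ paramM d k δ + a ^ 2 := by rw [hB]; nlinarith [sq_nonneg a]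
  have h2 : (c * a) ^ 2 ≤ a ^ 2 := by
    rw [mul_pow]
    exact mul_le_of_le_one_left (sq_nonneg a) (pow_le_one₀ hc0.le hc1)
  have h3 : (c * a + b) ^ 2 ≤ 4 * (paramM d k δ + a ^ 2) := by
    nlinarith [sq_nonneg (c * a - b)]
  have hn0 : (0 : ℝ) ≤ n := Nat.cast_nonneg n
  nlinarith

/-- Every sufficiently large `γ` passes the test of the binary search: `λ*(ℓ + γ)` grows linearly
in `γ`, and `n ^ γ` exponentially. -/
theorem gammaOK_of_le {c γ : ℝ} (hn : 2 ≤ n) (hM : 0 ≤ paramM d k δ) (hc : 0 ≤ c)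
    (hε : (n : ℝ) ^ (-c) ≤ ε) (hℓ : 0 < ℓ)
    (hγ : 2 * (6 + 2 * c + ℓ + paramM d k δ / Real.log n) ≤ γ) : GammaOK n d k δ ε ℓ γ := by
  have hn0 : (0 : ℝ) < n := by positivity
  have hlog2 : 0 < Real.log 2 := Real.log_pos one_lt_two
  have hL : Real.log 2 ≤ Real.log n := log_two_le_log hn
  set L := Real.log n with hLdef
  set M := paramM d k δ
  have hL0 : 0 < L := by linarith
  have hML : 0 ≤ M / L := by positivity
  have hγ0 : 0 ≤ γ := by linarith
  have hε0 : 0 < ε := (Real.rpow_pos_of_pos hn0 _).trans_le hε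
  have hlog2' : 0.6931471803 < Real.log 2 := Real.log_two_gt_d9
  have hlog2'' : Real.log 2 < 0.6931471808 := Real.log_two_lt_d9
  set u := γ * L with hu
  have hu0 : 0 ≤ u := by positivity
  have hu1 : 2 * ((6 + 2 * c) * L + ℓ * L + M) ≤ u := by
    have := mul_le_mul_of_nonneg_right hγ hL0.le
    have e : 2 * (6 + 2 * c + ℓ + M / L) * L = 2 * ((6 + 2 * c) * L + ℓ * L + M) := by
      field_simp
    linarith
  have hnL : ∀ a : ℝ, (n : ℝ) ^ a = Real.exp (a * L) := fun a => by
    rw [Real.rpow_def_of_pos hn0, mul_comm]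
  have hinv : 1 / ε ^ 2 ≤ Real.exp (2 * c * L) := by
    rw [hnL] at hε
    rw [div_le_iff₀ (by positivity)]
    have h1 : Real.exp (-c * L) ^ 2 ≤ ε ^ 2 := by gcongr
    have h2 : Real.exp (2 * c * L) * Real.exp (-c * L) ^ 2 = 1 := by
      rw [← Real.exp_nat_mul, ← Real.exp_add]
      ring_nf
      simp
    calc (1 : ℝ) = Real.exp (2 * c * L) * Real.exp (-c * L) ^ 2 := h2.symm
      _ ≤ _ := by gcongr
  have hnexp : (n : ℝ) = Real.exp L := (Real.exp_log hn0).symm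
  have hlam := lamStar_le (ℓ := ℓ + γ) hn hM hε0 (by linarith)
  have h2 : lamStar n d k δ ε (ℓ + γ) ≤
      8 * Real.exp ((1 + 2 * c) * L) * (M + ℓ * L + u + 1) := by
    refine hlam.trans ?_
    have e : 8 * (n : ℝ) * (M + (ℓ + γ) * L + Real.log 2) / ε ^ 2 =
        8 * n * (M + (ℓ + γ) * L + Real.log 2) * (1 / ε ^ 2) := by ring
    rw [e]
    calc 8 * (n : ℝ) * (M + (ℓ + γ) * L + Real.log 2) * (1 / ε ^ 2)
        ≤ 8 * n * (M + ℓ * L + u + 1) * Real.exp (2 * c * L) := by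
          refine mul_le_mul ?_ hinv (by positivity) (by positivity)
          refine mul_le_mul_of_nonneg_left ?_ (by positivity)
          rw [hu]; linarith
      _ = _ := by
          rw [hnexp, show (1 + 2 * c) * L = L + 2 * c * L by ring, Real.exp_add]; ring
  have h3 : M + ℓ * L + u + 1 ≤ Real.exp (M + ℓ * L) * (2 * Real.exp (u / 2)) := by
    have a1 := Real.add_one_le_exp (M + ℓ * L)
    have a2 := Real.add_one_le_exp (u / 2)
    have a3 : 0 ≤ M + ℓ * L := by positivity
    calc M + ℓ * L + u + 1 ≤ (M + ℓ * L + 1) * (2 * (u / 2 + 1)) := by nlinarith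
      _ ≤ _ := by gcongr
  have h4 : (1 : ℝ) ≤ Real.exp ((1 + 2 * c) * L) * (M + ℓ * L + u + 1) := by
    have : 1 ≤ Real.exp ((1 + 2 * c) * L) := Real.one_le_exp (by positivity)
    have : 1 ≤ M + ℓ * L + u + 1 := by
      have : 0 ≤ M + ℓ * L := by positivity
      linarith
    nlinarith
  have h5 : lamStar n d k δ ε (ℓ + γ) + 1 ≤ Real.exp u := by
    calc lamStar n d k δ ε (ℓ + γ) + 1
        ≤ 9 * (Real.exp ((1 + 2 * c) * L) * (M + ℓ * L + u + 1)) := by linarith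
      _ ≤ 9 * (Real.exp ((1 + 2 * c) * L) *
          (Real.exp (M + ℓ * L) * (2 * Real.exp (u / 2)))) := by gcongr
      _ = 18 * Real.exp ((1 + 2 * c) * L + (M + ℓ * L) + u / 2) := by
          rw [Real.exp_add _ (u / 2), Real.exp_add _ (M + ℓ * L)]; ring
      _ ≤ Real.exp 3 * Real.exp ((1 + 2 * c) * L + (M + ℓ * L) + u / 2) := by
          gcongr
          have h1 : (2.7 : ℝ) ≤ Real.exp 1 := by linarith [Real.exp_one_gt_d9]
          calc (18 : ℝ) ≤ 2.7 ^ 3 := by norm_num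
            _ ≤ Real.exp 1 ^ 3 := by gcongr
            _ = Real.exp 3 := by rw [← Real.exp_nat_mul]; norm_num
      _ = Real.exp (3 + ((1 + 2 * c) * L + (M + ℓ * L) + u / 2)) := (Real.exp_add _ _).symm
      _ ≤ Real.exp u := Real.exp_le_exp.2 (by linarith)
  rw [GammaOK, hnL, hnL, div_le_div_iff₀ (Real.exp_pos _) (Real.exp_pos _), one_mul]
  have h6 : (⌈lamStar n d k δ ε (ℓ + γ)⌉ : ℝ) ≤ Real.exp u :=
    (Int.ceil_lt_add_one _).le.trans h5
  calc _ ≤ Real.exp u * Real.exp (ℓ * L) := by gcongr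
    _ = _ := by rw [← Real.exp_add, hu]; ring_nf

theorem bisect_spec (r : ℕ) (lo hi : ℝ) (hlo : 0 ≤ lo) (hh : lo ≤ hi)
    (hok : GammaOK n d k δ ε ℓ hi) :
    0 ≤ (bisect n d k δ ε ℓ r lo hi).val ∧ (bisect n d k δ ε ℓ r lo hi).val ≤ hi ∧
      GammaOK n d k δ ε ℓ (bisect n d k δ ε ℓ r lo hi).val ∧
      (bisect n d k δ ε ℓ r lo hi).steps = r := by
  induction r generalizing lo hi with
  | zero => exact ⟨hlo.trans hh, le_rfl, hok, rfl⟩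
  | succ r ih =>
    simp only [bisect, Timed.val_bind, Timed.steps_bind, Timed.steps_tick]
    split_ifs with h
    · obtain ⟨h1, h2, h3, h4⟩ := ih lo ((lo + hi) / 2) hlo (by linarith) h
      exact ⟨h1, h2.trans (by linarith), h3, by rw [h4, add_comm]⟩
    · obtain ⟨h1, h2, h3, h4⟩ := ih ((lo + hi) / 2) hi (by linarith) (by linarith) hok
      exact ⟨h1, h2, h3, by rw [h4, add_comm]⟩

/-- The binary search returns an admissible `γ`, which need not be the least one, and it overshoots
the bound of `gammaOK_of_le` at most by the factor `2`. -/
theorem findGamma_spec {c : ℝ} (hn : 2 ≤ n) (hM : 0 ≤ paramM d k δ) (hc : 0 ≤ c)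
    (hε : (n : ℝ) ^ (-c) ≤ ε) (hℓ : 0 < ℓ) :
    0 ≤ (findGamma n d k δ ε ℓ).val ∧ GammaOK n d k δ ε ℓ (findGamma n d k δ ε ℓ).val ∧
      (findGamma n d k δ ε ℓ).val ≤ 4 * (6 + 2 * c + ℓ + paramM d k δ / Real.log n) ∧
      ((findGamma n d k δ ε ℓ).steps : ℝ) ≤
        12 * (6 + 2 * c + ℓ + paramM d k δ / Real.log n) := by
  set J := sInf {j : ℕ | GammaOK n d k δ ε ℓ (2 ^ j)} with hJ
  set γ₀ := 2 * (6 + 2 * c + ℓ + paramM d k δ / Real.log n) with hγ₀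
  have hML : 0 ≤ paramM d k δ / Real.log n :=
    div_nonneg hM (Real.log_natCast_nonneg _)
  have hne : {j : ℕ | GammaOK n d k δ ε ℓ (2 ^ j)}.Nonempty := by
    obtain ⟨j, hj⟩ := pow_unbounded_of_one_lt γ₀ (one_lt_two : (1 : ℝ) < 2)
    exact ⟨j, gammaOK_of_le hn hM hc hε hℓ hj.le⟩
  have hJok : GammaOK n d k δ ε ℓ (2 ^ J) := Nat.sInf_mem hne
  have hJle : (2 : ℝ) ^ J ≤ 2 * γ₀ := by
    rcases Nat.eq_zero_or_pos J with h | h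
    · rw [h, pow_zero]; linarith
    · have h1 : J - 1 ∉ {j : ℕ | GammaOK n d k δ ε ℓ (2 ^ j)} :=
        Nat.notMem_of_lt_sInf (by omega)
      have h2 : (2 : ℝ) ^ (J - 1) < γ₀ := by
        by_contra! h2
        exact h1 (gammaOK_of_le hn hM hc hε hℓ h2)
      calc (2 : ℝ) ^ J = 2 * 2 ^ (J - 1) := by
            rw [← pow_succ', Nat.sub_add_cancel h]
        _ ≤ _ := by linarith
  obtain ⟨h1, h2, h3, h4⟩ := bisect_spec J 0 (2 ^ J) le_rfl (by positivity) hJok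
  have hval : (findGamma n d k δ ε ℓ).val = (bisect n d k δ ε ℓ J 0 (2 ^ J)).val := by
    simp [findGamma, hJ]
  have hsteps : (findGamma n d k δ ε ℓ).steps = J + 1 + J := by
    have : (findGamma n d k δ ε ℓ).steps = J + 1 + (bisect n d k δ ε ℓ J 0 (2 ^ J)).steps := by
      simp [findGamma, hJ]
    rw [this, h4]
  rw [hval, hsteps]
  refine ⟨h1, h3, by linarith, ?_⟩
  have h5 : (J : ℝ) + 1 ≤ 2 ^ J := by exact_mod_cast Nat.lt_two_pow_self (n := J)
  have h6 : (1 : ℝ) ≤ 2 ^ J := one_le_pow₀ one_le_two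
  push_cast
  linarith

end Params

/-! ### The sampling phase -/

namespace LIM

variable {n d : ℕ} (P : LIM n d)

/-- The number of RR sets in round `i` of the loop. -/
def loopSize (n : ℕ) (lam' : ℝ) (i : ℕ) : ℕ := ⌊lam' / ((n : ℝ) / 2 ^ i)⌋₊ + 1

theorem loopSize_mono {lam' : ℝ} (h : 0 ≤ lam') : Monotone (loopSize n lam') := by
  intro i j hij
  refine Nat.add_le_add_right (Nat.floor_le_floor ?_) 1
  rw [div_div_eq_mul_div, div_div_eq_mul_div]
  gcongr
  exact one_le_two

/-- The estimate of the spread of the greedy solution on the first `N` RR sets. -/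
def greedyEstimate [NeZero d] (k δ : ℝ) (ω : ℕ → Draw n) (N : ℕ) : ℝ :=
  (n : ℝ) / N * P.cov (P.rrPrefix ω N) (P.lgreedy k δ (P.rrPrefix ω N)).val

/-- Up to a constant factor, the cost of lattice greedy on the first `N` RR sets. -/
def roundCost (K : ℕ) (ω : ℕ → Draw n) (N : ℕ) : ℕ :=
  K * (d + P.maxS * ∑ t ∈ Finset.range N, P.rrCost (ω t))

theorem sum_length_rrPrefix_le (ω : ℕ → Draw n) (N : ℕ) :
    ((P.rrPrefix ω N).map List.length).sum ≤ ∑ t ∈ Finset.range N, P.rrCost (ω t) := by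
  induction N with
  | zero => simp [TriggeringModel.rrPrefix]
  | succ N ih =>
    rw [Finset.sum_range_succ]
    have := P.length_rrList_le (ω N)
    simp only [TriggeringModel.rrPrefix, List.range_succ, List.map_append, List.sum_append,
      List.map_cons, List.map_nil, List.sum_cons, List.sum_nil, add_zero] at ih ⊢
    omega

theorem one_le_length_of_mem_rrPrefix {ω : ℕ → Draw n} {N : ℕ} {R : List (Fin n)}
    (h : R ∈ P.rrPrefix ω N) : 1 ≤ R.length := by
  simp only [TriggeringModel.rrPrefix, List.mem_map] at h
  obtain ⟨t, -, rfl⟩ := h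
  exact P.one_le_length_rrList _

theorem roundCost_mono (K : ℕ) (ω : ℕ → Draw n) : Monotone (P.roundCost K ω) := by
  intro N N' h
  unfold roundCost
  gcongr

variable [NeZero d]

theorem lgreedy_rrPrefix_steps {K : ℕ} {k δ : ℝ} (hK : 1 ≤ K) (hKk : ⌊k / δ⌋₊ = K)
    (hc : 1 ≤ P.maxS) (ω : ℕ → Draw n) (N : ℕ) :
    (P.lgreedy k δ (P.rrPrefix ω N)).steps ≤ 7 * P.roundCost K ω N := by
  refine (P.lgreedy_steps hK hKk hc _ fun R => P.one_le_length_of_mem_rrPrefix).trans ?_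
  unfold roundCost
  gcongr
  exact P.sum_length_rrPrefix_le ω N

/-- The cost of generating the RR sets is dominated by the cost of lattice greedy. -/
theorem sum_rrCost_le_roundCost {K : ℕ} (hK : 1 ≤ K) (hc : 1 ≤ P.maxS) (ω : ℕ → Draw n)
    (N : ℕ) : 1 + P.maxS * ∑ t ∈ Finset.range N, P.rrCost (ω t) ≤ P.roundCost K ω N ∧
      ∑ t ∈ Finset.range N, P.rrCost (ω t) ≤
        P.maxS * ∑ t ∈ Finset.range N, P.rrCost (ω t) := by
  have hd : 1 ≤ d := NeZero.one_le
  exact ⟨(Nat.add_le_add_right hd _).trans (Nat.le_mul_of_pos_left _ hK),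
    Nat.le_mul_of_pos_left _ hc⟩

/-- In round `i` the loop works with the first `loopSize n lam' i` RR sets. It ends in round `e`,
or, if `e = a + m`, after the last round. -/
theorem lowerBoundLoop_spec {k δ ε' lam' : ℝ} (hlam : 0 ≤ lam') (ω : ℕ → Draw n)
    (m a N₀ : ℕ) (h : N₀ ≤ loopSize n lam' a) :
    let r := P.lowerBoundLoop ω k δ ε' lam' (List.range' a m) (P.rrPrefix ω N₀)
    ∃ e N, a ≤ e ∧ e ≤ a + m ∧ r.val.1 = P.rrPrefix ω N ∧ N ≤ loopSize n lam' e ∧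
      (∀ i, a ≤ i → i < e →
        P.greedyEstimate k δ ω (loopSize n lam' i) < (1 + ε') * ((n : ℝ) / 2 ^ i)) ∧
      ((e = a + m ∧ r.val.2 = 1) ∨ (e < a + m ∧
        (1 + ε') * ((n : ℝ) / 2 ^ e) ≤ P.greedyEstimate k δ ω (loopSize n lam' e) ∧
        r.val.2 = P.greedyEstimate k δ ω (loopSize n lam' e) / (1 + ε'))) ∧
      (∀ K, 1 ≤ K → ⌊k / δ⌋₊ = K → 1 ≤ P.maxS →
        r.steps ≤ ∑ i ∈ Finset.Ico a (e + 1), 16 * P.roundCost K ω (loopSize n lam' i)) := by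
  induction m generalizing a N₀ with
  | zero =>
    exact ⟨a, N₀, le_rfl, le_rfl, rfl, h, fun i h1 h2 => absurd h1 (by omega),
      .inl ⟨rfl, rfl⟩, fun K _ _ _ => Nat.zero_le _⟩
  | succ m ih =>
    obtain ⟨f1, f2⟩ := P.fill_spec ω (lam' / ((n : ℝ) / 2 ^ a)) N₀
    have hmax : max N₀ (⌊lam' / ((n : ℝ) / 2 ^ a)⌋₊ + 1) = loopSize n lam' a := max_eq_right h
    rw [hmax] at f1 f2
    set Na := loopSize n lam' a with hNa
    have hest : (P.estimate (P.lgreedy k δ (P.rrPrefix ω Na)).val (P.rrPrefix ω Na)).val =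
        P.greedyEstimate k δ ω Na := by
      rw [estimate_val, TriggeringModel.length_rrPrefix, greedyEstimate]
    have hcost : ∀ K, 1 ≤ K → ⌊k / δ⌋₊ = K → 1 ≤ P.maxS →
        1 + ((P.fill ω (lam' / ((n : ℝ) / 2 ^ a)) (P.rrPrefix ω N₀)).steps +
          ((P.lgreedy k δ (P.rrPrefix ω Na)).steps +
          (P.estimate (P.lgreedy k δ (P.rrPrefix ω Na)).val (P.rrPrefix ω Na)).steps)) ≤
        16 * P.roundCost K ω Na := by
      intro K hK hKk hc
      have h1 := P.lgreedy_rrPrefix_steps hK hKk hc ω Na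
      have h2 := P.estimate_steps (P.lgreedy k δ (P.rrPrefix ω Na)).val hc (P.rrPrefix ω Na)
        fun R => P.one_le_length_of_mem_rrPrefix
      have h3 := Nat.mul_le_mul_left P.maxS (P.sum_length_rrPrefix_le ω Na)
      obtain ⟨h4, h5⟩ := P.sum_rrCost_le_roundCost hK hc ω Na
      omega
    intro r
    have hr : r = P.lowerBoundLoop ω k δ ε' lam' (List.range' a (m + 1)) (P.rrPrefix ω N₀) := rfl
    rw [List.range'_succ, lowerBoundLoop] at hr
    by_cases hcond : (1 + ε') * ((n : ℝ) / 2 ^ a) ≤ P.greedyEstimate k δ ω Na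
    · have hv : r.val = (P.rrPrefix ω Na, P.greedyEstimate k δ ω Na / (1 + ε')) := by
        rw [hr]
        simp only [Timed.val_bind, f1, hest, if_pos hcond, Timed.val_pure]
      refine ⟨a, Na, le_rfl, by omega, by rw [hv], le_rfl, fun i h1 h2 => absurd h1 (by omega),
        .inr ⟨by omega, hcond, by rw [hv]⟩, fun K hK hKk hc => ?_⟩
      rw [hr]
      simp only [Timed.steps_bind, Timed.steps_tick, f1, hest, if_pos hcond, Timed.steps_pure]
      simpa using hcost K hK hKk hc
    · obtain ⟨e, N, e1, e2, e3, e4, e5, e6, e7⟩ := ih (a + 1) Na (loopSize_mono hlam (by omega))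
      have hv : r.val = (P.lowerBoundLoop ω k δ ε' lam' (List.range' (a + 1) m)
          (P.rrPrefix ω Na)).val := by
        rw [hr]
        simp only [Timed.val_bind, f1, hest, if_neg hcond]
      refine ⟨e, N, by omega, by omega, by rw [hv, e3], e4, fun i h1 h2 => ?_, ?_,
        fun K hK hKk hc => ?_⟩
      · rcases Nat.eq_or_lt_of_le h1 with rfl | h1
        · exact not_le.1 hcond
        · exact e5 i h1 h2
      · rw [hv]
        rcases e6 with ⟨e6, e6'⟩ | ⟨e6, e6'⟩
        · exact .inl ⟨by omega, e6'⟩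
        · exact .inr ⟨by omega, e6'⟩
      · rw [hr]
        simp only [Timed.steps_bind, Timed.steps_tick, f1, hest, if_neg hcond]
        rw [Finset.sum_eq_sum_Ico_succ_bot (by omega), ← hNa]
        have h1 := hcost K hK hKk hc
        have h2 := e7 K hK hKk hc
        omega

/-- The confidence parameter `ℓ'` of the sampling phase. -/
def innerConf (n d : ℕ) (k δ ε ℓ : ℝ) : ℝ :=
  ℓ + (findGamma n d k δ ε ℓ).val + Real.log 2 / Real.log n

/-- The values and the costs of a run: `e` is the last round of the loop, and `1 + log₂ n` if the
loop has run to its end; `N` is the number of the RR sets of the sampling loop. -/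
theorem immPRR_spec {k δ ε ℓ : ℝ}
    (hlam : 0 ≤ lamPrime n d k δ (√2 * ε) (innerConf n d k δ ε ℓ)) (ω : ℕ → Draw n) :
    ∃ e N LB, 1 ≤ e ∧ e ≤ 1 + Nat.log 2 n ∧
      (P.immPRR k δ ε ℓ ω).val = (P.lgreedy k δ (P.rrPrefix ω
        (max N (⌊lamStar n d k δ ε (innerConf n d k δ ε ℓ) / LB⌋₊ + 1)))).val ∧
      N ≤ loopSize n (lamPrime n d k δ (√2 * ε) (innerConf n d k δ ε ℓ)) e ∧
      (∀ i, 1 ≤ i → i < e → P.greedyEstimate k δ ω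
        (loopSize n (lamPrime n d k δ (√2 * ε) (innerConf n d k δ ε ℓ)) i) <
          (1 + √2 * ε) * ((n : ℝ) / 2 ^ i)) ∧
      ((e = 1 + Nat.log 2 n ∧ LB = 1) ∨ (e < 1 + Nat.log 2 n ∧
        (1 + √2 * ε) * ((n : ℝ) / 2 ^ e) ≤ P.greedyEstimate k δ ω
          (loopSize n (lamPrime n d k δ (√2 * ε) (innerConf n d k δ ε ℓ)) e) ∧
        LB = P.greedyEstimate k δ ω
          (loopSize n (lamPrime n d k δ (√2 * ε) (innerConf n d k δ ε ℓ)) e) / (1 + √2 * ε))) ∧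
      (∀ K, 1 ≤ K → ⌊k / δ⌋₊ = K → 1 ≤ P.maxS →
        (P.immPRR k δ ε ℓ ω).steps ≤ n + 2 + (findGamma n d k δ ε ℓ).steps +
          ∑ i ∈ Finset.Ico 1 (e + 1), 16 * P.roundCost K ω
            (loopSize n (lamPrime n d k δ (√2 * ε) (innerConf n d k δ ε ℓ)) i) +
          16 * P.roundCost K ω
            (max N (⌊lamStar n d k δ ε (innerConf n d k δ ε ℓ) / LB⌋₊ + 1))) := by
  obtain ⟨e, N, e1, e2, e3, e4, e5, e6, e7⟩ := P.lowerBoundLoop_spec (k := k) (δ := δ)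
    (ε' := √2 * ε) hlam ω (Nat.log 2 n) 1 0 (Nat.zero_le _)
  rw [show P.rrPrefix ω 0 = [] from rfl] at e3 e6 e7
  set r := P.lowerBoundLoop ω k δ (√2 * ε)
    (lamPrime n d k δ (√2 * ε) (innerConf n d k δ ε ℓ)) (List.range' 1 (Nat.log 2 n)) [] with hr
  obtain ⟨f1, f2⟩ := P.fill_spec ω
    (lamStar n d k δ ε (innerConf n d k δ ε ℓ) / r.val.2) N
  have hs : P.sampling ω k δ ε ℓ = (do
      let _ ← findGamma n d k δ ε ℓ
      tick 1
      let r ← r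
      tick 1
      P.fill ω (lamStar n d k δ ε (innerConf n d k δ ε ℓ) / r.2) r.1) := rfl
  have hsv : (P.sampling ω k δ ε ℓ).val = P.rrPrefix ω
      (max N (⌊lamStar n d k δ ε (innerConf n d k δ ε ℓ) / r.val.2⌋₊ + 1)) := by
    rw [hs]
    simp only [Timed.val_bind]
    rw [e3, f1]
  refine ⟨e, N, r.val.2, e1, e2, ?_, e4, e5, e6, fun K hK hKk hc => ?_⟩
  · simp only [immPRR, Timed.val_bind, hsv]
  · simp only [immPRR, Timed.steps_bind, Timed.steps_tick, hsv]
    have h1 := e7 K hK hKk hc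
    have h2 := P.lgreedy_rrPrefix_steps hK hKk hc ω
      (max N (⌊lamStar n d k δ ε (innerConf n d k δ ε ℓ) / r.val.2⌋₊ + 1))
    obtain ⟨h4, h5⟩ := P.sum_rrCost_le_roundCost hK hc ω
      (max N (⌊lamStar n d k δ ε (innerConf n d k δ ε ℓ) / r.val.2⌋₊ + 1))
    rw [hs]
    simp only [Timed.steps_bind, Timed.steps_tick]
    rw [e3]
    omega

end LIM

/-! ### The approximation guarantee -/

section Params

variable {n d : ℕ} {k δ ε ℓ : ℝ}

/-- With `c = 1 - 1/e`, `a = α(ℓ)` and `b = β(ℓ)`, this says that `λ*(ℓ) / α(ℓ)²` is decreasing in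
`ℓ`. -/
theorem lamStar_ratio {c a b a' b' M : ℝ} (hc : 0 ≤ c) (ha : 0 ≤ a) (hb : 0 ≤ b) (ha' : 0 ≤ a')
    (hb' : 0 ≤ b') (hM : 0 ≤ M) (hB : b ^ 2 = c * (M + a ^ 2)) (hB' : b' ^ 2 = c * (M + a' ^ 2))
    (haa' : a ^ 2 ≤ a' ^ 2) : (c * a' + b') ^ 2 * a ^ 2 ≤ (c * a + b) ^ 2 * a' ^ 2 := by
  have hba : b' * a ≤ b * a' := by
    refine le_of_sq_le_sq ?_ (by positivity)
    rw [mul_pow, mul_pow, hB, hB']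
    nlinarith [mul_le_mul_of_nonneg_left haa' (mul_nonneg hc hM)]
  rw [← mul_pow, ← mul_pow]
  gcongr ?_ ^ 2
  linarith

/-- With `c = 1 - 1/e`, `a = α(ℓ)` and `b = β(ℓ)`, the right-hand side is `λ*(ℓ)`. -/
theorem lamStar_lower {c a b M ε n : ℝ} (hc0 : 0 < c) (hc1 : c ≤ 1) (ha : 0 ≤ a) (hb : 0 ≤ b)
    (hM : 0 ≤ M) (hB : b ^ 2 = c * (M + a ^ 2)) (hε : 0 < ε) (hεc : ε < c) (hn : 2 ≤ n) :
    8 * a ^ 2 ≤ 2 * n * (c * a + b) ^ 2 / ε ^ 2 := by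
  rw [le_div_iff₀ (by positivity)]
  have h1 : ε ^ 2 ≤ c ^ 2 := by gcongr
  have h2 : c * a ^ 2 ≤ b ^ 2 := by
    rw [hB]; nlinarith [mul_nonneg hc0.le hM]
  have h3 : (c + c ^ 2) * a ^ 2 ≤ (c * a + b) ^ 2 := by
    nlinarith [mul_nonneg (mul_nonneg hc0.le ha) hb]
  have h4 : 2 * c ^ 2 ≤ c + c ^ 2 := by nlinarith
  calc 8 * a ^ 2 * ε ^ 2 ≤ 8 * a ^ 2 * c ^ 2 := by gcongr
    _ = 4 * ((2 * c ^ 2) * a ^ 2) := by ring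
    _ ≤ 4 * ((c + c ^ 2) * a ^ 2) := by gcongr
    _ ≤ 4 * (c * a + b) ^ 2 := by gcongr
    _ ≤ 2 * n * (c * a + b) ^ 2 := by gcongr; linarith

/-- The failure probabilities of the final greedy runs, summed over all sample sizes that exceed
`λ*(ℓ')` divided by the optimum, are at most `1 / (2 n ^ ℓ)`, by the choice of `γ`. -/
theorem final_failure_le {γ : ℝ} (hn : 2 ≤ n) (hM : 0 ≤ paramM d k δ) (hε : 0 < ε)
    (hεc : ε < 1 - 1 / Real.exp 1) (hℓ : 0 < ℓ) (hγ : 0 ≤ γ) (hok : GammaOK n d k δ ε ℓ γ) :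
    2 * Real.exp (-paramAlpha n (ℓ + γ + Real.log 2 / Real.log n) ^ 2) *
      (1 + lamStar n d k δ ε (ℓ + γ + Real.log 2 / Real.log n) /
        paramAlpha n (ℓ + γ + Real.log 2 / Real.log n) ^ 2) ≤ 1 / (2 * (n : ℝ) ^ ℓ) := by
  obtain ⟨hc0, hc1⟩ := one_sub_inv_exp_mem
  have hn0 : (0 : ℝ) < n := by positivity
  have hn2 : (2 : ℝ) ≤ n := by exact_mod_cast hn
  have hlog2 : 0 < Real.log 2 := Real.log_pos one_lt_two
  have hlog2' : 0.6931471803 < Real.log 2 := Real.log_two_gt_d9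
  have hL : Real.log 2 ≤ Real.log n := log_two_le_log hn
  have hL0 : 0 < Real.log n := hlog2.trans_le hL
  have hnL : ∀ a : ℝ, (n : ℝ) ^ a = Real.exp (a * Real.log n) := fun a => by
    rw [Real.rpow_def_of_pos hn0, mul_comm]
  have hℓ' : 0 ≤ ℓ + γ + Real.log 2 / Real.log n := by positivity
  have hA' := paramAlpha_sq hn hℓ'
  have hA := paramAlpha_sq (ℓ := ℓ + γ) hn (by positivity)
  have hB' := paramBeta_sq (n := n) (ℓ := ℓ + γ + Real.log 2 / Real.log n) hM
  have hB := paramBeta_sq (n := n) (ℓ := ℓ + γ) hM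
  have hA'2 : (ℓ + γ + Real.log 2 / Real.log n) * Real.log n + Real.log 2 =
      (ℓ + γ) * Real.log n + 2 * Real.log 2 := by
    field_simp; ring
  rw [hA'2] at hA'
  have hgam : lamStar n d k δ ε (ℓ + γ) ≤ Real.exp (γ * Real.log n) := by
    rw [GammaOK, hnL, hnL, div_le_div_iff₀ (Real.exp_pos _) (Real.exp_pos _), one_mul,
      add_mul, Real.exp_add, mul_comm (Real.exp (ℓ * Real.log n))] at hok
    exact (Int.le_ceil _).trans (le_of_mul_le_mul_right hok (Real.exp_pos _))
  have hexp' : Real.exp (-paramAlpha n (ℓ + γ + Real.log 2 / Real.log n) ^ 2) =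
      Real.exp (-(ℓ * Real.log n)) * Real.exp (-(γ * Real.log n)) / 4 := by
    rw [hA', show -((ℓ + γ) * Real.log n + 2 * Real.log 2) =
      -(ℓ * Real.log n) + -(γ * Real.log n) - 2 * Real.log 2 by ring, Real.exp_sub, Real.exp_add,
      two_mul, Real.exp_add (Real.log 2), Real.exp_log two_pos]
    norm_num
  have haa' : paramAlpha n (ℓ + γ) ^ 2 ≤
      paramAlpha n (ℓ + γ + Real.log 2 / Real.log n) ^ 2 := by rw [hA, hA']; linarith
  have ha2 : Real.log 2 ≤ paramAlpha n (ℓ + γ) ^ 2 := by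
    rw [hA]
    exact le_add_of_nonneg_left (by positivity)
  have hΛ8 : 8 * paramAlpha n (ℓ + γ) ^ 2 ≤ lamStar n d k δ ε (ℓ + γ) :=
    lamStar_lower hc0 hc1 (Real.sqrt_nonneg _) (Real.sqrt_nonneg _) hM hB hε hεc hn2
  have hγlog : 2 * Real.log 2 ≤ γ * Real.log n := by
    have h4 : (4 : ℝ) ≤ Real.exp (γ * Real.log n) := by linarith
    have := Real.log_le_log (by norm_num) h4
    rwa [Real.log_exp, show (4 : ℝ) = 2 ^ 2 by norm_num, Real.log_pow, Nat.cast_ofNat] at this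
  have ha2' : 2 ≤ paramAlpha n (ℓ + γ) ^ 2 := by
    rw [hA, add_mul]
    have : 0 < ℓ * Real.log n := by positivity
    linarith
  -- `λ*(ℓ) / α(ℓ)²` is decreasing in `ℓ`.
  have hratio : lamStar n d k δ ε (ℓ + γ + Real.log 2 / Real.log n) /
      paramAlpha n (ℓ + γ + Real.log 2 / Real.log n) ^ 2 ≤
      lamStar n d k δ ε (ℓ + γ) / paramAlpha n (ℓ + γ) ^ 2 := by
    rw [div_le_div_iff₀ (by linarith) (by linarith), lamStar, lamStar]
    have h := lamStar_ratio hc0.le (Real.sqrt_nonneg _) (Real.sqrt_nonneg _) (Real.sqrt_nonneg _)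
      (Real.sqrt_nonneg _) hM hB hB' haa'
    rw [div_mul_eq_mul_div, div_mul_eq_mul_div, mul_assoc (2 * (n : ℝ)), mul_assoc (2 * (n : ℝ))]
    exact div_le_div_of_nonneg_right (mul_le_mul_of_nonneg_left h (by positivity))
      (by positivity)
  have hfin : 1 + lamStar n d k δ ε (ℓ + γ + Real.log 2 / Real.log n) /
      paramAlpha n (ℓ + γ + Real.log 2 / Real.log n) ^ 2 ≤ Real.exp (γ * Real.log n) := by
    have h1 : lamStar n d k δ ε (ℓ + γ) / paramAlpha n (ℓ + γ) ^ 2 ≤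
        lamStar n d k δ ε (ℓ + γ) / 2 :=
      div_le_div_of_nonneg_left (by linarith) two_pos ha2'
    linarith
  rw [hexp', hnL, one_div, mul_inv, ← Real.exp_neg]
  have h1 : Real.exp (-(γ * Real.log n)) * Real.exp (γ * Real.log n) = 1 := by
    rw [← Real.exp_add]; simp
  refine (mul_le_mul_of_nonneg_left hfin (by positivity)).trans_eq ?_
  calc _ = Real.exp (-(ℓ * Real.log n)) / 2 *
        (Real.exp (-(γ * Real.log n)) * Real.exp (γ * Real.log n)) := by ring
    _ = _ := by rw [h1]; ring

/-- The sum over all sample sizes from `N₀` on. -/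
theorem tsum_exp_le {A θ : ℝ} (hA : 0 < A) (hθ : 0 < θ) (N₀ : ℕ) (hN : θ ≤ N₀) :
    ∑' j : ℕ, ENNReal.ofReal (2 * Real.exp (-(A * ((N₀ + j : ℕ) / θ)))) ≤
      ENNReal.ofReal (2 * Real.exp (-A) * (1 + θ / A)) := by
  set r := Real.exp (-(A / θ)) with hr
  have hr0 : 0 ≤ r := (Real.exp_pos _).le
  have hu : 0 < A / θ := by positivity
  have hr1 : r < 1 := by rw [hr, Real.exp_lt_one_iff]; linarith
  have hterm : ∀ j : ℕ, 2 * Real.exp (-(A * ((N₀ + j : ℕ) / θ))) ≤ 2 * Real.exp (-A) * r ^ j := by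
    intro j
    rw [mul_assoc, hr, ← Real.exp_nat_mul, ← Real.exp_add]
    gcongr
    push_cast
    have h1 : 1 ≤ (N₀ : ℝ) / θ := (one_le_div hθ).2 hN
    have h2 : A * ((N₀ + j : ℝ) / θ) = A * (N₀ / θ) + j * (A / θ) := by ring
    rw [h2]
    nlinarith
  calc _ ≤ ∑' j : ℕ, ENNReal.ofReal (2 * Real.exp (-A) * r ^ j) :=
        ENNReal.tsum_le_tsum fun j => ENNReal.ofReal_le_ofReal (hterm j)
    _ = ENNReal.ofReal (∑' j : ℕ, 2 * Real.exp (-A) * r ^ j) :=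
        (ENNReal.ofReal_tsum_of_nonneg (fun j => by positivity)
          ((summable_geometric_of_lt_one hr0 hr1).mul_left _)).symm
    _ ≤ _ := by
        rw [tsum_mul_left, tsum_geometric_of_lt_one hr0 hr1]
        refine ENNReal.ofReal_le_ofReal ?_
        gcongr
        have h1 := Real.add_one_le_exp (A / θ)
        have h2 : r * Real.exp (A / θ) = 1 := by rw [hr, ← Real.exp_add]; simp
        rw [inv_le_iff_one_le_mul₀ (by linarith)]
        have h3 : θ / A = 1 / (A / θ) := by rw [one_div_div]
        rw [h3]
        have h4 : r * (A / θ + 1) ≤ 1 := (mul_le_mul_of_nonneg_left h1 hr0).trans h2.le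
        have h5 : (1 - r) * (1 + 1 / (A / θ)) = (A / θ + 1 - r * (A / θ + 1)) / (A / θ) := by
          field_simp
        rw [mul_comm, h5, le_div_iff₀ hu]
        linarith

end Params

namespace LIM

variable {n d : ℕ} (P : LIM n d)

theorem exists_optimum (K : ℕ) (δ : ℝ) : ∃ a : Fin d → ℕ, ∑ j, a j ≤ K ∧
    ∀ b : Fin d → ℕ, ∑ j, b j ≤ K → P.g (latticeMix δ b) ≤ P.g (latticeMix δ a) := by
  have hfin : {b : Fin d → ℕ | ∑ j, b j ≤ K}.Finite := by
    refine (Set.finite_Iic (fun _ : Fin d => K)).subset fun b hb j => ?_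
    exact (Finset.single_le_sum (f := b) (fun _ _ => Nat.zero_le _) (Finset.mem_univ j)).trans hb
  exact Set.exists_max_image _ (fun b => P.g (latticeMix δ b)) hfin
    ⟨0, show ∑ j, (0 : Fin d → ℕ) j ≤ K by simp⟩

variable [NeZero n]

theorem integral_hit (x : Fin d → ℝ) : ∫ ω, P.hit x ω ∂P.drawLaw = P.g x / n := by
  have hn : (n : ℝ) ≠ 0 := by exact_mod_cast NeZero.ne n
  rw [g_eq, mul_div_cancel_left₀ _ hn]

variable [NeZero d]

/-- A union bound over the possible outputs of greedy: they rarely look much better than `ζ` if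
none of them is better than `ζ`. -/
theorem measure_greedyEstimate_ge {K N : ℕ} {k δ ζ ε' : ℝ} (hK : 1 ≤ K) (hδ : 0 < δ)
    (hk : k = K * δ) (hN : 0 < N) (hζ : 0 < ζ) (hε' : 0 ≤ ε')
    (hg : ∀ b : Fin d → ℕ, ∑ j, b j = K → P.g (latticeMix δ b) ≤ ζ) :
    P.tape {ω | (1 + ε') * ζ ≤ P.greedyEstimate k δ ω N} ≤
      (Finset.piAntidiag (Finset.univ : Finset (Fin d)) K).card *
        ENNReal.ofReal (Real.exp (-(N * (ζ / n) * (ε' ^ 2 / (2 + 2 / 3 * ε'))))) := by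
  have hn : (0 : ℝ) < n := by exact_mod_cast NeZero.pos n
  have hN' : (0 : ℝ) < N := by exact_mod_cast hN
  have hsub : {ω | (1 + ε') * ζ ≤ P.greedyEstimate k δ ω N} ⊆
      ⋃ b ∈ Finset.piAntidiag (Finset.univ : Finset (Fin d)) K,
        {ω | N * (ζ / n) + N * (ζ / n) * ε' ≤
          ∑ s ∈ Finset.range N, P.hit (latticeMix δ b) (ω s)} := by
    intro ω hω
    obtain ⟨b, hb, hbK, -⟩ := P.lgreedy_spec hK hδ hk (P.rrPrefix ω N)
    refine Set.mem_biUnion (x := b) (by simpa using hbK) ?_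
    have h1 : (1 + ε') * ζ ≤ P.greedyEstimate k δ ω N := hω
    rw [greedyEstimate, hb, cov_rrPrefix, div_mul_eq_mul_div, le_div_iff₀ hN'] at h1
    rw [Set.mem_ofPred_eq]
    have e : N * (ζ / n) + N * (ζ / n) * ε' = (1 + ε') * ζ * N / n := by ring
    rw [e, div_le_iff₀ hn]
    linarith
  refine (measure_mono hsub).trans ((measure_biUnion_finset_le _ _).trans ?_)
  refine le_trans (Finset.sum_le_card_nsmul _ _ _ fun b hb => ?_) (nsmul_eq_mul _ _).le
  have hbK : ∑ j, b j = K := by simpa using hb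
  have hx := latticeMix_nonneg hδ.le b
  refine (P.tape_upper_tail (P.hit_nonneg hx) (P.hit_le_one hx) N (μ := ζ / n) ?_
    (by positivity) (by positivity)).trans (ENNReal.ofReal_le_ofReal (Real.exp_le_exp.2 ?_))
  · rw [integral_hit]
    gcongr
    exact hg b hbK
  · refine le_of_eq ?_
    field_simp

/-- The failure probability of lattice greedy on `N` RR sets. The values of `hit` are divided by
`min 1 OPT`, which bounds them, so that an optimum below `1` does no harm. -/
theorem measure_lgreedy_fail {K N : ℕ} {k δ ε a b M : ℝ} (hK : 1 ≤ K) (hδ : 0 < δ)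
    (hk : k = K * δ) (hε : 0 < ε) (hεc : ε < 1 - 1 / Real.exp 1) (ha : 0 < a) (hb : 0 < b)
    (hM : 0 ≤ M) (hbM : b ^ 2 = (1 - 1 / Real.exp 1) * (M + a ^ 2))
    (hcard : ((Finset.piAntidiag (Finset.univ : Finset (Fin d)) K).card : ℝ) ≤ Real.exp M)
    {x : Fin d → ℕ} (hx : ∑ j, x j ≤ K)
    (hopt : ∀ y : Fin d → ℕ, ∑ j, y j ≤ K → P.g (latticeMix δ y) ≤ P.g (latticeMix δ x))
    (hpos : 0 < P.g (latticeMix δ x))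
    (hN : 2 * n * ((1 - 1 / Real.exp 1) * a + b) ^ 2 / ε ^ 2 ≤
      N * max 1 (P.g (latticeMix δ x))) :
    P.tape {ω | P.g (P.lgreedy k δ (P.rrPrefix ω N)).val <
      (1 - 1 / Real.exp 1 - ε) * P.g (latticeMix δ x)} ≤
      ENNReal.ofReal (2 * Real.exp (-(a ^ 2 * (N * max 1 (P.g (latticeMix δ x)) /
        (2 * n * ((1 - 1 / Real.exp 1) * a + b) ^ 2 / ε ^ 2))))) := by
  obtain ⟨hc0, hc1⟩ := one_sub_inv_exp_mem
  have hn : (0 : ℝ) < n := by exact_mod_cast NeZero.pos n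
  set c := 1 - 1 / Real.exp 1 with hc
  set O := P.g (latticeMix δ x) with hO
  set B := min 1 O with hB
  set Z := max 1 O with hZ
  have hB0 : 0 < B := lt_min one_pos hpos
  have hZ0 : 0 < Z := lt_max_of_lt_left one_pos
  have hBZ : O / B = Z := by
    rw [div_eq_iff hB0.ne', hZ, hB, max_mul_min, one_mul]
  set s := c * a + b with hs
  have hs0 : 0 < s := by positivity
  set lam := 2 * n * s ^ 2 / ε ^ 2 with hlam
  have hlam0 : 0 < lam := by positivity
  set t := N * Z / lam with ht
  have ht1 : 1 ≤ t := (one_le_div hlam0).2 hN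
  have hN0 : (0 : ℝ) < N := by
    by_contra! h
    have : (N : ℝ) * Z ≤ 0 := mul_nonpos_of_nonpos_of_nonneg h hZ0.le
    linarith
  -- The error `ε` is split between the lower tail for the optimum and the upper tails for the bad
  -- mixes, so that both have the exponent `a ^ 2 * t` after the union bound.
  set ε₁ := ε * a / s with hε₁
  set ε₂ := ε * b / s with hε₂
  have hε₁0 : 0 ≤ ε₁ := by positivity
  have hε₂0 : 0 < ε₂ := by positivity
  have hsum : c * ε₁ + ε₂ = ε := by rw [hε₁, hε₂]; field_simp; exact hs.symm
  have hε₂le : ε₂ ≤ ε := by nlinarith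
  have e1 : ε₁ ^ 2 * (N * (Z / n)) / 2 = a ^ 2 * t := by
    rw [ht, hlam, hε₁]; field_simp
  have e2 : N * (Z / n) * (ε₂ ^ 2 / (2 * c)) = (M + a ^ 2) * t := by
    rw [ht, hlam, hε₂, div_pow, mul_pow ε b, hbM]; field_simp
  set F := (Finset.piAntidiag (Finset.univ : Finset (Fin d)) K).filter
    fun y => P.g (latticeMix δ y) < (c - ε) * O with hF
  -- The scaled values of `hit`.
  set X : (Fin d → ℕ) → Draw n → ℝ := fun y ω => P.hit (latticeMix δ y) ω / B with hX
  have hX0 : ∀ y ω, 0 ≤ X y ω := fun y ω =>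
    div_nonneg (P.hit_nonneg (latticeMix_nonneg hδ.le y) ω) hB0.le
  have hX1 : ∀ y : Fin d → ℕ, ∑ j, y j ≤ K → ∀ ω, X y ω ≤ 1 := fun y hy ω => by
    have hy0 := latticeMix_nonneg hδ.le y
    rw [hX, div_le_one hB0, hB]
    exact le_min (P.hit_le_one hy0 ω)
      (((P.hit_le_sum_h hy0 ω).trans (P.sum_h_le_g hy0)).trans (hopt y hy))
  have hXint : ∀ y, ∫ ω, X y ω ∂P.drawLaw = P.g (latticeMix δ y) / n / B := fun y => by
    rw [hX, integral_div, integral_hit]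
  have hXsum : ∀ y (ω : ℕ → Draw n), ∑ i ∈ Finset.range N, X y (ω i) =
      P.cov (P.rrPrefix ω N) (latticeMix δ y) / B := fun y ω => by
    rw [cov_rrPrefix, Finset.sum_div]
  have hZn : O / n / B = Z / n := by rw [← hBZ]; ring
  have hsub : {ω | P.g (P.lgreedy k δ (P.rrPrefix ω N)).val < (c - ε) * O} ⊆
      {ω | ∑ i ∈ Finset.range N, X x (ω i) ≤ N * (Z / n) * (1 - ε₁)} ∪
      ⋃ y ∈ F, {ω | N * ((c - ε) * (Z / n)) + N * (Z / n) * ε₂ ≤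
        ∑ i ∈ Finset.range N, X y (ω i)} := by
    intro ω hω
    obtain ⟨y, hy, hyK, hgr⟩ := P.lgreedy_spec hK hδ hk (P.rrPrefix ω N)
    have hω' : P.g (P.lgreedy k δ (P.rrPrefix ω N)).val < (c - ε) * O := hω
    rw [hy] at hω'
    rw [Set.mem_union, or_iff_not_imp_left]
    intro hnot
    have hnot' : N * (Z / n) * (1 - ε₁) < ∑ i ∈ Finset.range N, X x (ω i) := not_le.1 hnot
    refine Set.mem_biUnion (x := y) ?_ ?_
    · rw [hF, Finset.coe_filter]
      exact ⟨by simpa using hyK, hω'⟩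
    · rw [Set.mem_ofPred_eq]
      rw [hXsum] at hnot' ⊢
      have h1 := div_le_div_of_nonneg_right (hgr x hx) hB0.le
      rw [mul_div_assoc] at h1
      have h2 := mul_le_mul_of_nonneg_left hnot'.le hc0.le
      have h3 : N * ((c - ε) * (Z / n)) + N * (Z / n) * ε₂ = c * (N * (Z / n) * (1 - ε₁)) := by
        rw [← hsum]; ring
      linarith
  refine (measure_mono hsub).trans ((measure_union_le _ _).trans ?_)
  have hE1 : P.tape {ω | ∑ i ∈ Finset.range N, X x (ω i) ≤ N * (Z / n) * (1 - ε₁)} ≤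
      ENNReal.ofReal (Real.exp (-(a ^ 2 * t))) := by
    refine (P.tape_lower_tail (hX0 x) (hX1 x hx) N (by rw [hXint, ← hO, hZn]) hε₁0).trans ?_
    rw [e1]
  have hE2 : P.tape (⋃ y ∈ F, {ω | N * ((c - ε) * (Z / n)) + N * (Z / n) * ε₂ ≤
      ∑ i ∈ Finset.range N, X y (ω i)}) ≤ ENNReal.ofReal (Real.exp (-(a ^ 2 * t))) := by
    refine (measure_biUnion_finset_le _ _).trans ?_
    have hterm : ∀ y ∈ F, P.tape {ω | N * ((c - ε) * (Z / n)) + N * (Z / n) * ε₂ ≤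
        ∑ i ∈ Finset.range N, X y (ω i)} ≤ ENNReal.ofReal (Real.exp (-((M + a ^ 2) * t))) := by
      intro y hy
      obtain ⟨hy1, hy2⟩ := Finset.mem_filter.1 hy
      have hyK : ∑ j, y j = K := by simpa using hy1
      have hcε : 0 < c - ε := by linarith
      refine (P.tape_upper_tail (hX0 y) (hX1 y hyK.le) N ?_ (by positivity)
        (by positivity)).trans (ENNReal.ofReal_le_ofReal (Real.exp_le_exp.2 (neg_le_neg ?_)))
      · rw [hXint, ← hZn]
        calc P.g (latticeMix δ y) / n / B ≤ (c - ε) * O / n / B := by gcongr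
          _ = _ := by ring
      · rw [← e2]
        have h1 : (N * (Z / n) * ε₂) ^ 2 / (2 * (N * ((c - ε) * (Z / n))) +
            2 / 3 * (N * (Z / n) * ε₂)) =
            N * (Z / n) * (ε₂ ^ 2 / (2 * (c - ε) + 2 / 3 * ε₂)) := by
          field_simp
        rw [h1]
        gcongr
        linarith
    refine (Finset.sum_le_card_nsmul _ _ _ hterm).trans ?_
    rw [nsmul_eq_mul, ← ENNReal.ofReal_natCast, ← ENNReal.ofReal_mul (Nat.cast_nonneg _)]
    refine ENNReal.ofReal_le_ofReal ?_
    have h1 : (F.card : ℝ) ≤ Real.exp M :=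
      le_trans (by exact_mod_cast Finset.card_filter_le _ _) hcard
    calc (F.card : ℝ) * Real.exp (-((M + a ^ 2) * t))
        ≤ Real.exp M * Real.exp (-((M + a ^ 2) * t)) := by gcongr
      _ = Real.exp (M + -((M + a ^ 2) * t)) := (Real.exp_add _ _).symm
      _ ≤ _ := Real.exp_le_exp.2 (by nlinarith)
  refine (add_le_add hE1 hE2).trans ?_
  rw [← ENNReal.ofReal_add (Real.exp_pos _).le (Real.exp_pos _).le, two_mul]

end LIM

section Params

variable {n d : ℕ} {k δ ε ℓ : ℝ}

theorem exists_rpow_neg_le (hn : 2 ≤ n) (hε : 0 < ε) : ∃ c : ℝ, 0 ≤ c ∧ (n : ℝ) ^ (-c) ≤ ε := by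
  have hn0 : (0 : ℝ) < n := by positivity
  have hL0 : 0 < Real.log n := (Real.log_pos one_lt_two).trans_le (log_two_le_log hn)
  refine ⟨max 0 (-Real.log ε / Real.log n), le_max_left _ _, ?_⟩
  rw [Real.rpow_def_of_pos hn0, ← Real.le_log_iff_exp_le hε]
  have := le_max_right 0 (-Real.log ε / Real.log n)
  rw [div_le_iff₀ hL0] at this
  linarith

theorem log_logb_nonneg (hn : 2 ≤ n) : 0 ≤ Real.log (Real.logb 2 n) := by
  refine Real.log_nonneg ?_
  rw [Real.le_logb_iff_rpow_le one_lt_two (by positivity), Real.rpow_one]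
  exact_mod_cast hn

theorem lamPrime_mul {ε' : ℝ} (hn : 2 ≤ n) (hε' : 0 < ε') :
    lamPrime n d k δ ε' ℓ / n * (ε' ^ 2 / (2 + 2 / 3 * ε')) =
      paramM d k δ + ℓ * Real.log n + Real.log (Real.logb 2 n) := by
  have hn0 : (0 : ℝ) < n := by positivity
  rw [lamPrime]
  field_simp

theorem lamPrime_nonneg {ε' : ℝ} (hn : 2 ≤ n) (hM : 0 ≤ paramM d k δ) (hε' : 0 < ε')
    (hℓ : 0 ≤ ℓ) : 0 ≤ lamPrime n d k δ ε' ℓ := by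
  have := log_logb_nonneg hn
  have := Real.log_natCast_nonneg n
  rw [lamPrime]
  positivity

theorem innerConf_nonneg (hn : 2 ≤ n) (hM : 0 ≤ paramM d k δ) (hε : 0 < ε) (hℓ : 0 < ℓ) :
    0 ≤ LIM.innerConf n d k δ ε ℓ := by
  obtain ⟨c, hc, hcε⟩ := exists_rpow_neg_le hn hε
  have h1 := (findGamma_spec hn hM hc hcε hℓ).1
  have := Real.log_natCast_nonneg n
  have := Real.log_pos one_lt_two
  unfold LIM.innerConf
  positivity

end Params

namespace LIM

variable {n d : ℕ} (P : LIM n d) [NeZero n] [NeZero d]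

/-- The lower bounds that the sampling phase may return rarely exceed the optimum. -/
theorem measure_loop_fail {K : ℕ} {k δ ε' ℓ' Z : ℝ} (hn : 2 ≤ n) (hK : 2 ≤ K) (hδ : 0 < δ)
    (hk : k = K * δ) (hε' : 0 < ε') (hℓ' : 0 ≤ ℓ') (hZ : 0 < Z)
    (hg : ∀ b : Fin d → ℕ, ∑ j, b j = K → P.g (latticeMix δ b) ≤ Z) :
    P.tape (⋃ i ∈ Finset.Icc 1 (Nat.log 2 n), {ω | (1 + ε') * max Z ((n : ℝ) / 2 ^ i) ≤
      P.greedyEstimate k δ ω (loopSize n (lamPrime n d k δ ε' ℓ') i)}) ≤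
      ENNReal.ofReal (Real.exp (-(ℓ' * Real.log n))) := by
  have hn0 : (0 : ℝ) < n := by positivity
  have hM := paramM_nonneg (d := d) hδ hk
  have hlam := lamPrime_nonneg (ε' := ε') hn hM hε' hℓ'
  have hlogb : 1 ≤ Real.logb 2 n := by
    rw [Real.le_logb_iff_rpow_le one_lt_two (by positivity), Real.rpow_one]
    exact_mod_cast hn
  refine (measure_biUnion_finset_le _ _).trans ?_
  have hterm : ∀ i ∈ Finset.Icc 1 (Nat.log 2 n), P.tape {ω | (1 + ε') * max Z ((n : ℝ) / 2 ^ i) ≤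
      P.greedyEstimate k δ ω (loopSize n (lamPrime n d k δ ε' ℓ') i)} ≤
      ENNReal.ofReal (Real.exp (-(ℓ' * Real.log n)) / Real.logb 2 n) := by
    intro i _
    have hy : 0 < (n : ℝ) / 2 ^ i := by positivity
    set ζ := max Z ((n : ℝ) / 2 ^ i) with hζ
    have hζ0 : 0 < ζ := lt_max_of_lt_left hZ
    set N := loopSize n (lamPrime n d k δ ε' ℓ') i with hN
    have hN0 : 0 < N := Nat.succ_pos _
    refine (P.measure_greedyEstimate_ge (by omega) hδ hk hN0 hζ0 hε'.le
      fun b hb => (hg b hb).trans (le_max_left _ _)).trans ?_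
    rw [← ENNReal.ofReal_natCast, ← ENNReal.ofReal_mul (Nat.cast_nonneg _)]
    refine ENNReal.ofReal_le_ofReal ?_
    have h1 : lamPrime n d k δ ε' ℓ' ≤ N * ζ := by
      have h2 : lamPrime n d k δ ε' ℓ' / ((n : ℝ) / 2 ^ i) ≤ N := by
        rw [hN, loopSize]
        push_cast
        exact (Nat.lt_floor_add_one _).le
      rw [div_le_iff₀ hy] at h2
      refine h2.trans ?_
      gcongr
      exact le_max_right _ _
    have h2 : paramM d k δ + ℓ' * Real.log n + Real.log (Real.logb 2 n) ≤
        N * (ζ / n) * (ε' ^ 2 / (2 + 2 / 3 * ε')) := by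
      have h3 : lamPrime n d k δ ε' ℓ' / n ≤ N * (ζ / n) := by
        rw [← mul_div_assoc]; gcongr
      rw [← lamPrime_mul hn hε']
      gcongr
    calc _ ≤ Real.exp (paramM d k δ) *
          Real.exp (-(paramM d k δ + ℓ' * Real.log n + Real.log (Real.logb 2 n))) := by
          gcongr
          exact card_budgetMixes_le hK hδ hk
      _ = Real.exp (-(ℓ' * Real.log n) - Real.log (Real.logb 2 n)) := by
          rw [← Real.exp_add]; ring_nf
      _ = _ := by rw [Real.exp_sub, Real.exp_log (by linarith)]
  refine (Finset.sum_le_card_nsmul _ _ _ hterm).trans ?_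
  rw [nsmul_eq_mul, ← ENNReal.ofReal_natCast, ← ENNReal.ofReal_mul (Nat.cast_nonneg _)]
  refine ENNReal.ofReal_le_ofReal ?_
  have h1 : (Nat.log 2 n : ℝ) ≤ Real.logb 2 n := by
    exact_mod_cast Real.natLog_le_logb n 2
  rw [Nat.card_Icc, Nat.add_sub_cancel, mul_div_assoc', div_le_iff₀ (by linarith), mul_comm]
  gcongr

/-- The approximation guarantee. -/
theorem immPRR_approx {K : ℕ} {k δ ε ℓ : ℝ} (hn : 2 ≤ n) (hK : 2 ≤ K) (hδ : 0 < δ)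
    (hk : k = K * δ) (hε : 0 < ε) (hℓ : 0 < ℓ) :
    1 - 1 / (n : ℝ) ^ ℓ ≤ P.tape.real {ω | P.IsApproxSolution k δ (1 - 1 / Real.exp 1 - ε)
      (P.immPRR k δ ε ℓ ω).val} := by
  have : IsProbabilityMeasure P.tape := by
    unfold TriggeringModel.tape; infer_instance
  have hn0 : (0 : ℝ) < n := by positivity
  have hK1 : 1 ≤ K := by omega
  have hM := paramM_nonneg (d := d) hδ hk
  have hℓ' := innerConf_nonneg hn hM hε hℓ
  have hε' : 0 < √2 * ε := by positivity
  have hlam := lamPrime_nonneg hn hM hε' hℓ'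
  have hpow : 0 ≤ 1 / (n : ℝ) ^ ℓ := by positivity
  obtain ⟨x, hx, hopt⟩ := P.exists_optimum K δ
  have hgx : 0 ≤ P.g (latticeMix δ x) := P.g_nonneg (latticeMix_nonneg hδ.le x)
  -- Every output is feasible, so that only its spread matters.
  have hout : ∀ ω, (1 - 1 / Real.exp 1 - ε) * P.g (latticeMix δ x) ≤
      P.g (P.immPRR k δ ε ℓ ω).val → 0 ≤ 1 - 1 / Real.exp 1 - ε →
      P.IsApproxSolution k δ (1 - 1 / Real.exp 1 - ε) (P.immPRR k δ ε ℓ ω).val := by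
    intro ω h h0
    obtain ⟨e, N, LB, -, -, hv, -⟩ := P.immPRR_spec hlam ω
    obtain ⟨b, hb, hbK, -⟩ := P.lgreedy_spec hK1 hδ hk (P.rrPrefix ω
        (max N (⌊lamStar n d k δ ε (innerConf n d k δ ε ℓ) / LB⌋₊ + 1)))
    refine ⟨(feasible_iff hδ hk _).2 ⟨b, hbK.le, hv.trans hb⟩, fun y hy => ?_⟩
    obtain ⟨a, ha, rfl⟩ := (feasible_iff hδ hk _).1 hy
    exact (mul_le_mul_of_nonneg_left (hopt a ha) h0).trans h
  have hout0 : ∀ ω, 0 ≤ P.g (P.immPRR k δ ε ℓ ω).val ∧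
      Feasible k δ (P.immPRR k δ ε ℓ ω).val := by
    intro ω
    obtain ⟨e, N, LB, -, -, hv, -⟩ := P.immPRR_spec hlam ω
    obtain ⟨b, hb, hbK, -⟩ := P.lgreedy_spec hK1 hδ hk (P.rrPrefix ω
        (max N (⌊lamStar n d k δ ε (innerConf n d k δ ε ℓ) / LB⌋₊ + 1)))
    rw [hv, hb]
    exact ⟨P.g_nonneg (latticeMix_nonneg hδ.le b), (feasible_iff hδ hk _).2 ⟨b, hbK.le, rfl⟩⟩
  -- If `1 - 1/e ≤ ε` or `OPT = 0`, then every feasible mix is a solution.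
  rcases le_or_gt (1 - 1 / Real.exp 1) ε with hεc | hεc
  · have : {ω | P.IsApproxSolution k δ (1 - 1 / Real.exp 1 - ε) (P.immPRR k δ ε ℓ ω).val} =
        Set.univ := by
      refine Set.eq_univ_of_forall fun ω => ⟨(hout0 ω).2, fun y hy => ?_⟩
      obtain ⟨a, ha, rfl⟩ := (feasible_iff hδ hk _).1 hy
      exact (mul_nonpos_of_nonpos_of_nonneg (by linarith)
        (P.g_nonneg (latticeMix_nonneg hδ.le a))).trans (hout0 ω).1
    rw [this, probReal_univ]
    linarith
  rcases hgx.eq_or_lt with hO | hO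
  · have : {ω | P.IsApproxSolution k δ (1 - 1 / Real.exp 1 - ε) (P.immPRR k δ ε ℓ ω).val} =
        Set.univ := by
      refine Set.eq_univ_of_forall fun ω => hout ω ?_ (by linarith)
      rw [← hO, mul_zero]
      exact (hout0 ω).1
    rw [this, probReal_univ]
    linarith
  set O := P.g (latticeMix δ x) with hOdef
  set Z := max 1 O with hZ
  have hZ1 : 1 ≤ Z := le_max_left _ _
  set ℓ' := innerConf n d k δ ε ℓ with hℓ'def
  set lam' := lamPrime n d k δ (√2 * ε) ℓ' with hlam'
  set Λ := lamStar n d k δ ε ℓ' with hΛ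
  set N₀ := ⌊Λ / Z⌋₊ + 1 with hN₀
  obtain ⟨c, hc, hcε⟩ := exists_rpow_neg_le hn hε
  obtain ⟨hγ0, hγok, -, -⟩ := findGamma_spec hn hM hc hcε hℓ
  have hlog2 : 0 < Real.log 2 := Real.log_pos one_lt_two
  have hL0 : 0 < Real.log n := hlog2.trans_le (log_two_le_log hn)
  have hc0 := one_sub_inv_exp_mem.1
  have hα2 : 0 < paramAlpha n ℓ' ^ 2 := by
    rw [paramAlpha_sq hn hℓ']; positivity
  have hα : 0 < paramAlpha n ℓ' := (Real.sqrt_nonneg _).lt_of_ne fun h => by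
    rw [show paramAlpha n ℓ' = 0 from h.symm] at hα2; simp at hα2
  have hβsq := paramBeta_sq (n := n) (ℓ := ℓ') hM
  have hβ : 0 < paramBeta n d k δ ℓ' := (Real.sqrt_nonneg _).lt_of_ne fun h => by
    have h1 : paramBeta n d k δ ℓ' ^ 2 = 0 := by
      rw [show paramBeta n d k δ ℓ' = 0 from h.symm]; simp
    have h2 : 0 < (1 - 1 / Real.exp 1) * (paramM d k δ + paramAlpha n ℓ' ^ 2) := by positivity
    linarith
  have hΛ0 : 0 < Λ := by
    rw [hΛ, lamStar]; positivity
  -- `Bad1`: some lower bound exceeds `max(1, OPT)`. `Bad2`: greedy fails for some number of RR sets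
  -- that a correct lower bound allows.
  set Bad1 := ⋃ i ∈ Finset.Icc 1 (Nat.log 2 n), {ω | (1 + √2 * ε) * max Z ((n : ℝ) / 2 ^ i) ≤
      P.greedyEstimate k δ ω (loopSize n lam' i)} with hBad1
  set Bad2 := ⋃ j : ℕ, {ω | P.g (P.lgreedy k δ (P.rrPrefix ω (N₀ + j))).val <
      (1 - 1 / Real.exp 1 - ε) * O} with hBad2
  have hcover : (Set.univ : Set (ℕ → Draw n)) ⊆
      {ω | P.IsApproxSolution k δ (1 - 1 / Real.exp 1 - ε) (P.immPRR k δ ε ℓ ω).val} ∪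
        (Bad1 ∪ Bad2) := by
    intro ω _
    by_contra hω
    rw [Set.mem_union, Set.mem_union, not_or, not_or] at hω
    obtain ⟨hω1, hω2, hω3⟩ := hω
    refine hω1 (hout ω ?_ (by linarith))
    obtain ⟨e, N, LB, e1, -, hv, -, -, hLB, -⟩ := P.immPRR_spec hlam ω
    have hLBZ : 0 < LB ∧ LB ≤ Z := by
      rcases hLB with ⟨-, rfl⟩ | ⟨h1, h2, rfl⟩
      · exact ⟨one_pos, hZ1⟩
      · have hy : 0 < (n : ℝ) / 2 ^ e := by positivity
        have h3 : P.greedyEstimate k δ ω (loopSize n lam' e) <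
            (1 + √2 * ε) * max Z ((n : ℝ) / 2 ^ e) := by
          by_contra! h3
          exact hω2 (Set.mem_biUnion (x := e)
            (by simpa using ⟨e1, (by omega : e ≤ Nat.log 2 n)⟩) h3)
        have h4 : 0 < 1 + √2 * ε := by positivity
        rcases le_total Z ((n : ℝ) / 2 ^ e) with h5 | h5
        · rw [max_eq_right h5] at h3
          linarith
        · rw [max_eq_left h5] at h3
          refine ⟨div_pos ((mul_pos h4 hy).trans_le h2) h4, ?_⟩
          rw [div_le_iff₀ h4]
          linarith
    obtain ⟨j, hj⟩ : ∃ j, max N (⌊Λ / LB⌋₊ + 1) = N₀ + j := by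
      refine Nat.exists_eq_add_of_le (le_trans ?_ (le_max_right _ _))
      refine Nat.add_le_add_right (Nat.floor_le_floor ?_) 1
      exact div_le_div_of_nonneg_left hΛ0.le hLBZ.1 hLBZ.2
    rw [hv, hj]
    by_contra! h
    exact hω3 (Set.mem_iUnion.2 ⟨j, h⟩)
  have hprod : ℓ' * Real.log n = (ℓ + (findGamma n d k δ ε ℓ).val) * Real.log n + Real.log 2 := by
    rw [hℓ'def, innerConf]
    field_simp
  have hm1 : P.tape Bad1 ≤ ENNReal.ofReal (1 / (2 * (n : ℝ) ^ ℓ)) := by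
    refine (P.measure_loop_fail hn hK hδ hk hε' hℓ' (by linarith) fun b hb =>
      (hopt b hb.le).trans (le_max_right _ _)).trans (ENNReal.ofReal_le_ofReal ?_)
    rw [Real.rpow_def_of_pos hn0, one_div, mul_inv, ← Real.exp_neg, hprod,
      ← Real.exp_log (inv_pos.2 two_pos), ← Real.exp_add, Real.log_inv]
    refine Real.exp_le_exp.2 ?_
    have := mul_nonneg hγ0 hL0.le
    linarith
  have hm2 : P.tape Bad2 ≤ ENNReal.ofReal (1 / (2 * (n : ℝ) ^ ℓ)) := by
    have hθ : Λ / Z ≤ N₀ := by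
      rw [hN₀]; push_cast; exact (Nat.lt_floor_add_one _).le
    refine (measure_iUnion_le _).trans ?_
    have hterm : ∀ j : ℕ, P.tape {ω | P.g (P.lgreedy k δ (P.rrPrefix ω (N₀ + j))).val <
        (1 - 1 / Real.exp 1 - ε) * O} ≤ ENNReal.ofReal
          (2 * Real.exp (-(paramAlpha n ℓ' ^ 2 * ((N₀ + j : ℕ) / (Λ / Z))))) := by
      intro j
      have hNj : Λ ≤ (N₀ + j : ℕ) * Z := by
        rw [div_le_iff₀ (by linarith)] at hθ
        refine hθ.trans ?_
        gcongr
        exact Nat.le_add_right _ _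
      refine (P.measure_lgreedy_fail hK1 hδ hk hε hεc hα hβ hM hβsq
        (card_budgetMixes_le hK hδ hk) hx hopt hO hNj).trans (le_of_eq ?_)
      rw [div_div_eq_mul_div _ Λ Z]
      rfl
    refine (ENNReal.tsum_le_tsum hterm).trans
      ((tsum_exp_le hα2 (by positivity) N₀ hθ).trans (ENNReal.ofReal_le_ofReal ?_))
    refine le_trans ?_ (final_failure_le hn hM hε hεc hℓ hγ0 hγok)
    refine mul_le_mul_of_nonneg_left ?_ (by positivity)
    refine add_le_add le_rfl (div_le_div_of_nonneg_right ?_ hα2.le)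
    exact div_le_self hΛ0.le hZ1
  have h1 : (1 : ℝ≥0∞) ≤
      P.tape {ω | P.IsApproxSolution k δ (1 - 1 / Real.exp 1 - ε) (P.immPRR k δ ε ℓ ω).val} +
        ENNReal.ofReal (1 / (n : ℝ) ^ ℓ) := by
    calc (1 : ℝ≥0∞) = P.tape Set.univ := measure_univ.symm
      _ ≤ _ := measure_mono hcover
      _ ≤ _ := measure_union_le _ _
      _ ≤ _ := by
        gcongr
        refine (measure_union_le _ _).trans ((add_le_add hm1 hm2).trans_eq ?_)
        rw [← ENNReal.ofReal_add (by positivity) (by positivity)]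
        congr 1
        field_simp
        norm_num
  have h2 := ENNReal.toReal_mono (by finiteness) h1
  rw [ENNReal.toReal_one, ENNReal.toReal_add (by finiteness) (by finiteness),
    ENNReal.toReal_ofReal hpow] at h2
  rw [Measure.real]
  linarith

end LIM

/-! ### The expected running time -/

namespace LIM

variable {n d : ℕ} (P : LIM n d)

open Classical in
/-- For an optimal mix `x`, a superset of the event that the sampling loop reaches round `i`. While
`2 ^ i * g(x) / n < 16`, this is the sure event. Afterwards, it is the event that the RR sets of the
previous round underestimate the spread of `x` by more than the factor `2`. -/
def slowEvent (x : Fin d → ℝ) (lam' : ℝ) (i : ℕ) : Set (ℕ → Draw n) :=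
  if 2 ^ i * P.g x / n < 16 then Set.univ
  else {ω | ∑ s ∈ Finset.range (loopSize n lam' (i - 1)), P.hit x (ω s) <
    loopSize n lam' (i - 1) * (P.g x / n) / 2}

theorem measurableSet_slowEvent (x : Fin d → ℝ) (lam' : ℝ) (i : ℕ) :
    MeasurableSet (P.slowEvent x lam' i) := by
  unfold slowEvent
  split_ifs
  · exact MeasurableSet.univ
  · refine measurableSet_lt (Finset.measurable_sum _ fun s _ => ?_) measurable_const
    exact (measurable_of_finite (P.hit x)).comp (measurable_pi_apply s)

theorem one_add_sqrt_two_mul_le {ε : ℝ} (hε1 : ε ≤ 1) :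
    1 + √2 * ε ≤ 4 * (1 - 1 / Real.exp 1) := by
  have h1 : √2 ≤ 1.415 := by
    rw [Real.sqrt_le_left (by norm_num)]; norm_num
  have h2 : √2 * ε ≤ √2 := mul_le_of_le_one_right (Real.sqrt_nonneg _) hε1
  have h3 : 1 / Real.exp 1 ≤ 0.37 := by
    rw [div_le_iff₀ (Real.exp_pos _)]
    have := Real.exp_one_gt_d9
    linarith
  linarith

open Classical in
/-- An upper bound for the probability of `slowEvent`, which also bounds its effect on the
expected costs of the draws. -/
def slowProb (x : Fin d → ℝ) (lam' : ℝ) (i : ℕ) : ℝ :=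
  if 2 ^ i * P.g x / n < 16 then 1
  else 2 * Real.exp (-(loopSize n lam' (i - 1) * (P.g x / n) / 8))

theorem slowProb_nonneg (x : Fin d → ℝ) (lam' : ℝ) (i : ℕ) : 0 ≤ P.slowProb x lam' i := by
  unfold slowProb
  split_ifs <;> positivity

theorem lintegral_cost_slowEvent [NeZero n] {x : Fin d → ℝ} (hx : ∀ j, 0 ≤ x j) (lam' : ℝ)
    (i t : ℕ) :
    ∫⁻ ω, (P.slowEvent x lam' i).indicator (fun ω => (P.rrCost (ω t) : ℝ≥0∞)) ω ∂P.tape ≤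
      ENNReal.ofReal ((∫ ω, (P.rrCost ω : ℝ) ∂P.drawLaw) * P.slowProb x lam' i) := by
  have hint : ∫⁻ ω, (P.rrCost ω : ℝ≥0∞) ∂P.drawLaw =
      ENNReal.ofReal (∫ ω, (P.rrCost ω : ℝ) ∂P.drawLaw) := by
    rw [ofReal_integral_eq_lintegral_ofReal Integrable.of_finite
      (ae_of_all _ fun _ => Nat.cast_nonneg _)]
    simp
  have h0 : 0 ≤ ∫ ω, (P.rrCost ω : ℝ) ∂P.drawLaw := integral_nonneg fun _ => Nat.cast_nonneg _
  rw [ENNReal.ofReal_mul h0, ← hint]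
  unfold slowEvent slowProb
  split_ifs
  · rw [ENNReal.ofReal_one, mul_one]
    simp only [Set.indicator_univ]
    exact ((measurePreserving_eval_infinitePi (fun _ : ℕ => P.drawLaw) t).lintegral_comp
      (measurable_of_finite fun a : Draw n => (P.rrCost a : ℝ≥0∞))).le
  · exact P.lintegral_cost_lower_tail (P.hit_nonneg hx) (P.hit_le_one hx) _ _ t
      (P.integral_hit x)

variable [NeZero n] [NeZero d]

/-- If round `i - 1` did not end the loop, then the greedy solution, and so the mix `x`, had a small
estimate in that round. -/
theorem mem_slowEvent {K : ℕ} {k δ ε lam' : ℝ} (hK : 1 ≤ K) (hδ : 0 < δ) (hk : k = K * δ)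
    (hε1 : ε ≤ 1) {x : Fin d → ℕ} (hx : ∑ j, x j ≤ K) {i : ℕ} (hi : 1 ≤ i) {ω : ℕ → Draw n}
    (h : i = 1 ∨ P.greedyEstimate k δ ω (loopSize n lam' (i - 1)) <
      (1 + √2 * ε) * ((n : ℝ) / 2 ^ (i - 1))) (hgn : P.g (latticeMix δ x) ≤ n) :
    ω ∈ P.slowEvent (latticeMix δ x) lam' i := by
  have hn : (0 : ℝ) < n := by exact_mod_cast NeZero.pos n
  obtain ⟨hc0, hc1⟩ := one_sub_inv_exp_mem
  unfold slowEvent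
  split_ifs with hz
  · trivial
  rw [not_lt, le_div_iff₀ hn] at hz
  rcases h with rfl | h
  · rw [pow_one] at hz; linarith
  obtain ⟨i, rfl⟩ := Nat.exists_eq_add_of_le' hi
  simp only [Nat.add_sub_cancel] at h ⊢
  set N := loopSize n lam' i with hN
  have hN0 : (0 : ℝ) < N := by rw [hN, loopSize]; positivity
  obtain ⟨b, hb, -, hgr⟩ := P.lgreedy_spec hK hδ hk (P.rrPrefix ω N)
  have h1 := hgr x hx
  rw [greedyEstimate, hb, div_mul_eq_mul_div, div_lt_iff₀ hN0] at h
  rw [Set.mem_ofPred_eq, ← cov_rrPrefix]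
  have hO0 : 0 ≤ P.g (latticeMix δ x) := P.g_nonneg (latticeMix_nonneg hδ.le x)
  set O := P.g (latticeMix δ x)
  set Cx := P.cov (P.rrPrefix ω N) (latticeMix δ x)
  set Cb := P.cov (P.rrPrefix ω N) (latticeMix δ b)
  have h2 := one_add_sqrt_two_mul_le hε1
  set c := 1 - 1 / Real.exp 1
  have h5 : (n : ℝ) / 2 ^ i ≤ O / 8 := by
    rw [div_le_iff₀ (by positivity)]
    rw [pow_succ] at hz
    linarith
  have h3 : (n : ℝ) * (c * Cx) < c * (n * (N * (O / n) / 2)) := by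
    calc (n : ℝ) * (c * Cx) ≤ n * Cb := by gcongr
      _ < (1 + √2 * ε) * ((n : ℝ) / 2 ^ i) * N := h
      _ ≤ 4 * c * (O / 8) * N := by
          gcongr ?_ * _
          exact mul_le_mul h2 h5 (by positivity) (by positivity)
      _ = _ := by field_simp; ring
  have h4 : (c * n) * Cx < (c * n) * (N * (O / n) / 2) := by linarith
  exact lt_of_mul_lt_mul_left h4 (by positivity)

/-- A bound on the number of steps for every random tape. -/
theorem immPRR_steps_le {K : ℕ} {k δ ε ℓ : ℝ} (hn : 2 ≤ n) (hK : 1 ≤ K) (hδ : 0 < δ)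
    (hk : k = K * δ) (hε : 0 < ε) (hε1 : ε ≤ 1) (hc : 1 ≤ P.maxS) {x : Fin d → ℕ}
    (hx : ∑ j, x j ≤ K) (hgn : P.g (latticeMix δ x) ≤ n) {lam' Λ : ℝ}
    (hlam : lam' = lamPrime n d k δ (√2 * ε) (innerConf n d k δ ε ℓ)) (hlam0 : 0 ≤ lam')
    (hΛ1 : lam' ≤ Λ) (hΛ2 : lamStar n d k δ ε (innerConf n d k δ ε ℓ) ≤ Λ)
    (ω : ℕ → Draw n) :
    ((P.immPRR k δ ε ℓ ω).steps : ℝ≥0∞) ≤ (n + 2 + (findGamma n d k δ ε ℓ).steps : ℕ) +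
      ∑ i ∈ Finset.Icc 1 (1 + Nat.log 2 n), 32 * (K * (d + P.maxS *
        ∑ t ∈ Finset.range (loopSize n Λ i), (P.slowEvent (latticeMix δ x) lam' i).indicator
          (fun ω => (P.rrCost (ω t) : ℝ≥0∞)) ω)) := by
  have hn0 : (0 : ℝ) < n := by positivity
  have hKk : ⌊k / δ⌋₊ = K := by rw [hk, mul_div_cancel_right₀ _ hδ.ne', Nat.floor_natCast]
  obtain ⟨e, N, LB, e1, e2, -, hN, hreach, hLB, hsteps⟩ :=
    P.immPRR_spec (k := k) (δ := δ) (ε := ε) (ℓ := ℓ) (by rw [← hlam]; exact hlam0) ω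
  rw [← hlam] at hN hreach hLB hsteps
  replace hsteps := hsteps K hK hKk hc
  have hΛ0 : 0 ≤ Λ := hlam0.trans hΛ1
  have hsize : ∀ i, loopSize n lam' i ≤ loopSize n Λ i := by
    intro i
    refine Nat.add_le_add_right (Nat.floor_le_floor ?_) 1
    gcongr
  have hy : 0 < (n : ℝ) / 2 ^ e := by positivity
  have hfinal : max N (⌊lamStar n d k δ ε (innerConf n d k δ ε ℓ) / LB⌋₊ + 1) ≤
      loopSize n Λ e := by
    refine max_le (hN.trans (hsize e)) (Nat.add_le_add_right (Nat.floor_le_floor ?_) 1)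
    have hLBy : (n : ℝ) / 2 ^ e ≤ LB := by
      rcases hLB with ⟨rfl, rfl⟩ | ⟨-, h2, rfl⟩
      · rw [div_le_one (by positivity), add_comm]
        exact_mod_cast (Nat.lt_pow_succ_log_self one_lt_two n).le
      · have h4 : 0 < 1 + √2 * ε := by positivity
        rw [le_div_iff₀ h4]
        linarith
    calc _ ≤ Λ / LB := div_le_div_of_nonneg_right hΛ2 (hy.le.trans hLBy)
      _ ≤ _ := div_le_div_of_nonneg_left hΛ0 hy hLBy
  set f : ℕ → ℕ := fun i => P.roundCost K ω (loopSize n Λ i) with hf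
  have hmem : ∀ i ∈ Finset.Ico 1 (e + 1), ω ∈ P.slowEvent (latticeMix δ x) lam' i := by
    intro i hi
    obtain ⟨hi1, hi2⟩ := Finset.mem_Ico.1 hi
    refine P.mem_slowEvent hK hδ hk hε1 hx hi1 ?_ hgn
    rcases hi1.eq_or_lt with h | h
    · exact .inl h.symm
    · exact .inr (hreach (i - 1) (by omega) (by omega))
  have hnat : (P.immPRR k δ ε ℓ ω).steps ≤ n + 2 + (findGamma n d k δ ε ℓ).steps +
      ∑ i ∈ Finset.Ico 1 (e + 1), 32 * f i := by
    have h1 : ∑ i ∈ Finset.Ico 1 (e + 1), 16 * P.roundCost K ω (loopSize n lam' i) ≤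
        ∑ i ∈ Finset.Ico 1 (e + 1), 16 * f i := by
      refine Finset.sum_le_sum fun i _ => ?_
      have := P.roundCost_mono K ω (hsize i)
      simp only [hf]
      omega
    -- The final sample costs at most as much as the last round with `Λ` in place of `λ'`.
    have h2 := P.roundCost_mono K ω hfinal
    have h3 : f e ≤ ∑ i ∈ Finset.Ico 1 (e + 1), f i :=
      Finset.single_le_sum (f := f) (fun _ _ => Nat.zero_le _)
        (Finset.mem_Ico.2 ⟨e1, Nat.lt_succ_self e⟩)
    rw [← Finset.mul_sum] at hsteps
    rw [← Finset.mul_sum, ← Finset.mul_sum] at h1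
    rw [← Finset.mul_sum]
    simp only [hf] at h1 h2 h3 ⊢
    omega
  calc ((P.immPRR k δ ε ℓ ω).steps : ℝ≥0∞)
      ≤ ((n + 2 + (findGamma n d k δ ε ℓ).steps +
        ∑ i ∈ Finset.Ico 1 (e + 1), 32 * f i : ℕ) : ℝ≥0∞) := by exact_mod_cast hnat
    _ = (n + 2 + (findGamma n d k δ ε ℓ).steps : ℕ) +
        ∑ i ∈ Finset.Ico 1 (e + 1), ((32 * f i : ℕ) : ℝ≥0∞) := by
        rw [Nat.cast_add, Nat.cast_sum]
    _ ≤ _ := by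
        gcongr
        refine (Finset.sum_le_sum fun i hi => ?_).trans (Finset.sum_le_sum_of_subset
          (show Finset.Ico 1 (e + 1) ⊆ Finset.Icc 1 (1 + Nat.log 2 n) from fun i hi => ?_))
        · simp only [Set.indicator_of_mem (hmem i hi), hf, roundCost]
          push_cast
          exact le_rfl
        · obtain ⟨h1, h2⟩ := Finset.mem_Ico.1 hi
          exact Finset.mem_Icc.2 ⟨h1, by omega⟩

/-- The bound of `immPRR_steps_le`, averaged over the tape. -/
theorem lintegral_steps_le {K : ℕ} {k δ ε ℓ : ℝ} (hn : 2 ≤ n) (hK : 1 ≤ K) (hδ : 0 < δ)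
    (hk : k = K * δ) (hε : 0 < ε) (hε1 : ε ≤ 1) (hc : 1 ≤ P.maxS) {x : Fin d → ℕ}
    (hx : ∑ j, x j ≤ K) (hgn : P.g (latticeMix δ x) ≤ n) {lam' Λ : ℝ}
    (hlam : lam' = lamPrime n d k δ (√2 * ε) (innerConf n d k δ ε ℓ)) (hlam0 : 0 ≤ lam')
    (hΛ1 : lam' ≤ Λ) (hΛ2 : lamStar n d k δ ε (innerConf n d k δ ε ℓ) ≤ Λ) :
    ∫⁻ ω, ((P.immPRR k δ ε ℓ ω).steps : ℝ≥0∞) ∂P.tape ≤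
      ENNReal.ofReal (n + 2 + (findGamma n d k δ ε ℓ).steps +
        ∑ i ∈ Finset.Icc 1 (1 + Nat.log 2 n), 32 * (K * (d + P.maxS *
          (loopSize n Λ i * ((∫ ω, (P.rrCost ω : ℝ) ∂P.drawLaw) *
            P.slowProb (latticeMix δ x) lam' i))))) := by
  have : IsProbabilityMeasure P.tape := by
    unfold TriggeringModel.tape; infer_instance
  have h0 : 0 ≤ ∫ ω, (P.rrCost ω : ℝ) ∂P.drawLaw := integral_nonneg fun _ => Nat.cast_nonneg _
  have hp := P.slowProb_nonneg (latticeMix δ x) lam'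
  have hmeas : ∀ i t, Measurable ((P.slowEvent (latticeMix δ x) lam' i).indicator
      (fun ω : ℕ → Draw n => (P.rrCost (ω t) : ℝ≥0∞))) := fun i t =>
    ((measurable_of_finite fun a : Draw n => (P.rrCost a : ℝ≥0∞)).comp
      (measurable_pi_apply t)).indicator (P.measurableSet_slowEvent _ _ _)
  refine (lintegral_mono fun ω => P.immPRR_steps_le (ℓ := ℓ) hn hK hδ hk hε hε1 hc hx hgn hlam
    hlam0 hΛ1 hΛ2 ω).trans ?_
  rw [lintegral_add_left measurable_const, lintegral_finsetSum _ (fun i _ => by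
    refine Measurable.const_mul (Measurable.const_mul (Measurable.const_add
      (Measurable.const_mul (Finset.measurable_sum _ fun t _ => hmeas i t) _) _) _) _)]
  rw [ENNReal.ofReal_add (by positivity) (Finset.sum_nonneg fun i _ => by
    have := hp i; positivity)]
  refine add_le_add ?_ ?_
  · rw [lintegral_const, measure_univ, mul_one, ← ENNReal.ofReal_natCast]
    push_cast
    exact le_rfl
  · rw [ENNReal.ofReal_sum_of_nonneg fun i _ => by have := hp i; positivity]
    refine Finset.sum_le_sum fun i _ => ?_
    rw [lintegral_const_mul' _ _ (by finiteness), lintegral_const_mul' _ _ (by finiteness),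
      lintegral_add_left measurable_const, lintegral_const_mul' _ _ (by finiteness),
      lintegral_finsetSum _ fun t _ => hmeas i t, lintegral_const, measure_univ, mul_one]
    have hi := hp i
    rw [ENNReal.ofReal_mul (by norm_num), ENNReal.ofReal_mul (by positivity),
      ENNReal.ofReal_add (by positivity) (by positivity), ENNReal.ofReal_mul (by positivity),
      ENNReal.ofReal_natCast, ENNReal.ofReal_natCast, ENNReal.ofReal_natCast,
      ENNReal.ofReal_ofNat]
    gcongr
    refine (Finset.sum_le_card_nsmul _ _ _ fun t _ => P.lintegral_cost_slowEvent
      (latticeMix_nonneg hδ.le x) lam' i t).trans ?_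
    rw [Finset.card_range, nsmul_eq_mul, ← ENNReal.ofReal_natCast,
      ← ENNReal.ofReal_mul (by positivity)]

end LIM

/-! ### The constants of the running time bound -/

namespace LIM

variable {n d : ℕ} (P : LIM n d)

section Parameters

variable {k δ ε ℓ ℓ₀ c : ℝ}

theorem half_le_log (hn : 2 ≤ n) : 1 / 2 ≤ Real.log n := by
  have := Real.log_two_gt_d9
  linarith [log_two_le_log hn]

/-- The bound for `γ` and for the number of steps of its search, relative to `M + ℓ ln n`. -/
theorem findGamma_bound_mul_log_le (hn : 2 ≤ n) (hM : 0 ≤ paramM d k δ) (hc : 0 ≤ c)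
    (hℓ₀ : 0 < ℓ₀) (hℓ : ℓ₀ ≤ ℓ) :
    (6 + 2 * c + ℓ + paramM d k δ / Real.log n) * Real.log n ≤
      ((6 + 2 * c) / ℓ₀ + 1) * (paramM d k δ + ℓ * Real.log n) := by
  have hL : 0 < Real.log n := by linarith [half_le_log hn]
  have h1 : (6 + 2 * c) * Real.log n ≤ (6 + 2 * c) / ℓ₀ * (paramM d k δ + ℓ * Real.log n) := by
    rw [div_mul_eq_mul_div, le_div_iff₀ hℓ₀, mul_assoc]
    refine mul_le_mul_of_nonneg_left ?_ (by positivity)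
    nlinarith
  have h2 : paramM d k δ / Real.log n * Real.log n = paramM d k δ := div_mul_cancel₀ _ hL.ne'
  linarith

/-- A common bound, up to the factor `n / ε²`, for the numbers `λ'` and `λ*(ℓ')`. -/
theorem sample_bounds (hn : 2 ≤ n) (hM : 0 ≤ paramM d k δ) (hc : 0 ≤ c) (hε : (n : ℝ) ^ (-c) ≤ ε)
    (hε0 : 0 < ε) (hε1 : ε ≤ 1) (hℓ₀ : 0 < ℓ₀) (hℓ : ℓ₀ ≤ ℓ) :
    lamPrime n d k δ (√2 * ε) (innerConf n d k δ ε ℓ) ≤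
        n * (8 * (1 + 4 * ((6 + 2 * c) / ℓ₀ + 1) + 3 / ℓ₀) *
          (paramM d k δ + ℓ * Real.log n) / ε ^ 2) ∧
      lamStar n d k δ ε (innerConf n d k δ ε ℓ) ≤
        n * (8 * (1 + 4 * ((6 + 2 * c) / ℓ₀ + 1) + 3 / ℓ₀) *
          (paramM d k δ + ℓ * Real.log n) / ε ^ 2) := by
  have hn0 : (0 : ℝ) < n := by positivity
  have hℓ0 : 0 < ℓ := hℓ₀.trans_le hℓ
  have hL : 0 < Real.log n := by linarith [half_le_log hn]
  have hL2 := log_two_le_log hn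
  have h2 := Real.log_two_gt_d9
  obtain ⟨hγ0, -, hγ, -⟩ := findGamma_spec hn hM hc hε hℓ0
  have hγL := (mul_le_mul_of_nonneg_right hγ hL.le)
  rw [mul_assoc] at hγL
  have hB := findGamma_bound_mul_log_le hn hM hc hℓ₀ hℓ
  have hinner : innerConf n d k δ ε ℓ * Real.log n =
      ℓ * Real.log n + (findGamma n d k δ ε ℓ).val * Real.log n + Real.log 2 := by
    rw [innerConf]; field_simp
  have hi0 := innerConf_nonneg (n := n) (ℓ := ℓ) hn hM hε0 hℓ0
  have hLA : Real.log n ≤ 1 / ℓ₀ * (paramM d k δ + ℓ * Real.log n) := by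
    rw [div_mul_eq_mul_div, le_div_iff₀ hℓ₀]
    nlinarith
  have hloglog : Real.log (Real.logb 2 n) ≤ 2 * Real.log n := by
    have h0 : 0 ≤ Real.logb 2 n := Real.logb_nonneg one_lt_two (by exact_mod_cast by omega)
    refine (Real.log_le_self h0).trans ?_
    rw [Real.logb, div_le_iff₀ (by linarith)]
    nlinarith
  set A := paramM d k δ + ℓ * Real.log n with hA
  set c₀ := (6 + 2 * c) / ℓ₀ + 1
  have e3 : 3 / ℓ₀ * A = 3 * (1 / ℓ₀ * A) := by ring
  have hA0 : 0 ≤ A := by positivity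
  have hX1 : paramM d k δ + innerConf n d k δ ε ℓ * Real.log n + Real.log (Real.logb 2 n) ≤
      (1 + 4 * c₀ + 3 / ℓ₀) * A := by
    rw [hinner]; linarith
  have hX2 : paramM d k δ + innerConf n d k δ ε ℓ * Real.log n + Real.log 2 ≤
      (1 + 4 * c₀ + 3 / ℓ₀) * A := by
    rw [hinner]; linarith
  have hX0 := log_logb_nonneg hn
  set Y := (1 + 4 * c₀ + 3 / ℓ₀) * A with hY
  have hY0 : 0 ≤ Y := le_trans (by positivity) hX1
  constructor
  · have hs : √2 * ε ≤ 1.5 := by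
      have h1 : √2 ≤ 1.5 := by
        rw [Real.sqrt_le_left (by norm_num)]; norm_num
      exact (mul_le_of_le_one_right (Real.sqrt_nonneg _) hε1).trans h1
    have hs2 : (√2 * ε) ^ 2 = 2 * ε ^ 2 := by
      rw [mul_pow, Real.sq_sqrt zero_le_two]
    rw [lamPrime, hs2]
    calc _ ≤ (2 + 2 / 3 * 1.5) * Y * n / (2 * ε ^ 2) := by gcongr
      _ = n * (3 / 2 * Y / ε ^ 2) := by field_simp; norm_num
      _ ≤ n * (8 * Y / ε ^ 2) := by gcongr; norm_num
      _ = _ := by rw [hY]; ring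
  · refine (lamStar_le hn hM hε0 hi0).trans ?_
    calc _ ≤ 8 * n * Y / ε ^ 2 := by gcongr
      _ = _ := by rw [hY]; ring

theorem le_lamPrime (hn : 2 ≤ n) (hM : 0 ≤ paramM d k δ) (hε0 : 0 < ε) (hε1 : ε ≤ 1)
    {ℓ' : ℝ} (hℓ₀ : 0 < ℓ₀) (hℓ : ℓ₀ ≤ ℓ') :
    ℓ₀ / 2 * n ≤ lamPrime n d k δ (√2 * ε) ℓ' := by
  have hL := half_le_log hn
  have hX0 := log_logb_nonneg hn
  have hs2 : (√2 * ε) ^ 2 = 2 * ε ^ 2 := by rw [mul_pow, Real.sq_sqrt zero_le_two]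
  have h1 : ℓ₀ / 2 ≤ paramM d k δ + ℓ' * Real.log n + Real.log (Real.logb 2 n) := by nlinarith
  have h2 : (2 : ℝ) ≤ 2 + 2 / 3 * (√2 * ε) := by
    have : 0 ≤ √2 * ε := by positivity
    linarith
  have h3 : 2 * ε ^ 2 ≤ 2 := by nlinarith
  rw [lamPrime, hs2, le_div_iff₀ (by positivity)]
  calc ℓ₀ / 2 * n * (2 * ε ^ 2) ≤ ℓ₀ / 2 * n * 2 := by gcongr
    _ = 2 * (ℓ₀ / 2) * n := by ring
    _ ≤ _ := by gcongr

/-- The sum of the costs of the search for `γ` and of at most `r` rounds. Here `A = M + ℓ ln n`,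
`L = ln n`, `S = max_v |S_v|`, the number `s` is the cost of the search for `γ`, and `X` is the sum
of the expected costs of the RR sets of the rounds. -/
theorem total_cost_le {n m d K S A L B ε ℓ₀ c₀ c₁ Cp s r X : ℝ} (hn : 2 ≤ n) (hm : 0 ≤ m)
    (hd0 : 0 ≤ d) (hd : d ≤ n * S) (hK : 1 ≤ K) (hS : 1 ≤ S) (hL : 1 / 2 ≤ L) (hε : 0 < ε)
    (hε1 : ε ≤ 1) (hℓ₀ : 0 < ℓ₀) (hc₀ : 0 ≤ c₀) (hCp : 0 ≤ Cp) (hLA : ℓ₀ * L ≤ A) (hB0 : 0 ≤ B)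
    (hs : s ≤ 12 * B) (hB : B * L ≤ c₀ * A) (hr : r ≤ 4 * L)
    (hX : X ≤ (c₁ * A / ε ^ 2 + 1) * (2 * (n + m)) * Cp) :
    n + 2 + s + (r * (32 * K * d) + 32 * K * S * X) ≤
      (132 / ℓ₀ + 24 * c₀ + 64 * (c₁ + 2 / ℓ₀) * Cp) * (K * S * A * (n + m) / ε ^ 2) := by
  have hA : ℓ₀ / 2 ≤ A := by nlinarith
  have hA0 : 0 < A := by linarith
  -- `Q` is the claimed bound, up to the constant.
  set Q : ℝ := K * S * A * (n + m) / ε ^ 2 with hQ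
  have hε2 : ε ^ 2 ≤ 1 := pow_le_one₀ hε.le hε1
  have hKS : 1 ≤ K * S := one_le_mul_of_one_le_of_one_le hK hS
  have hQ1 : K * S * (A * (n + m)) ≤ Q := by
    rw [hQ, le_div_iff₀ (by positivity), ← mul_assoc]
    exact mul_le_of_le_one_right (by positivity) hε2
  have hQ2 : A * n ≤ Q := by
    refine le_trans ?_ hQ1
    have h1 : A * n ≤ A * (n + m) := by gcongr; linarith
    exact h1.trans (le_mul_of_one_le_left (by positivity) hKS)
  have hone : 1 ≤ 2 / ℓ₀ * A := by
    rw [div_mul_eq_mul_div, le_div_iff₀ hℓ₀]; linarith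
  have e1 : n + 2 ≤ 4 / ℓ₀ * Q := by
    calc (n + 2 : ℝ) ≤ 1 * (2 * n) := by linarith
      _ ≤ 2 / ℓ₀ * A * (2 * n) := by gcongr
      _ = 4 / ℓ₀ * (A * n) := by ring
      _ ≤ _ := by gcongr
  have e2 : s ≤ 24 * c₀ * Q := by
    calc s ≤ 12 * B := hs
      _ ≤ 24 * (B * L) := by nlinarith
      _ ≤ 24 * (c₀ * A) := by gcongr
      _ ≤ 24 * (c₀ * (A * n)) := by
          gcongr
          exact le_mul_of_one_le_right hA0.le (by linarith)
      _ ≤ 24 * (c₀ * Q) := by gcongr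
      _ = _ := by ring
  have e3 : r * (32 * K * d) ≤ 128 / ℓ₀ * Q := by
    calc _ ≤ 4 * L * (32 * K * (n * S)) := by gcongr
      _ = 128 * (K * S * (L * n)) := by ring
      _ ≤ 128 * (K * S * (1 / ℓ₀ * A * (n + m))) := by
          have h1 : L ≤ 1 / ℓ₀ * A := by
            rw [div_mul_eq_mul_div, le_div_iff₀ hℓ₀]; linarith
          gcongr
          linarith
      _ = 128 / ℓ₀ * (K * S * (A * (n + m))) := by ring
      _ ≤ _ := by gcongr
  have e4 : 32 * K * S * ((c₁ * A / ε ^ 2 + 1) * (2 * (n + m)) * Cp) ≤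
      64 * (c₁ + 2 / ℓ₀) * Cp * Q := by
    have h1 : 1 ≤ 2 / ℓ₀ * A / ε ^ 2 := by
      rw [le_div_iff₀ (by positivity)]; linarith
    calc _ ≤ 32 * K * S * ((c₁ * A / ε ^ 2 + 2 / ℓ₀ * A / ε ^ 2) * (2 * (n + m)) * Cp) := by
          gcongr
      _ = _ := by rw [hQ]; ring
  have e5 := mul_le_mul_of_nonneg_left hX (show 0 ≤ 32 * K * S by positivity)
  have e6 : (132 / ℓ₀ + 24 * c₀ + 64 * (c₁ + 2 / ℓ₀) * Cp) * Q =
      4 / ℓ₀ * Q + 24 * c₀ * Q + 128 / ℓ₀ * Q + 64 * (c₁ + 2 / ℓ₀) * Cp * Q := by ring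
  rw [e6]
  linarith

end Parameters

/-- The weight of a round is compared with an increment of `z ↦ z / (1 + z)` along a doubling of
`z`, so that the sum over the rounds telescopes. -/
theorem mul_slowProb_le {lam' κ : ℝ} (hn : 0 < n) (hκ : 0 < κ) (hlam : κ * n ≤ lam')
    {x : Fin d → ℝ} (hg : 0 ≤ P.g x) {i : ℕ} (hi : 1 ≤ i) :
    2 ^ i * P.g x / n * P.slowProb x lam' i ≤ (561 + 6144 / κ ^ 2) *
      (2 ^ (i + 1) * P.g x / n / (1 + 2 ^ (i + 1) * P.g x / n) -
        2 ^ i * P.g x / n / (1 + 2 ^ i * P.g x / n)) := by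
  have hn0 : (0 : ℝ) < n := by exact_mod_cast hn
  have hz2 : 2 ^ (i + 1) * P.g x / n = 2 * (2 ^ i * P.g x / n) := by ring
  have hz0 : 0 ≤ 2 ^ i * P.g x / n := by positivity
  rw [hz2]
  unfold slowProb
  obtain ⟨i, rfl⟩ := Nat.exists_eq_add_of_le' hi
  have hN : κ * 2 ^ i ≤ loopSize n lam' i := by
    rw [loopSize]
    push_cast
    refine le_trans ?_ (Nat.lt_floor_add_one _).le
    rw [le_div_iff₀ (by positivity)]
    calc κ * 2 ^ i * (n / 2 ^ i) = κ * n := by field_simp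
      _ ≤ _ := hlam
  have hu : κ * (2 ^ (i + 1) * P.g x / n) / 16 ≤ loopSize n lam' i * (P.g x / n) / 8 := by
    calc κ * (2 ^ (i + 1) * P.g x / n) / 16 = κ * 2 ^ i * (P.g x / n) / 8 := by
          rw [pow_succ]; ring
      _ ≤ _ := by gcongr
  simp only [Nat.add_sub_cancel]
  set z := 2 ^ (i + 1) * P.g x / n
  have hφ : 2 * z / (1 + 2 * z) - z / (1 + z) = z * (1 / ((1 + 2 * z) * (1 + z))) := by
    field_simp; ring
  rw [hφ, mul_left_comm]
  refine mul_le_mul_of_nonneg_left ?_ hz0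
  rw [mul_one_div, le_div_iff₀ (by positivity)]
  have hκ2 : 0 ≤ 6144 / κ ^ 2 := by positivity
  split_ifs with hz
  · -- `(1 + 2z)(1 + z) ≤ 33 * 17 = 561`
    nlinarith
  · rw [not_lt] at hz
    have hz' : 0 < z := by linarith
    set w := κ * z / 16 with hw
    have hw0 : 0 < w := by positivity
    have h1 : 2 * Real.exp (-(loopSize n lam' i * (P.g x / n) / 8)) ≤ 4 / w ^ 2 := by
      calc _ ≤ 2 * Real.exp (-w) := by gcongr
        _ ≤ 2 * (2 / w ^ 2) := by
          rw [Real.exp_neg, ← one_div]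
          refine mul_le_mul_of_nonneg_left ?_ zero_le_two
          rw [div_le_div_iff₀ (Real.exp_pos _) (by positivity)]
          have := Real.quadratic_le_exp_of_nonneg hw0.le
          linarith
        _ = _ := by ring
    calc _ ≤ 4 / w ^ 2 * (6 * z ^ 2) := by
          have h2 : (1 + 2 * z) * (1 + z) ≤ 6 * z ^ 2 := by nlinarith
          exact mul_le_mul h1 h2 (by positivity) (by positivity)
      _ = 6144 / κ ^ 2 := by rw [hw]; field_simp; norm_num
      _ ≤ _ := by linarith

theorem sum_mul_slowProb_le {lam' κ : ℝ} (hn : 0 < n) (hκ : 0 < κ) (hlam : κ * n ≤ lam')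
    {x : Fin d → ℝ} (hg : 0 ≤ P.g x) (I : ℕ) :
    ∑ i ∈ Finset.Icc 1 I, 2 ^ i * P.g x / n * P.slowProb x lam' i ≤ 561 + 6144 / κ ^ 2 := by
  have hn0 : (0 : ℝ) < n := by exact_mod_cast hn
  set φ : ℕ → ℝ := fun i => 2 ^ i * P.g x / n / (1 + 2 ^ i * P.g x / n) with hφ
  calc _ ≤ ∑ i ∈ Finset.Icc 1 I, (561 + 6144 / κ ^ 2) * (φ (i + 1) - φ i) :=
        Finset.sum_le_sum fun i hi => P.mul_slowProb_le hn hκ hlam hg (Finset.mem_Icc.1 hi).1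
    _ = (561 + 6144 / κ ^ 2) * ∑ i ∈ Finset.Ico 1 (I + 1), (φ (i + 1) - φ i) := by
        rw [← Finset.mul_sum, Finset.Ico_add_one_right_eq_Icc]
    _ = (561 + 6144 / κ ^ 2) * (φ (I + 1) - φ 1) := by
        rw [Finset.sum_Ico_sub _ (by omega)]
    _ ≤ (561 + 6144 / κ ^ 2) * 1 := by
        refine mul_le_mul_of_nonneg_left ?_ (by positivity)
        have h1 : 0 ≤ φ 1 := by simp only [hφ]; positivity
        have h2 : φ (I + 1) ≤ 1 := by
          have h3 : 0 ≤ 2 ^ (I + 1) * P.g x / n := by positivity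
          simp only [hφ]
          rw [div_le_one (by positivity)]
          linarith
        linarith
    _ = _ := mul_one _

theorem card_strategies_le (hS : ∀ j, ∃ v, j ∈ P.S v) : d ≤ n * P.maxS := by
  have h : (Finset.univ : Finset (Fin d)) ⊆ Finset.univ.biUnion P.S := fun j _ =>
    Finset.mem_biUnion.2 ((hS j).imp fun v hv => ⟨Finset.mem_univ v, hv⟩)
  calc d = (Finset.univ : Finset (Fin d)).card := by simp
    _ ≤ _ := Finset.card_le_card h
    _ ≤ (Finset.univ : Finset (Fin n)).card * P.maxS :=
        Finset.card_biUnion_le_card_mul _ _ _ fun v _ => P.card_S_le_maxS v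
    _ = _ := by simp

theorem loopSize_le {Λ : ℝ} (hΛ : 0 ≤ Λ) (hn : 0 < n) (i : ℕ) :
    (loopSize n Λ i : ℝ) ≤ (Λ / n + 1) * 2 ^ i := by
  have hn0 : (0 : ℝ) < n := by exact_mod_cast hn
  rw [loopSize]
  push_cast
  have h1 : (⌊Λ / (n / 2 ^ i)⌋₊ : ℝ) ≤ Λ / n * 2 ^ i := by
    refine (Nat.floor_le (by positivity)).trans_eq ?_
    field_simp
  have h2 : (1 : ℝ) ≤ 2 ^ i := one_le_pow₀ one_le_two
  linarith

variable [NeZero n]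

theorem g_le_card {x : Fin d → ℝ} (hx : ∀ j, 0 ≤ x j) : P.g x ≤ n := by
  rw [P.g_eq]
  refine mul_le_of_le_one_right (Nat.cast_nonneg n) ?_
  calc _ ≤ ∫ _, (1 : ℝ) ∂P.drawLaw :=
        integral_mono Integrable.of_finite Integrable.of_finite (P.hit_le_one hx)
    _ = 1 := by simp

/-- The sum of the expected costs of the rounds. -/
theorem sum_round_cost_le {lam' Λ κ : ℝ} (hκ : 0 < κ) (hlam : κ * n ≤ lam') (hΛ : 0 ≤ Λ)
    {x : Fin d → ℝ} (hg : 0 ≤ P.g x) (hU : ∀ v, P.spread {v} ≤ P.g x) (I : ℕ) :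
    ∑ i ∈ Finset.Icc 1 I, loopSize n Λ i * ((∫ ω, (P.rrCost ω : ℝ) ∂P.drawLaw) *
      P.slowProb x lam' i) ≤
      (Λ / n + 1) * (2 * (n + P.numEdges)) * (561 + 6144 / κ ^ 2) := by
  have hn : 0 < n := NeZero.pos n
  have hn0 : (0 : ℝ) < n := by exact_mod_cast hn
  calc _ ≤ ∑ i ∈ Finset.Icc 1 I, (Λ / n + 1) * (2 * (n + P.numEdges)) *
          (2 ^ i * P.g x / n * P.slowProb x lam' i) := by
        refine Finset.sum_le_sum fun i _ => ?_
        have hp := P.slowProb_nonneg x lam' i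
        have h1 := loopSize_le hΛ hn i
        have h2 := P.integral_rrCost_le hU
        have h3 : 0 ≤ ∫ ω, (P.rrCost ω : ℝ) ∂P.drawLaw :=
          integral_nonneg fun _ => Nat.cast_nonneg _
        calc _ ≤ (Λ / n + 1) * 2 ^ i * (2 * (n + P.numEdges) * P.g x / n *
              P.slowProb x lam' i) := by gcongr
          _ = _ := by ring
    _ ≤ _ := by
        rw [← Finset.mul_sum]
        exact mul_le_mul_of_nonneg_left (P.sum_mul_slowProb_le hn hκ hlam hg I) (by positivity)

/-- The bound for the expected running time. -/
theorem lintegral_immPRR_steps_le [NeZero d] {c ℓ₀ : ℝ} (hc : 0 < c) (hℓ₀ : 0 < ℓ₀) {K : ℕ}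
    {k δ ε ℓ : ℝ} (hn : 2 ≤ n) (hK : 1 ≤ K) (hδ : 0 < δ) (hk : k = K * δ)
    (hεc : (n : ℝ) ^ (-c) ≤ ε) (hε1 : ε ≤ 1) (hℓ : ℓ₀ ≤ ℓ) (hS : ∀ j, ∃ v, j ∈ P.S v)
    (hopt : ∀ v, ∃ x, Feasible k δ x ∧ P.spread {v} ≤ P.g x) :
    ∫⁻ ω, ((P.immPRR k δ ε ℓ ω).steps : ℝ≥0∞) ∂P.tape ≤
      ENNReal.ofReal ((132 / ℓ₀ + 24 * ((6 + 2 * c) / ℓ₀ + 1) +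
        64 * (8 * (1 + 4 * ((6 + 2 * c) / ℓ₀ + 1) + 3 / ℓ₀) + 2 / ℓ₀) *
          (561 + 6144 / (ℓ₀ / 2) ^ 2)) *
        (k / δ * P.maxS * (paramM d k δ + ℓ * Real.log n) * (n + P.numEdges) / ε ^ 2)) := by
  have hn0 : (0 : ℝ) < n := by positivity
  have hn2 : (2 : ℝ) ≤ n := by exact_mod_cast hn
  have hε0 : 0 < ε := (Real.rpow_pos_of_pos hn0 _).trans_le hεc
  have hℓ0 : 0 < ℓ := hℓ₀.trans_le hℓ
  have hM : 0 ≤ paramM d k δ := paramM_nonneg hδ hk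
  have hkδ : k / δ = K := by rw [hk, mul_div_cancel_right₀ _ hδ.ne']
  have hL := half_le_log hn
  have hd := P.card_strategies_le hS
  have hmaxS : 1 ≤ P.maxS := by
    rcases Nat.eq_zero_or_pos P.maxS with h | h
    · rw [h, mul_zero] at hd
      exact absurd (NeZero.pos d) (by omega)
    · exact h
  obtain ⟨a, ha, hamax⟩ := P.exists_optimum K δ
  have ha0 := latticeMix_nonneg hδ.le a
  have hU : ∀ v, P.spread {v} ≤ P.g (latticeMix δ a) := by
    intro v
    obtain ⟨x, hx, hxv⟩ := hopt v
    obtain ⟨b, hb, rfl⟩ := (feasible_iff hδ hk x).1 hx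
    exact hxv.trans (hamax b hb)
  have hinner : ℓ₀ ≤ innerConf n d k δ ε ℓ := by
    have h1 := (findGamma_spec hn hM hc.le hεc hℓ0).1
    have h2 : 0 ≤ Real.log 2 / Real.log n := div_nonneg (Real.log_nonneg one_le_two) (by linarith)
    rw [innerConf]
    linarith
  have hsteps := (findGamma_spec hn hM hc.le hεc hℓ0).2.2.2
  have hB := findGamma_bound_mul_log_le hn hM hc.le hℓ₀ hℓ
  obtain ⟨hΛ1, hΛ2⟩ := sample_bounds hn hM hc.le hεc hε0 hε1 hℓ₀ hℓ
  have hlam := le_lamPrime (k := k) (δ := δ) (d := d) hn hM hε0 hε1 hℓ₀ hinner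
  have hlam0 := lamPrime_nonneg (k := k) (δ := δ) (d := d) hn hM
    (mul_pos (Real.sqrt_pos.2 zero_lt_two) hε0) (hℓ₀.le.trans hinner)
  refine (P.lintegral_steps_le hn hK hδ hk hε0 hε1 hmaxS ha (P.g_le_card ha0) rfl hlam0
    hΛ1 hΛ2).trans (ENNReal.ofReal_le_ofReal ?_)
  have hB0 : 0 ≤ 6 + 2 * c + ℓ + paramM d k δ / Real.log n := by positivity
  have hmain := P.sum_round_cost_le (half_pos hℓ₀) hlam (hlam0.trans hΛ1)
    (P.g_nonneg ha0) hU (1 + Nat.log 2 n)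
  rw [mul_div_cancel_left₀ _ hn0.ne'] at hmain
  have hlog : ((1 + Nat.log 2 n : ℕ) : ℝ) ≤ 4 * Real.log n := by
    have h1 : (Nat.log 2 n : ℝ) ≤ Real.logb 2 n := by exact_mod_cast Real.natLog_le_logb n 2
    have h2 : (1 : ℝ) ≤ Real.logb 2 n := by
      rw [Real.le_logb_iff_rpow_le one_lt_two hn0]; simpa using hn2
    have h3 : Real.logb 2 n ≤ 2 * Real.log n := by
      have := Real.log_two_gt_d9
      rw [Real.logb, div_le_iff₀ (by linarith)]
      nlinarith
    push_cast
    linarith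
  rw [hkδ]
  have hd' : (d : ℝ) ≤ n * P.maxS := by exact_mod_cast hd
  have hmaxS' : (1 : ℝ) ≤ P.maxS := by exact_mod_cast hmaxS
  have hK' : (1 : ℝ) ≤ K := by exact_mod_cast hK
  have hm0 : (0 : ℝ) ≤ P.numEdges := Nat.cast_nonneg _
  have hLA : ℓ₀ * Real.log n ≤ paramM d k δ + ℓ * Real.log n := by nlinarith
  have hsplit : ∀ t : ℕ → ℝ, ∑ i ∈ Finset.Icc 1 (1 + Nat.log 2 n),
      32 * (K * (d + P.maxS * t i)) = ((1 + Nat.log 2 n : ℕ) : ℝ) * (32 * K * d) +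
        32 * K * P.maxS * ∑ i ∈ Finset.Icc 1 (1 + Nat.log 2 n), t i := by
    intro t
    rw [Finset.mul_sum, ← nsmul_eq_mul]
    nth_rewrite 2 [← Nat.add_sub_cancel (n := 1 + Nat.log 2 n) (m := 1)]
    rw [← Nat.card_Icc, ← Finset.sum_const, ← Finset.sum_add_distrib]
    exact Finset.sum_congr rfl fun i _ => by ring
  refine (add_le_add le_rfl (hsplit _).le).trans ?_
  exact total_cost_le hn2 hm0 (Nat.cast_nonneg d) hd' hK' hmaxS' hL hε0 hε1 hℓ₀ (by positivity)
    (by positivity) hLA hB0 hsteps hB hlog hmain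

end LIM

end

theorem theorem1 :
    (∀ (n d : ℕ) [NeZero n] [NeZero d] (P : LIM n d) (K : ℕ) (k δ ε ℓ : ℝ),
      2 ≤ n → 2 ≤ K → 0 < δ → k = K * δ → 0 < ε → 0 < ℓ →
      1 - 1 / (n : ℝ) ^ ℓ ≤
        P.tape.real {ω | P.IsApproxSolution k δ (1 - 1 / Real.exp 1 - ε)
          (P.immPRR k δ ε ℓ ω).val}) ∧
    (∀ c ℓ₀ : ℝ, 0 < c → 0 < ℓ₀ → ∃ C : ℝ, 0 < C ∧
      ∀ (n d : ℕ) [NeZero n] [NeZero d] (P : LIM n d) (K : ℕ) (k δ ε ℓ : ℝ),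
        2 ≤ n → 1 ≤ K → 0 < δ → k = K * δ →
        (n : ℝ) ^ (-c) ≤ ε → ε ≤ 1 → ℓ₀ ≤ ℓ →
        (∀ j, ∃ v, j ∈ P.S v) →
        (∀ v, ∃ x, Feasible k δ x ∧ P.spread {v} ≤ P.g x) →
        ∫⁻ ω, ((P.immPRR k δ ε ℓ ω).steps : ℝ≥0∞) ∂P.tape ≤
          ENNReal.ofReal (C * (k / δ * P.maxS * (paramM d k δ + ℓ * Real.log n) *
            (n + P.numEdges) / ε ^ 2))) := by
  refine ⟨fun n d _ _ P K k δ ε ℓ hn hK hδ hk hε hℓ => P.immPRR_approx hn hK hδ hk hε hℓ,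
    fun c ℓ₀ hc hℓ₀ => ⟨_, ?_, fun n d _ _ P K k δ ε ℓ hn hK hδ hk hεc hε1 hℓ hS hopt =>
      P.lintegral_immPRR_steps_le hc hℓ₀ hn hK hδ hk hεc hε1 hℓ hS hopt⟩⟩
  positivity
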